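/- Let $\mathbb K$ be a field of characteristic zero and let $L$ be a (right) Leibniz algebra over $\mathbb K$, i.e. a vector space with a bilinear bracket satisfying $[x,[y,z]]=[[x,y],z]-[[x,z],y]$. Let $HL^n(L;L)$ be the Leibniz cohomology of $L$ with coefficients in itself, and assume that $\mathbb H=HL^2(L;L)$ is finite-dimensional. A prime denotes the dual vector space. **Definitions.** Let $A$ be a commutative unital $\mathbb K$-algebra with an augmentation $\varepsilon:A\to\mathbb K$ and $\mathfrak M=\ker\varepsilon$; homomorphisms of such algebras are unital $\mathbb K$-algebra homomorphisms compatible with the augmentations. A *deformation of $L$ with base $A$* is an $A$-bilinear Leibniz bracket on $A\otimes L$ such that $\varepsilon\otimes\mathrm{id}:A\otimes L\to L$ preserves brackets. The *push-out* $\varphi_*\lambda$ along $\varphi:A\to A'$ is the deformation with base $A'$ obtained from $A'\otimes L=A'\otimes_A(A\otimes L)$. A *complete local algebra* is a local $A$ as above with $A=\varprojlim A/\mathfrak M^n$ and $\dim(\mathfrak M^k/\mathfrak M^{k+1})<\infty$ for all $k$. A *formal deformation of $L$ with base $A$* is an $A$-Leibniz algebra structure on $A\hat\otimes L=\varprojlim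 (A/\mathfrak M^n)\otimes L$ which is the projective limit of a system of deformations with bases $A/\mathfrak M^n$ compatible with the projections; push-outs are taken level by level. Two formal deformations with base $A$ are *equivalent* if there is an isomorphism of $A$-Leibniz algebras between them that commutes with $\varepsilon\otimes\mathrm{id}:A\hat\otimes L\to L$. A formal deformation $\eta$ with base $C$ is *versal* if (i) for every complete local algebra $A$ and every formal deformation $\lambda$ of $L$ with base $A$ there is a homomorphism $f:C\to A$ such that $\lambda$ is equivalent to $f_*\eta$; and (ii) $f$ is unique whenever $\mathfrak M^2=0$ in $A$. **Obstruction map.** Let $A$ be finite-dimensional and local and let $\lambda$ be a deformation of $L$ with base $A$. Let $H^2_{Harr}(A;\mathbb K)$ be the space of symmetric bilinear maps $f:A\times A\to\mathbb K$ with $\varepsilon(a)f(b,c)-f(ab,c)+f(a,bc)-f(a,b)\varepsilon(c)=0$, modulo the maps $(a,b)\mapsto\varepsilon(a)g(b)-g(ab)+\varepsilon(b)g(a)$ with $g:A\to\mathbb K$ linear. A cocycle $f$ gives an extension $0\to\mathbb K\to B\to A\to0$, where $B=A\oplus\mathbb K$ with product $(a,s)(b,t)=(ab,\varepsilon(a)t+\varepsilon(b)s+f(a,b))$.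 Lift the bracket of $\lambda$ to a $B$-bilinear operation $\{\,,\}$ on $B\otimes L$. Its defect $\{x,\{y,z\}\}-\{\{x,y\},z\}+\{\{x,z\},y\}$ on $1\otimes L$ takes values in $\mathbb K\otimes L=L$ and is a cocycle in $CL^3(L;L)$; its class is $\theta_\lambda([f])$. This defines the linear map $\theta_\lambda:H^2_{Harr}(A;\mathbb K)\to HL^3(L;L)$. **Construction.** Choose a linear map $\mu$ sending each class in $\mathbb H$ to a representing cocycle. Put $C_1=\mathbb K\oplus\mathbb H'$ with $\mathbb H'\cdot\mathbb H'=0$, and let $\eta_1$ be the deformation with base $C_1$ given by $$[1\otimes x,1\otimes y]=1\otimes[x,y]+\sum_i g_i\otimes\mu(h_i)(x,y),$$ where $(h_i)$ is a basis of $\mathbb H$ and $(g_i)$ is the dual basis of $\mathbb H'$. Given $(C_k,\eta_k)$, put $\omega_k=\theta_{\eta_k}:H^2_{Harr}(C_k;\mathbb K)\to HL^3(L;L)$. Choose a linear map sending each class in $H^2_{Harr}(C_k;\mathbb K)$ to a representing cocycle. Its dual is a 2-cocycle with values in $H^2_{Harr}(C_k;\mathbb K)'$, which defines an extension $0\to H^2_{Harr}(C_k;\mathbb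 K)'\xrightarrow{\ \bar i\ }\bar C_{k+1}\to C_k\to0$. Put $C_{k+1}=\bar C_{k+1}/\bar i\,\omega_k'(HL^3(L;L)')$, with projection $p_{k+1}:C_{k+1}\to C_k$, and choose a deformation $\eta_{k+1}$ of $L$ with base $C_{k+1}$ such that $(p_{k+1})_*\eta_{k+1}=\eta_k$. Put $C=\varprojlim C_k$. **Theorem.** Assume $\dim\mathbb H<\infty$. The choices in the construction can always be made. For every system of choices, $C$ is a complete local algebra, there is exactly one formal deformation $\eta$ of $L$ with base $C$ whose push-out to $C_k$ is $\eta_k$ for every $k$ (the projective limit of the $\eta_k$), and $\eta$ is a versal deformation of $L$: every formal deformation $\lambda$ of $L$ with a complete local base $A$ is equivalent to $\varphi_*\eta$ for some homomorphism $\varphi:C\to A$, and $\varphi$ is unique if $\mathfrak M^2=0$ in $A$. -/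

import Mathlib

set_option maxSynthPendingDepth 3

open scoped TensorProduct

universe u v w

noncomputable section

namespace LeibnizDeformation

/-! ### Leibniz algebras and their cohomology with coefficients in themselves -/

/-- An `R`-Leibniz algebra structure on the `R`-module `V`:
`[x,[y,z]] = [[x,y],z] - [[x,z],y]`. -/
@[ext]
structure LeibnizBracket (R : Type*) (V : Type*) [CommRing R] [AddCommGroup V] [Module R V] where
  bracket : V →ₗ[R] V →ₗ[R] V
  leibniz : ∀ x y z : V,
    bracket x (bracket y z) = bracket (bracket x y) z - bracket (bracket x z) y

section Cohomology

variable {K : Type u} [Field K] {L : Type v} [AddCommGroup L] [Module K L]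
variable (br : LeibnizBracket K L)

/-- The coboundary of a `1`-cochain. -/
def d1 (f : L →ₗ[K] L) (x y : L) : L :=
  br.bracket x (f y) + br.bracket (f x) y - f (br.bracket x y)

/-- The coboundary of a `2`-cochain. -/
def d2 (f : L →ₗ[K] L →ₗ[K] L) (x y z : L) : L :=
  br.bracket x (f y z) + br.bracket (f x z) y - br.bracket (f x y) z
    - f (br.bracket x y) z + f (br.bracket x z) y + f x (br.bracket y z)

/-- The coboundary of a `3`-cochain. -/
def d3 (f : L →ₗ[K] L →ₗ[K] L →ₗ[K] L) (x y z t : L) : L :=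
  br.bracket x (f y z t) + br.bracket (f x z t) y - br.bracket (f x y t) z
    + br.bracket (f x y z) t
    - f (br.bracket x y) z t + f (br.bracket x z) y t + f x (br.bracket y z) t
    - f (br.bracket x t) y z - f x (br.bracket y t) z - f x y (br.bracket z t)

/-- The `2`-cocycles in `CL²(L;L)`. -/
def Z2 : Submodule K (L →ₗ[K] L →ₗ[K] L) where
  carrier := {f | ∀ x y z, d2 br f x y z = 0}
  add_mem' {f g} hf hg x y z := by
    have h : d2 br (f + g) x y z = d2 br f x y z + d2 br g x y z := by
      simp only [d2, LinearMap.add_apply, map_add]; abel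
    rw [h, hf, hg, add_zero]
  zero_mem' x y z := by simp [d2]
  smul_mem' c f hf x y z := by
    have h : d2 br (c • f) x y z = c • d2 br f x y z := by
      simp only [d2, LinearMap.smul_apply, map_smul, smul_add, smul_sub]
    rw [h, hf, smul_zero]

/-- The `2`-coboundaries in `CL²(L;L)`. -/
def B2 : Submodule K (L →ₗ[K] L →ₗ[K] L) where
  carrier := {f | ∃ g : L →ₗ[K] L, ∀ x y, f x y = d1 br g x y}
  add_mem' := by
    rintro f f' ⟨g, hg⟩ ⟨g', hg'⟩
    refine ⟨g + g', fun x y => ?_⟩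
    simp only [LinearMap.add_apply, hg, hg', d1, map_add]; abel
  zero_mem' := ⟨0, fun x y => by simp [d1]⟩
  smul_mem' := by
    rintro c f ⟨g, hg⟩
    refine ⟨c • g, fun x y => ?_⟩
    simp only [LinearMap.smul_apply, hg, d1, map_smul, smul_add, smul_sub]

/-- The `3`-cocycles in `CL³(L;L)`. -/
def Z3 : Submodule K (L →ₗ[K] L →ₗ[K] L →ₗ[K] L) where
  carrier := {f | ∀ x y z t, d3 br f x y z t = 0}
  add_mem' {f g} hf hg x y z t := by
    have h : d3 br (f + g) x y z t = d3 br f x y z t + d3 br g x y z t := by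
      simp only [d3, LinearMap.add_apply, map_add]; abel
    rw [h, hf, hg, add_zero]
  zero_mem' x y z t := by simp [d3]
  smul_mem' c f hf x y z t := by
    have h : d3 br (c • f) x y z t = c • d3 br f x y z t := by
      simp only [d3, LinearMap.smul_apply, map_smul, smul_add, smul_sub]
    rw [h, hf, smul_zero]

/-- The `3`-coboundaries in `CL³(L;L)`. -/
def B3 : Submodule K (L →ₗ[K] L →ₗ[K] L →ₗ[K] L) where
  carrier := {f | ∃ g : L →ₗ[K] L →ₗ[K] L, ∀ x y z, f x y z = d2 br g x y z}
  add_mem' := by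
    rintro f f' ⟨g, hg⟩ ⟨g', hg'⟩
    refine ⟨g + g', fun x y z => ?_⟩
    simp only [LinearMap.add_apply, hg, hg', d2, map_add]; abel
  zero_mem' := ⟨0, fun x y z => by simp [d2]⟩
  smul_mem' := by
    rintro c f ⟨g, hg⟩
    refine ⟨c • g, fun x y z => ?_⟩
    simp only [LinearMap.smul_apply, hg, d2, map_smul, smul_add, smul_sub]

/-- `HL²(L;L)`. -/
abbrev HL2 : Type v := Z2 br ⧸ (B2 br).submoduleOf (Z2 br)

/-- `HL³(L;L)`. -/
abbrev HL3 : Type v := Z3 br ⧸ (B3 br).submoduleOf (Z3 br)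

end Cohomology

/-! ### Bilinear operations on `A ⊗ L` -/

section Tensor

variable {K : Type*} [Field K] {L : Type*} [AddCommGroup L] [Module K L]
variable {A : Type*} [CommRing A] [Algebra K A]
variable {A' : Type*} [CommRing A'] [Algebra K A']

/-- `r ⊗ id : A ⊗ L → K ⊗ L = L` for a linear form `r` on `A`. -/
def coeff (L : Type*) [AddCommGroup L] [Module K L] (r : A →ₗ[K] K) : A ⊗[K] L →ₗ[K] L :=
  (TensorProduct.lid K L).toLinearMap ∘ₗ r.rTensor L

@[simp]
theorem coeff_tmul (r : A →ₗ[K] K) (a : A) (l : L) : coeff L r (a ⊗ₜ l) = r a • l := by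
  simp [coeff]

/-- `φ ⊗ id : A ⊗ L → A' ⊗ L`. -/
def baseMap (L : Type*) [AddCommGroup L] [Module K L] (φ : A →ₗ[K] A') :
    A ⊗[K] L →ₗ[K] A' ⊗[K] L :=
  φ.rTensor L

@[simp]
theorem baseMap_tmul (φ : A →ₗ[K] A') (a : A) (l : L) :
    baseMap L φ (a ⊗ₜ l) = φ a ⊗ₜ l := by
  simp [baseMap]

/-- The `A`-bilinear operation on `A ⊗ L` with prescribed values on `1 ⊗ l₁, 1 ⊗ l₂`. -/
def bilinExt (Λ : L →ₗ[K] L →ₗ[K] A ⊗[K] L) :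
    A ⊗[K] L →ₗ[A] A ⊗[K] L →ₗ[A] A ⊗[K] L :=
  LinearMap.liftBaseChange A
    (((LinearMap.liftBaseChangeEquiv (R := K) (M := L) (N := A ⊗[K] L) A).toLinearMap.restrictScalars
      K) ∘ₗ Λ)

@[simp]
theorem bilinExt_tmul (Λ : L →ₗ[K] L →ₗ[K] A ⊗[K] L) (a b : A) (x y : L) :
    bilinExt Λ (a ⊗ₜ x) (b ⊗ₜ y) = a • b • Λ x y := by
  simp [bilinExt]

/-- The restriction of an `A`-bilinear operation to `1 ⊗ L`. -/
def gen (b : A ⊗[K] L →ₗ[A] A ⊗[K] L →ₗ[A] A ⊗[K] L) : L →ₗ[K] L →ₗ[K] A ⊗[K] L :=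
  LinearMap.mk₂ K (fun x y => b (1 ⊗ₜ x) (1 ⊗ₜ y))
    (fun x x' y => by simp [TensorProduct.tmul_add])
    (fun c x y => by
      rw [← TensorProduct.smul_tmul, ← mul_one (c • (1 : A)), ← smul_eq_mul,
        ← TensorProduct.smul_tmul', map_smul]
      simp)
    (fun x y y' => by simp [TensorProduct.tmul_add])
    (fun c x y => by
      rw [← TensorProduct.smul_tmul, ← mul_one (c • (1 : A)), ← smul_eq_mul,
        ← TensorProduct.smul_tmul', map_smul]
      simp)

@[simp]
theorem gen_apply (b : A ⊗[K] L →ₗ[A] A ⊗[K] L →ₗ[A] A ⊗[K] L) (x y : L) :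
    gen b x y = b (1 ⊗ₜ x) (1 ⊗ₜ y) := rfl

theorem bilin_tmul (b : A ⊗[K] L →ₗ[A] A ⊗[K] L →ₗ[A] A ⊗[K] L) (r s : A) (x y : L) :
    b (r ⊗ₜ x) (s ⊗ₜ y) = r • s • b (1 ⊗ₜ x) (1 ⊗ₜ y) := by
  have h : ∀ (t : A) (z : L), (t ⊗ₜ[K] z) = t • ((1 : A) ⊗ₜ[K] z) := fun t z => by
    rw [TensorProduct.smul_tmul', smul_eq_mul, mul_one]
  rw [h r, h s]
  simp only [map_smul, LinearMap.smul_apply]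
  exact smul_comm _ _ _

/-- The defect of the Leibniz identity. -/
def leibnizator (b : A ⊗[K] L →ₗ[A] A ⊗[K] L →ₗ[A] A ⊗[K] L) (x y z : A ⊗[K] L) : A ⊗[K] L :=
  b x (b y z) - b (b x y) z + b (b x z) y

theorem leibnizator_tmul (b : A ⊗[K] L →ₗ[A] A ⊗[K] L →ₗ[A] A ⊗[K] L) (r s t : A) (x y z : L) :
    leibnizator b (r ⊗ₜ x) (s ⊗ₜ y) (t ⊗ₜ z)
      = (r * s * t) • leibnizator b (1 ⊗ₜ x) (1 ⊗ₜ y) (1 ⊗ₜ z) := by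
  have h : ∀ (t : A) (z : L), (t ⊗ₜ[K] z) = t • ((1 : A) ⊗ₜ[K] z) := fun t z => by
    rw [TensorProduct.smul_tmul', smul_eq_mul, mul_one]
  rw [h r, h s, h t]
  simp only [leibnizator, map_smul, LinearMap.smul_apply]
  module

theorem leibnizator_add_left (b : A ⊗[K] L →ₗ[A] A ⊗[K] L →ₗ[A] A ⊗[K] L)
    (x x' y z : A ⊗[K] L) :
    leibnizator b (x + x') y z = leibnizator b x y z + leibnizator b x' y z := by
  simp only [leibnizator, map_add, LinearMap.add_apply]; abel

theorem leibnizator_add_mid (b : A ⊗[K] L →ₗ[A] A ⊗[K] L →ₗ[A] A ⊗[K] L)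
    (x y y' z : A ⊗[K] L) :
    leibnizator b x (y + y') z = leibnizator b x y z + leibnizator b x y' z := by
  simp only [leibnizator, map_add, LinearMap.add_apply]; abel

theorem leibnizator_add_right (b : A ⊗[K] L →ₗ[A] A ⊗[K] L →ₗ[A] A ⊗[K] L)
    (x y z z' : A ⊗[K] L) :
    leibnizator b x y (z + z') = leibnizator b x y z + leibnizator b x y z' := by
  simp only [leibnizator, map_add, LinearMap.add_apply]; abel

theorem leibnizator_eq_zero (b : A ⊗[K] L →ₗ[A] A ⊗[K] L →ₗ[A] A ⊗[K] L)
    (h : ∀ x y z : L, leibnizator b (1 ⊗ₜ x) (1 ⊗ₜ y) (1 ⊗ₜ z) = 0) (x y z : A ⊗[K] L) :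
    leibnizator b x y z = 0 := by
  induction x using TensorProduct.induction_on with
  | zero => simp [leibnizator]
  | add x x' hx hx' => rw [leibnizator_add_left, hx, hx', add_zero]
  | tmul r x =>
    induction y using TensorProduct.induction_on with
    | zero => simp [leibnizator]
    | add y y' hy hy' => rw [leibnizator_add_mid, hy, hy', add_zero]
    | tmul s y =>
      induction z using TensorProduct.induction_on with
      | zero => simp [leibnizator]
      | add z z' hz hz' => rw [leibnizator_add_right, hz, hz', add_zero]
      | tmul t z => rw [leibnizator_tmul, h, smul_zero]

theorem leibnizator_eq_zero_iff {b : A ⊗[K] L →ₗ[A] A ⊗[K] L →ₗ[A] A ⊗[K] L}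
    {x y z : A ⊗[K] L} :
    leibnizator b x y z = 0 ↔ b x (b y z) = b (b x y) z - b (b x z) y := by
  rw [leibnizator, ← sub_eq_zero (b := b (b x y) z - b (b x z) y)]
  constructor <;> intro h <;> rw [← h] <;> abel

theorem baseMap_smul (φ : A →ₐ[K] A') (a : A) (x : A ⊗[K] L) :
    baseMap L φ.toLinearMap (a • x) = φ a • baseMap L φ.toLinearMap x := by
  induction x using TensorProduct.induction_on with
  | zero => simp
  | add x y hx hy => simp only [smul_add, map_add, hx, hy]
  | tmul b l => simp [TensorProduct.smul_tmul']

theorem coeff_smul (ε : A →ₐ[K] K) (a : A) (x : A ⊗[K] L) :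
    coeff L ε.toLinearMap (a • x) = ε a • coeff L ε.toLinearMap x := by
  induction x using TensorProduct.induction_on with
  | zero => simp
  | add x y hx hy => simp only [smul_add, map_add, hx, hy]
  | tmul b l => simp [TensorProduct.smul_tmul', mul_smul]

end Tensor

/-! ### Deformations with an augmented base -/

section Deformation

variable {K : Type*} [Field K] {L : Type*} [AddCommGroup L] [Module K L]
variable (br : LeibnizBracket K L)
variable {A : Type*} [CommRing A] [Algebra K A] (ε : A →ₐ[K] K)
variable {A' : Type*} [CommRing A'] [Algebra K A'] {ε' : A' →ₐ[K] K}
variable {A'' : Type*} [CommRing A''] [Algebra K A''] {ε'' : A'' →ₐ[K] K}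

/-- A deformation of `(L, br)` with base `(A, ker ε)`: an `A`-Leibniz algebra structure on `A ⊗ L`
such that `ε ⊗ id : A ⊗ L → L` preserves the brackets. -/
@[ext]
structure Deformation extends LeibnizBracket A (A ⊗[K] L) where
  augmentation : ∀ x y, coeff L ε.toLinearMap (bracket x y)
    = br.bracket (coeff L ε.toLinearMap x) (coeff L ε.toLinearMap y)

variable {br} {ε}

theorem coeff_baseMap (φ : A →ₐ[K] A') (hφ : ε'.comp φ = ε) (x : A ⊗[K] L) :
    coeff L ε'.toLinearMap (baseMap L φ.toLinearMap x) = coeff L ε.toLinearMap x := by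
  subst hφ
  induction x using TensorProduct.induction_on with
  | zero => simp
  | add x y hx hy => simp only [map_add, hx, hy]
  | tmul a l => simp

theorem bilin_ext {b b' : A ⊗[K] L →ₗ[A] A ⊗[K] L →ₗ[A] A ⊗[K] L}
    (h : ∀ x y : L, b (1 ⊗ₜ x) (1 ⊗ₜ y) = b' (1 ⊗ₜ x) (1 ⊗ₜ y)) : b = b' := by
  refine LinearMap.ext fun x => LinearMap.ext fun y => ?_
  induction x using TensorProduct.induction_on with
  | zero => simp
  | add x x' hx hx' => simp only [map_add, LinearMap.add_apply, hx, hx']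
  | tmul r x =>
    induction y using TensorProduct.induction_on with
    | zero => simp
    | add y y' hy hy' => simp only [map_add, hy, hy']
    | tmul s y => rw [bilin_tmul, bilin_tmul b', h]

/-- The `A'`-bilinear operation on `A' ⊗ L = A' ⊗_A (A ⊗ L)` induced by an `A`-bilinear operation
on `A ⊗ L`. -/
def pushBilin (φ : A →ₐ[K] A') (b : A ⊗[K] L →ₗ[A] A ⊗[K] L →ₗ[A] A ⊗[K] L) :
    A' ⊗[K] L →ₗ[A'] A' ⊗[K] L →ₗ[A'] A' ⊗[K] L :=
  bilinExt ((gen b).compr₂ (baseMap L φ.toLinearMap))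

theorem pushBilin_baseMap (φ : A →ₐ[K] A') (b : A ⊗[K] L →ₗ[A] A ⊗[K] L →ₗ[A] A ⊗[K] L)
    (x y : A ⊗[K] L) :
    pushBilin φ b (baseMap L φ.toLinearMap x) (baseMap L φ.toLinearMap y)
      = baseMap L φ.toLinearMap (b x y) := by
  induction x using TensorProduct.induction_on with
  | zero => simp
  | add x x' hx hx' => simp only [map_add, LinearMap.add_apply, hx, hx']
  | tmul r x =>
    induction y using TensorProduct.induction_on with
    | zero => simp
    | add y y' hy hy' => simp only [map_add, hy, hy']
    | tmul s y =>
      rw [bilin_tmul b, baseMap_smul, baseMap_smul]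
      simp [pushBilin]

/-- The push-out `φ_* lam`. -/
def Deformation.pushout (φ : A →ₐ[K] A') (hφ : ε'.comp φ = ε) (lam : Deformation br ε) :
    Deformation br ε' where
  bracket := pushBilin φ lam.bracket
  leibniz x y z := by
    rw [← leibnizator_eq_zero_iff]
    refine leibnizator_eq_zero _ (fun x y z => ?_) x y z
    have h : ∀ l : L, (1 : A') ⊗ₜ[K] l = baseMap L φ.toLinearMap ((1 : A) ⊗ₜ[K] l) := by
      intro l; simp
    simp only [leibnizator_eq_zero_iff, h, pushBilin_baseMap, lam.leibniz, map_sub]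
  augmentation x y := by
    induction x using TensorProduct.induction_on with
    | zero => simp
    | add x x' hx hx' => simp only [map_add, LinearMap.add_apply, hx, hx']
    | tmul r x =>
      induction y using TensorProduct.induction_on with
      | zero => simp
      | add y y' hy hy' => simp only [map_add, hy, hy']
      | tmul s y =>
        rw [bilin_tmul, coeff_smul, coeff_smul]
        have h : ∀ l : L, (1 : A') ⊗ₜ[K] l = baseMap L φ.toLinearMap ((1 : A) ⊗ₜ[K] l) := by
          intro l; simp
        rw [h x, h y, pushBilin_baseMap, coeff_baseMap φ hφ, lam.augmentation]
        simp [smul_smul, mul_comm]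

theorem Deformation.ext_gen {lam mu : Deformation br ε}
    (h : ∀ x y : L, lam.bracket (1 ⊗ₜ x) (1 ⊗ₜ y) = mu.bracket (1 ⊗ₜ x) (1 ⊗ₜ y)) :
    lam = mu :=
  Deformation.ext (bilin_ext h)

theorem Deformation.pushout_baseMap (φ : A →ₐ[K] A') (hφ : ε'.comp φ = ε)
    (lam : Deformation br ε) (x y : A ⊗[K] L) :
    (lam.pushout φ hφ).bracket (baseMap L φ.toLinearMap x) (baseMap L φ.toLinearMap y)
      = baseMap L φ.toLinearMap (lam.bracket x y) :=
  pushBilin_baseMap φ lam.bracket x y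

theorem baseMap_comp (φ : A →ₐ[K] A') (ψ : A' →ₐ[K] A'') (x : A ⊗[K] L) :
    baseMap L ψ.toLinearMap (baseMap L φ.toLinearMap x)
      = baseMap L (ψ.comp φ).toLinearMap x := by
  induction x using TensorProduct.induction_on with
  | zero => simp
  | add x y hx hy => simp only [map_add, hx, hy]
  | tmul a l => simp

theorem Deformation.pushout_pushout (φ : A →ₐ[K] A') (hφ : ε'.comp φ = ε)
    (ψ : A' →ₐ[K] A'') (hψ : ε''.comp ψ = ε') (χ : A →ₐ[K] A'') (hχ : ε''.comp χ = ε)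
    (h : ψ.comp φ = χ) (lam : Deformation br ε) :
    (lam.pushout φ hφ).pushout ψ hψ = lam.pushout χ hχ := by
  subst h
  refine Deformation.ext_gen fun x y => ?_
  have h1 : ∀ l : L, (1 : A') ⊗ₜ[K] l = baseMap L φ.toLinearMap ((1 : A) ⊗ₜ[K] l) := by
    intro l; simp
  have h2 : ∀ l : L, (1 : A'') ⊗ₜ[K] l = baseMap L ψ.toLinearMap ((1 : A') ⊗ₜ[K] l) := by
    intro l; simp
  have h3 : ∀ l : L,
      (1 : A'') ⊗ₜ[K] l = baseMap L (ψ.comp φ).toLinearMap ((1 : A) ⊗ₜ[K] l) := by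
    intro l; simp
  rw [h2 x, h2 y, pushout_baseMap, h1 x, h1 y, pushout_baseMap, baseMap_comp, baseMap_comp,
    baseMap_comp, pushout_baseMap]

end Deformation

end LeibnizDeformation

namespace LeibnizDeformation

/-! ### Complete local algebras and formal deformations -/

section Formal

variable {K : Type*} [Field K] {L : Type*} [AddCommGroup L] [Module K L]
variable (br : LeibnizBracket K L)
variable {A : Type*} [CommRing A] [Algebra K A] (ε : A →ₐ[K] K)
variable {C : Type*} [CommRing C] [Algebra K C] {εC : C →ₐ[K] K}

/-- `A` is a complete local algebra with maximal ideal `𝔐 = ker ε` (that is, `A = lim A/𝔐ⁿ`),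
and `𝔐ᵏ/𝔐ᵏ⁺¹` is finite-dimensional for all `k`. -/
structure IsCompleteLocal : Prop where
  isLocalRing : IsLocalRing A
  isAdicComplete : IsAdicComplete (RingHom.ker ε) A
  finite : ∀ k : ℕ, Module.Finite K
    (↥((RingHom.ker ε) ^ k) ⧸ ((RingHom.ker ε) ^ (k + 1)).submoduleOf ((RingHom.ker ε) ^ k))

/-- `A/𝔐ⁿ⁺¹`. -/
abbrev Trunc (n : ℕ) : Type _ := A ⧸ (RingHom.ker ε) ^ (n + 1)

theorem ker_pow_le (n : ℕ) : (RingHom.ker ε) ^ (n + 1) ≤ RingHom.ker ε :=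
  Ideal.pow_le_self n.succ_ne_zero

/-- The augmentation of `A/𝔐ⁿ⁺¹`. -/
def truncAug (n : ℕ) : Trunc ε n →ₐ[K] K :=
  Ideal.Quotient.liftₐ _ ε fun _ ha => ker_pow_le ε n ha

/-- The projection `A/𝔐ⁿ⁺² → A/𝔐ⁿ⁺¹`. -/
def truncMap (n : ℕ) : Trunc ε (n + 1) →ₐ[K] Trunc ε n :=
  Ideal.Quotient.factorₐ K (Ideal.pow_le_pow_right (Nat.le_succ (n + 1)))

@[simp]
theorem truncAug_mk (n : ℕ) (a : A) : truncAug ε n (Ideal.Quotient.mk _ a) = ε a := rfl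

@[simp]
theorem truncMap_mk (n : ℕ) (a : A) :
    truncMap ε n (Ideal.Quotient.mk _ a) = Ideal.Quotient.mk _ a := rfl

theorem truncAug_comp_truncMap (n : ℕ) :
    (truncAug ε n).comp (truncMap ε n) = truncAug ε (n + 1) := by
  refine AlgHom.ext fun x => ?_
  obtain ⟨x, rfl⟩ := Ideal.Quotient.mk_surjective x
  rw [AlgHom.comp_apply, truncMap_mk, truncAug_mk, truncAug_mk]

/-- A formal deformation of `(L, br)` with base `A`, given as a projective system of deformations
with the bases `A/𝔐ⁿ⁺¹`. The induced `A`-Leibniz algebra structure on the completed tensor product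
is `FormalDeformation.limitBracket`. -/
@[ext]
structure FormalDeformation where
  level : ∀ n : ℕ, Deformation br (truncAug ε n)
  compat : ∀ n : ℕ,
    (level (n + 1)).pushout (truncMap ε n) (truncAug_comp_truncMap ε n) = level n

/-- The completed tensor product `lim (A/𝔐ⁿ⁺¹) ⊗ L`. -/
def CompletedTensor (L : Type*) [AddCommGroup L] [Module K L] :
    Submodule A (∀ n : ℕ, Trunc ε n ⊗[K] L) where
  carrier := {x | ∀ n, baseMap L (truncMap ε n).toLinearMap (x (n + 1)) = x n}
  add_mem' hx hy n := by simp only [Pi.add_apply, map_add, hx n, hy n]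
  zero_mem' n := by simp
  smul_mem' a x hx n := by
    have h : ∀ (m : ℕ) (y : Trunc ε m ⊗[K] L), a • y = (Ideal.Quotient.mk _ a : Trunc ε m) • y := by
      intro m y
      induction y using TensorProduct.induction_on with
      | zero => simp
      | add y z hy hz => simp only [smul_add, hy, hz]
      | tmul b l => rfl
    simp only [Pi.smul_apply]
    rw [h, h, baseMap_smul, hx n]
    rfl

variable {br} {ε}

/-- The `A`-Leibniz algebra structure on the completed tensor product which is the projective limit
of the given structures on `(A/𝔐ⁿ⁺¹) ⊗ L`. -/
def FormalDeformation.limitBracket (lam : FormalDeformation br ε) :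
    LeibnizBracket A (CompletedTensor ε L) where
  bracket := LinearMap.mk₂ A
    (fun x y => ⟨fun n => (lam.level n).bracket (x.1 n) (y.1 n), fun n => by
      dsimp only
      rw [← Deformation.pushout_baseMap (truncMap ε n) (truncAug_comp_truncMap ε n), lam.compat,
        x.2 n, y.2 n]⟩)
    (fun x x' y => by
      ext n; simp)
    (fun c x y => by
      ext n
      exact LinearMap.congr_fun (LinearMap.map_smul_of_tower (lam.level n).bracket c (x.1 n)) (y.1 n))
    (fun x y y' => by
      ext n; simp)
    (fun c x y => by
      ext n
      exact LinearMap.map_smul_of_tower ((lam.level n).bracket (x.1 n)) c (y.1 n))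
  leibniz x y z := by
    ext n
    exact (lam.level n).leibniz (x.1 n) (y.1 n) (z.1 n)

/-- `ε ⊗ id` on the completed tensor product. -/
def completedAug (x : CompletedTensor ε L) : L :=
  coeff L (truncAug ε 0).toLinearMap (x.1 0)

/-- Equivalence of formal deformations: an isomorphism of `A`-Leibniz algebras over `L`. -/
def FormalDeformation.Equivalent (lam mu : FormalDeformation br ε) : Prop :=
  ∃ ρ : CompletedTensor ε L ≃ₗ[A] CompletedTensor ε L,
    (∀ x y, ρ (lam.limitBracket.bracket x y) = mu.limitBracket.bracket (ρ x) (ρ y)) ∧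
    ∀ x, completedAug (ρ x) = completedAug x

theorem ker_pow_le_comap (f : C →ₐ[K] A) (hf : ε.comp f = εC) (n : ℕ) :
    (RingHom.ker εC) ^ (n + 1) ≤ ((RingHom.ker ε) ^ (n + 1)).comap f := by
  subst hf
  refine le_trans ?_ (Ideal.le_comap_pow f (n + 1))
  exact Ideal.pow_right_mono (fun x hx => hx) (n + 1)

/-- The homomorphism `C/𝔐_Cⁿ⁺¹ → A/𝔐_Aⁿ⁺¹` induced by `f : C → A`. -/
def truncHom (f : C →ₐ[K] A) (hf : ε.comp f = εC) (n : ℕ) : Trunc εC n →ₐ[K] Trunc ε n :=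
  Ideal.quotientMapₐ _ f (ker_pow_le_comap f hf n)

theorem truncAug_comp_truncHom (f : C →ₐ[K] A) (hf : ε.comp f = εC) (n : ℕ) :
    (truncAug ε n).comp (truncHom f hf n) = truncAug εC n := by
  subst hf
  ext x
  obtain ⟨x, rfl⟩ := Ideal.Quotient.mk_surjective x
  rfl

/-- The push-out `f_* eta` of a formal deformation. -/
def FormalDeformation.pushout (f : C →ₐ[K] A) (hf : ε.comp f = εC)
    (eta : FormalDeformation br εC) : FormalDeformation br ε where
  level n := (eta.level n).pushout (truncHom f hf n) (truncAug_comp_truncHom f hf n)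
  compat n := by
    have hχ : (truncAug ε n).comp ((truncMap ε n).comp (truncHom f hf (n + 1)))
        = truncAug εC (n + 1) := by
      rw [← AlgHom.comp_assoc, truncAug_comp_truncMap, truncAug_comp_truncHom]
    rw [Deformation.pushout_pushout _ _ _ _ _ hχ rfl, ← eta.compat n,
      Deformation.pushout_pushout _ _ _ _ ((truncMap ε n).comp (truncHom f hf (n + 1))) hχ]
    ext x
    obtain ⟨x, rfl⟩ := Ideal.Quotient.mk_surjective x
    rfl

/-- A formal deformation `eta` with base `C` is versal if (i) every formal deformation with a
complete local base `A` is equivalent to `f_* eta` for some homomorphism `f : C → A`, and (ii) `f`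
is unique if `𝔐² = 0` in `A`. -/
def FormalDeformation.IsVersal (eta : FormalDeformation br εC) : Prop :=
  (∀ (A : Type w) [CommRing A] [Algebra K A] (ε : A →ₐ[K] K), IsCompleteLocal ε →
    ∀ lam : FormalDeformation br ε,
      ∃ (f : C →ₐ[K] A) (hf : ε.comp f = εC), lam.Equivalent (eta.pushout f hf)) ∧
  (∀ (A : Type w) [CommRing A] [Algebra K A] (ε : A →ₐ[K] K), IsCompleteLocal ε →
    (RingHom.ker ε) ^ 2 = ⊥ →
    ∀ (lam : FormalDeformation br ε) (f g : C →ₐ[K] A) (hf : ε.comp f = εC) (hg : ε.comp g = εC),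
      lam.Equivalent (eta.pushout f hf) → lam.Equivalent (eta.pushout g hg) → f = g)

end Formal

end LeibnizDeformation

namespace LeibnizDeformation

/-! ### Harrison cohomology in degree two and extensions of algebras -/

section Harrison

variable {K : Type*} [Field K] {A : Type*} [CommRing A] [Algebra K A] (ε : A →ₐ[K] K)
variable (V : Type*) [AddCommGroup V] [Module K V]

/-- The Harrison `2`-cocycles of `A` with coefficients in a `K`-vector space `V` on which `A` acts
through `ε`. Since `Ch₂(A)` is the quotient of `A ⊗ A ⊗ A` by the shuffles
`(a₁, a₂) - (a₂, a₁)`, a Harrison `2`-cochain is a symmetric bilinear map. -/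
def HarrisonCocycle : Submodule K (A →ₗ[K] A →ₗ[K] V) where
  carrier := {f | (∀ a b, f a b = f b a) ∧
    ∀ a b c, ε a • f b c - f (a * b) c + f a (b * c) - ε c • f a b = 0}
  add_mem' := by
    rintro f g ⟨hf, hf'⟩ ⟨hg, hg'⟩
    refine ⟨fun a b => by simp [hf a b, hg a b], fun a b c => ?_⟩
    have h := congrArg₂ (· + ·) (hf' a b c) (hg' a b c)
    simp only [add_zero] at h
    rw [← h]
    simp only [LinearMap.add_apply, smul_add]
    abel
  zero_mem' := by simp
  smul_mem' := by
    rintro k f ⟨hf, hf'⟩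
    refine ⟨fun a b => by simp [hf a b], fun a b c => ?_⟩
    have h := congrArg (k • ·) (hf' a b c)
    simp only [smul_zero] at h
    rw [← h]
    simp only [LinearMap.smul_apply]
    module

/-- The Harrison `2`-coboundaries. (Harrison `1`-cochains are all the linear maps `A → V`.) -/
def HarrisonCoboundary : Submodule K (A →ₗ[K] A →ₗ[K] V) where
  carrier := {f | ∃ g : A →ₗ[K] V, ∀ a b, f a b = ε a • g b - g (a * b) + ε b • g a}
  add_mem' := by
    rintro f f' ⟨g, hg⟩ ⟨g', hg'⟩
    refine ⟨g + g', fun a b => ?_⟩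
    simp only [LinearMap.add_apply, hg, hg']
    module
  zero_mem' := ⟨0, by simp⟩
  smul_mem' := by
    rintro k f ⟨g, hg⟩
    refine ⟨k • g, fun a b => ?_⟩
    simp only [LinearMap.smul_apply, hg]
    module

/-- `H²_Harr(A; K)`. -/
abbrev H2Harr : Type _ :=
  HarrisonCocycle ε K ⧸ (HarrisonCoboundary ε K).submoduleOf (HarrisonCocycle ε K)

variable {ε} {V}

/-- The extension `0 → V → B → A → 0` given by a cocycle `f`: the vector space `A × V` with the
product `(a, v) (b, w) = (a b, a w + b v + f(a, b))`. -/
def HarrisonExt (_f : HarrisonCocycle ε V) : Type _ := A × V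

namespace HarrisonExt

variable (f : HarrisonCocycle ε V)

instance : AddCommGroup (HarrisonExt f) := inferInstanceAs (AddCommGroup (A × V))

instance : Module K (HarrisonExt f) := inferInstanceAs (Module K (A × V))

instance : Mul (HarrisonExt f) :=
  ⟨fun x y => (x.1 * y.1, ε x.1 • y.2 + ε y.1 • x.2 + f.1 x.1 y.1)⟩

instance : One (HarrisonExt f) := ⟨((1 : A), -f.1 1 1)⟩

variable {f}

@[ext]
theorem ext {x y : HarrisonExt f} (h1 : x.1 = y.1) (h2 : x.2 = y.2) : x = y := Prod.ext h1 h2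

@[simp] theorem add_fst (x y : HarrisonExt f) : (x + y).1 = x.1 + y.1 := rfl
@[simp] theorem add_snd (x y : HarrisonExt f) : (x + y).2 = x.2 + y.2 := rfl
@[simp] theorem zero_fst : (0 : HarrisonExt f).1 = 0 := rfl
@[simp] theorem zero_snd : (0 : HarrisonExt f).2 = 0 := rfl
@[simp] theorem smul_fst (k : K) (x : HarrisonExt f) : (k • x).1 = k • x.1 := rfl
@[simp] theorem smul_snd (k : K) (x : HarrisonExt f) : (k • x).2 = k • x.2 := rfl
@[simp] theorem one_fst : (1 : HarrisonExt f).1 = 1 := rfl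
@[simp] theorem one_snd : (1 : HarrisonExt f).2 = -f.1 1 1 := rfl
@[simp] theorem mul_fst (x y : HarrisonExt f) : (x * y).1 = x.1 * y.1 := rfl
@[simp] theorem mul_snd (x y : HarrisonExt f) :
    (x * y).2 = ε x.1 • y.2 + ε y.1 • x.2 + f.1 x.1 y.1 := rfl

theorem cocycle_one (a : A) : f.1 1 a = ε a • f.1 1 1 := by
  have h := f.2.2 1 1 a
  simp only [map_one, one_smul, one_mul] at h
  rw [sub_self, zero_add, sub_eq_zero] at h
  exact h

instance : CommRing (HarrisonExt f) where
  __ := (inferInstance : AddCommGroup (HarrisonExt f))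
  left_distrib x y z := by
    ext
    · simp [mul_add]
    · simp only [mul_snd, add_fst, add_snd, map_add]; module
  right_distrib x y z := by
    ext
    · simp [add_mul]
    · simp only [mul_snd, add_fst, add_snd, map_add, LinearMap.add_apply]; module
  zero_mul x := by ext <;> simp
  mul_zero x := by ext <;> simp
  mul_assoc x y z := by
    ext
    · simp [mul_assoc]
    · have h := f.2.2 x.1 y.1 z.1
      rw [sub_eq_zero, ← sub_eq_zero, ← neg_eq_zero] at h
      rw [← sub_eq_zero, ← h]
      simp only [mul_snd, mul_fst, map_mul]
      module
  one_mul x := by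
    ext
    · simp
    · simp only [mul_snd, one_fst, one_snd, map_one]
      rw [cocycle_one x.1]; module
  mul_one x := by
    ext
    · simp
    · simp only [mul_snd, one_fst, one_snd, map_one]
      rw [f.2.1 x.1 1, cocycle_one x.1]; module
  mul_comm x y := by
    ext
    · simp [mul_comm]
    · simp only [mul_snd, f.2.1 x.1 y.1]; module

instance : Algebra K (HarrisonExt f) :=
  Algebra.ofModule
    (fun k x y => by
      ext
      · simp
      · simp only [mul_snd, smul_fst, smul_snd, map_smul, LinearMap.smul_apply, smul_eq_mul]
        module)
    (fun k x y => by
      ext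
      · simp
      · simp only [mul_snd, smul_fst, smul_snd, map_smul, smul_eq_mul]
        module)

variable (f)

/-- The projection `p : B → A`. -/
def proj : HarrisonExt f →ₐ[K] A :=
  AlgHom.ofLinearMap (LinearMap.fst K A V : A × V →ₗ[K] A) rfl fun _ _ => rfl

/-- The inclusion `i : V → B`. -/
def incl : V →ₗ[K] HarrisonExt f := (LinearMap.inr K A V : V →ₗ[K] A × V)

/-- The section `q : A → B` of `p`. -/
def sec : A →ₗ[K] HarrisonExt f := (LinearMap.inl K A V : A →ₗ[K] A × V)

/-- The projection `B → V` along the section `q`. -/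
def retr : HarrisonExt f →ₗ[K] V := (LinearMap.snd K A V : A × V →ₗ[K] V)

/-- The augmentation of `B`. -/
def aug : HarrisonExt f →ₐ[K] K := ε.comp (proj f)

variable {f}

@[simp] theorem proj_apply (x : HarrisonExt f) : proj f x = x.1 := rfl
@[simp] theorem aug_apply (x : HarrisonExt f) : aug f x = ε x.1 := rfl
@[simp] theorem incl_fst (v : V) : (incl f v).1 = 0 := rfl
@[simp] theorem incl_snd (v : V) : (incl f v).2 = v := rfl
@[simp] theorem sec_fst (a : A) : (sec f a).1 = a := rfl
@[simp] theorem sec_snd (a : A) : (sec f a).2 = 0 := rfl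
@[simp] theorem retr_apply (x : HarrisonExt f) : retr f x = x.2 := rfl

theorem mul_incl (x : HarrisonExt f) (v : V) : x * incl f v = incl f (ε x.1 • v) := by
  ext <;> simp

theorem incl_mul_incl (v w : V) : incl f v * incl f w = 0 := by
  rw [mul_incl, incl_fst, map_zero, zero_smul, map_zero]

theorem aug_incl (v : V) : aug f (incl f v) = 0 := by
  rw [aug_apply, incl_fst, map_zero]

theorem proj_surjective : Function.Surjective (proj f) := fun a => ⟨sec f a, rfl⟩

instance [Module.Finite K A] [Module.Finite K V] : Module.Finite K (HarrisonExt f) :=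
  inferInstanceAs (Module.Finite K (A × V))

theorem isLocalRing [IsLocalRing A] : IsLocalRing (HarrisonExt f) := by
  have : IsLocalHom (proj f).toRingHom := by
    refine ⟨fun x hx => ?_⟩
    obtain ⟨y, hy⟩ := hx.exists_right_inv
    have h1 : x.1 * y = 1 := hy
    have hz : x * sec f y - 1 = incl f (x * sec f y - 1).2 := by
      ext
      · rw [sub_eq_add_neg, add_fst]
        change x.1 * y + -(1 : A) = 0
        rw [h1]; simp
      · rfl
    have hsq : (x * sec f y - 1) * (x * sec f y - 1) = 0 := by
      rw [hz, mul_incl, incl_fst, map_zero, zero_smul, map_zero]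
    refine IsUnit.of_mul_eq_one (sec f y * (1 - (x * sec f y - 1))) ?_
    linear_combination -hsq
  exact (proj f).toRingHom.domain_isLocalRing

end HarrisonExt

end Harrison

end LeibnizDeformation

namespace LeibnizDeformation

/-! ### Obstructions -/

section Obstruction

variable {K : Type*} [Field K] {L : Type*} [AddCommGroup L] [Module K L]
variable {br : LeibnizBracket K L}
variable {A : Type*} [CommRing A] [Algebra K A] {ε : A →ₐ[K] K}

theorem leibnizator_identity (b : A ⊗[K] L →ₗ[A] A ⊗[K] L →ₗ[A] A ⊗[K] L)
    (x y z t : A ⊗[K] L) :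
    b x (leibnizator b y z t) + b (leibnizator b x z t) y - b (leibnizator b x y t) z
      + b (leibnizator b x y z) t
      - leibnizator b (b x y) z t + leibnizator b (b x z) y t + leibnizator b x (b y z) t
      - leibnizator b (b x t) y z - leibnizator b x (b y t) z - leibnizator b x y (b z t) = 0 := by
  simp only [leibnizator, map_add, map_sub, LinearMap.add_apply, LinearMap.sub_apply]
  abel

theorem coeff_add_form (r s : A →ₗ[K] K) (t : A ⊗[K] L) :
    coeff L (r + s) t = coeff L r t + coeff L s t := by
  simp [coeff, LinearMap.rTensor_add]

theorem coeff_smul_form (k : K) (r : A →ₗ[K] K) (t : A ⊗[K] L) :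
    coeff L (k • r) t = k • coeff L r t := by
  simp [coeff, LinearMap.rTensor_smul]

/-- The trilinear map `(x, y, z) ↦ (r ⊗ id) φ(1 ⊗ x, 1 ⊗ y, 1 ⊗ z)`, where `φ` is the defect of the
Leibniz identity for `b`. -/
def defectCochain (r : A →ₗ[K] K) (b : A ⊗[K] L →ₗ[A] A ⊗[K] L →ₗ[A] A ⊗[K] L) :
    L →ₗ[K] L →ₗ[K] L →ₗ[K] L :=
  LinearMap.mk₂ K
    (fun x y =>
      { toFun := fun z => coeff L r (leibnizator b (1 ⊗ₜ x) (1 ⊗ₜ y) (1 ⊗ₜ z))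
        map_add' := fun z z' => by
          rw [TensorProduct.tmul_add, leibnizator_add_right, map_add]
        map_smul' := fun k z => by
          rw [← TensorProduct.smul_tmul, leibnizator_tmul]
          simp })
    (fun x x' y => by
      ext z
      simp only [LinearMap.coe_mk, AddHom.coe_mk, LinearMap.add_apply]
      rw [TensorProduct.tmul_add, leibnizator_add_left, map_add])
    (fun k x y => by
      ext z
      simp only [LinearMap.coe_mk, AddHom.coe_mk, LinearMap.smul_apply]
      rw [← TensorProduct.smul_tmul, leibnizator_tmul]
      simp)
    (fun x y y' => by
      ext z
      simp only [LinearMap.coe_mk, AddHom.coe_mk, LinearMap.add_apply]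
      rw [TensorProduct.tmul_add, leibnizator_add_mid, map_add])
    (fun k x y => by
      ext z
      simp only [LinearMap.coe_mk, AddHom.coe_mk, LinearMap.smul_apply]
      rw [← TensorProduct.smul_tmul, leibnizator_tmul]
      simp)

@[simp]
theorem defectCochain_apply (r : A →ₗ[K] K) (b : A ⊗[K] L →ₗ[A] A ⊗[K] L →ₗ[A] A ⊗[K] L)
    (x y z : L) :
    defectCochain r b x y z = coeff L r (leibnizator b (1 ⊗ₜ x) (1 ⊗ₜ y) (1 ⊗ₜ z)) := rfl

variable (lam : Deformation br ε) (f : HarrisonCocycle ε K)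

/-- A `B`-bilinear operation on `B ⊗ L` lifting `lam`, where `B` is the one-dimensional extension
of `A` given by `f`. -/
def IsLifting (b : HarrisonExt f ⊗[K] L →ₗ[HarrisonExt f] HarrisonExt f ⊗[K] L →ₗ[HarrisonExt f]
    HarrisonExt f ⊗[K] L) : Prop :=
  ∀ x y, baseMap L (HarrisonExt.proj f).toLinearMap (b x y)
    = lam.bracket (baseMap L (HarrisonExt.proj f).toLinearMap x)
        (baseMap L (HarrisonExt.proj f).toLinearMap y)

/-- The lifting of `lam` to `B ⊗ L` given by the section `q` of `p`:
`{1 ⊗ x, 1 ⊗ y} = (q ⊗ id) [1 ⊗ x, 1 ⊗ y]`. -/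
def sectionLift : HarrisonExt f ⊗[K] L →ₗ[HarrisonExt f] HarrisonExt f ⊗[K] L →ₗ[HarrisonExt f]
    HarrisonExt f ⊗[K] L :=
  bilinExt ((gen lam.bracket).compr₂ (baseMap L (HarrisonExt.sec f)))

variable {lam} {f}

theorem baseMap_proj_sec (t : A ⊗[K] L) :
    baseMap L (HarrisonExt.proj f).toLinearMap (baseMap L (HarrisonExt.sec f) t) = t := by
  induction t using TensorProduct.induction_on with
  | zero => simp
  | add x y hx hy => simp only [map_add, hx, hy]
  | tmul a l => simp

theorem isLifting_sectionLift : IsLifting lam f (sectionLift lam f) := by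
  intro x y
  induction x using TensorProduct.induction_on with
  | zero => simp
  | add x x' hx hx' => simp only [map_add, LinearMap.add_apply, hx, hx']
  | tmul r x =>
    induction y using TensorProduct.induction_on with
    | zero => simp
    | add y y' hy hy' => simp only [map_add, hy, hy']
    | tmul s y =>
      rw [sectionLift, bilinExt_tmul, baseMap_smul, baseMap_smul, LinearMap.compr₂_apply,
        baseMap_proj_sec, gen_apply, baseMap_tmul, baseMap_tmul,
        bilin_tmul lam.bracket ((HarrisonExt.proj f).toLinearMap r)]
      rfl

theorem decompose (t : HarrisonExt f ⊗[K] L) :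
    t = baseMap L (HarrisonExt.sec f) (baseMap L (HarrisonExt.proj f).toLinearMap t)
      + HarrisonExt.incl f 1 ⊗ₜ coeff L (HarrisonExt.retr f) t := by
  induction t using TensorProduct.induction_on with
  | zero => simp
  | add x y hx hy =>
    rw [map_add, map_add, map_add, TensorProduct.tmul_add]
    nth_rewrite 1 [hx, hy]
    abel
  | tmul b l =>
    rw [baseMap_tmul, baseMap_tmul, coeff_tmul, ← TensorProduct.smul_tmul, ← map_smul,
      ← TensorProduct.add_tmul]
    congr 1
    ext <;> simp

theorem incl_smul (t : HarrisonExt f ⊗[K] L) :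
    HarrisonExt.incl f 1 • t
      = HarrisonExt.incl f 1 ⊗ₜ coeff L (HarrisonExt.aug f).toLinearMap t := by
  induction t using TensorProduct.induction_on with
  | zero => simp
  | add x y hx hy => rw [smul_add, hx, hy, map_add, TensorProduct.tmul_add]
  | tmul b l =>
    rw [coeff_tmul, ← TensorProduct.smul_tmul, TensorProduct.smul_tmul', smul_eq_mul, mul_comm,
      HarrisonExt.mul_incl, map_smul]
    rfl

theorem smul_incl_tmul (b : HarrisonExt f) (l : L) :
    b • (HarrisonExt.incl f 1 ⊗ₜ[K] l) = HarrisonExt.incl f 1 ⊗ₜ (ε b.1 • l) := by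
  rw [← TensorProduct.smul_tmul, TensorProduct.smul_tmul', smul_eq_mul, HarrisonExt.mul_incl,
    map_smul]

section

variable {b : HarrisonExt f ⊗[K] L →ₗ[HarrisonExt f] HarrisonExt f ⊗[K] L →ₗ[HarrisonExt f]
    HarrisonExt f ⊗[K] L}

theorem IsLifting.aug (hb : IsLifting lam f b) (x y : HarrisonExt f ⊗[K] L) :
    coeff L (HarrisonExt.aug f).toLinearMap (b x y)
      = br.bracket (coeff L (HarrisonExt.aug f).toLinearMap x)
          (coeff L (HarrisonExt.aug f).toLinearMap y) := by
  have h : ε.comp (HarrisonExt.proj f) = HarrisonExt.aug f := rfl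
  rw [← coeff_baseMap (HarrisonExt.proj f) h, ← coeff_baseMap (HarrisonExt.proj f) h,
    ← coeff_baseMap (HarrisonExt.proj f) h, hb, lam.augmentation]

theorem IsLifting.leibnizator_eq (hb : IsLifting lam f b) (x y z : HarrisonExt f ⊗[K] L) :
    leibnizator b x y z = HarrisonExt.incl f 1 ⊗ₜ
      defectCochain (HarrisonExt.retr f) b (coeff L (HarrisonExt.aug f).toLinearMap x)
        (coeff L (HarrisonExt.aug f).toLinearMap y)
        (coeff L (HarrisonExt.aug f).toLinearMap z) := by
  induction x using TensorProduct.induction_on with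
  | zero => simp [leibnizator]
  | add x x' hx hx' =>
    rw [leibnizator_add_left, hx, hx', map_add, map_add, LinearMap.add_apply,
      LinearMap.add_apply, TensorProduct.tmul_add]
  | tmul r x =>
    induction y using TensorProduct.induction_on with
    | zero => simp [leibnizator]
    | add y y' hy hy' =>
      rw [leibnizator_add_mid, hy, hy', map_add, map_add, LinearMap.add_apply,
        TensorProduct.tmul_add]
    | tmul s y =>
      induction z using TensorProduct.induction_on with
      | zero => simp [leibnizator]
      | add z z' hz hz' =>
        rw [leibnizator_add_right, hz, hz', map_add, map_add, TensorProduct.tmul_add]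
      | tmul t z =>
        rw [leibnizator_tmul, decompose (leibnizator b (1 ⊗ₜ x) (1 ⊗ₜ y) (1 ⊗ₜ z))]
        have h0 : baseMap L (HarrisonExt.proj f).toLinearMap
            (leibnizator b (1 ⊗ₜ x) (1 ⊗ₜ y) (1 ⊗ₜ z)) = 0 := by
          rw [leibnizator, map_add, map_sub, hb, hb, hb, hb, hb, hb]
          exact leibnizator_eq_zero_iff.2 (lam.leibniz _ _ _)
        rw [h0, map_zero, zero_add, ← defectCochain_apply, smul_incl_tmul]
        simp only [coeff_tmul, map_smul, LinearMap.smul_apply, smul_smul]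
        congr 2
        simp only [AlgHom.toLinearMap_apply, HarrisonExt.aug_apply, HarrisonExt.mul_fst, map_mul]
        ring

theorem IsLifting.bracket_incl (hb : IsLifting lam f b) (x : HarrisonExt f ⊗[K] L) (l : L) :
    b x (HarrisonExt.incl f 1 ⊗ₜ l) = HarrisonExt.incl f 1 ⊗ₜ
      br.bracket (coeff L (HarrisonExt.aug f).toLinearMap x) l := by
  have h : HarrisonExt.incl f 1 ⊗ₜ[K] l = HarrisonExt.incl f 1 • ((1 : HarrisonExt f) ⊗ₜ[K] l) := by
    rw [TensorProduct.smul_tmul', smul_eq_mul, mul_one]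
  rw [h, map_smul, incl_smul, hb.aug]
  simp

theorem IsLifting.incl_bracket (hb : IsLifting lam f b) (x : HarrisonExt f ⊗[K] L) (l : L) :
    b (HarrisonExt.incl f 1 ⊗ₜ l) x = HarrisonExt.incl f 1 ⊗ₜ
      br.bracket l (coeff L (HarrisonExt.aug f).toLinearMap x) := by
  have h : HarrisonExt.incl f 1 ⊗ₜ[K] l = HarrisonExt.incl f 1 • ((1 : HarrisonExt f) ⊗ₜ[K] l) := by
    rw [TensorProduct.smul_tmul', smul_eq_mul, mul_one]
  rw [h, map_smul, LinearMap.smul_apply, incl_smul, hb.aug]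
  simp

/-- The cochain `φ̄` of a lifting is a cocycle. -/
theorem IsLifting.defectCochain_mem (hb : IsLifting lam f b) :
    defectCochain (HarrisonExt.retr f) b ∈ Z3 br := by
  intro x y z t
  have h := leibnizator_identity b ((1 : HarrisonExt f) ⊗ₜ[K] x) (1 ⊗ₜ y) (1 ⊗ₜ z) (1 ⊗ₜ t)
  simp only [hb.leibnizator_eq, hb.bracket_incl, hb.incl_bracket, hb.aug, coeff_tmul,
    AlgHom.toLinearMap_apply, map_one, one_smul, ← TensorProduct.tmul_add,
    ← TensorProduct.tmul_sub] at h
  have h' := congrArg (coeff L (HarrisonExt.retr f)) h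
  simp only [coeff_tmul, HarrisonExt.retr_apply, HarrisonExt.incl_snd, one_smul, map_zero] at h'
  exact h'

end

/-- `a ⊗ y ↦ (f(a, -) ⊗ id) (g y)`. -/
def contract (f : A →ₗ[K] A →ₗ[K] K) (g : L →ₗ[K] A ⊗[K] L) : A ⊗[K] L →ₗ[K] L :=
  TensorProduct.lift (LinearMap.mk₂ K (fun a y => coeff L (f a) (g y))
    (fun a a' y => by rw [map_add, coeff_add_form])
    (fun k a y => by rw [map_smul, coeff_smul_form])
    (fun a y y' => by rw [map_add, map_add])
    (fun k a y => by rw [map_smul, map_smul]))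

@[simp]
theorem contract_tmul (f : A →ₗ[K] A →ₗ[K] K) (g : L →ₗ[K] A ⊗[K] L) (a : A) (y : L) :
    contract f g (a ⊗ₜ y) = coeff L (f a) (g y) := by
  simp [contract]

theorem contract_add (f f' : A →ₗ[K] A →ₗ[K] K) (g : L →ₗ[K] A ⊗[K] L) (t : A ⊗[K] L) :
    contract (f + f') g t = contract f g t + contract f' g t := by
  induction t using TensorProduct.induction_on with
  | zero => simp
  | add x y hx hy => simp only [map_add, hx, hy]; abel
  | tmul a l => simp [coeff_add_form]

theorem contract_smul (k : K) (f : A →ₗ[K] A →ₗ[K] K) (g : L →ₗ[K] A ⊗[K] L) (t : A ⊗[K] L) :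
    contract (k • f) g t = k • contract f g t := by
  induction t using TensorProduct.induction_on with
  | zero => simp
  | add x y hx hy => simp only [map_add, hx, hy, smul_add]
  | tmul a l => simp [coeff_smul_form]

theorem coeff_retr_sec_smul (a : A) (t : A ⊗[K] L) :
    coeff L (HarrisonExt.retr f) (HarrisonExt.sec f a • baseMap L (HarrisonExt.sec f) t)
      = coeff L (f.1 a) t := by
  induction t using TensorProduct.induction_on with
  | zero => simp
  | add x y hx hy => simp only [map_add, smul_add, hx, hy]
  | tmul c l => simp [TensorProduct.smul_tmul']

theorem coeff_retr_sectionLift_left (x : L) (t : A ⊗[K] L) :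
    coeff L (HarrisonExt.retr f) (sectionLift lam f (1 ⊗ₜ x) (baseMap L (HarrisonExt.sec f) t))
      = contract f.1 (gen lam.bracket x) t := by
  induction t using TensorProduct.induction_on with
  | zero => simp
  | add x y hx hy => simp only [map_add, hx, hy]
  | tmul a l =>
    rw [baseMap_tmul, sectionLift, bilinExt_tmul, one_smul, LinearMap.compr₂_apply,
      coeff_retr_sec_smul, contract_tmul]

theorem coeff_retr_sectionLift_right (x : L) (t : A ⊗[K] L) :
    coeff L (HarrisonExt.retr f) (sectionLift lam f (baseMap L (HarrisonExt.sec f) t) (1 ⊗ₜ x))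
      = contract f.1 ((gen lam.bracket).flip x) t := by
  induction t using TensorProduct.induction_on with
  | zero => simp
  | add x y hx hy => simp only [map_add, LinearMap.add_apply, hx, hy]
  | tmul a l =>
    rw [baseMap_tmul, sectionLift, bilinExt_tmul, one_smul, LinearMap.compr₂_apply,
      coeff_retr_sec_smul, contract_tmul, LinearMap.flip_apply]

theorem defectCochain_sectionLift (x y z : L) :
    defectCochain (HarrisonExt.retr f) (sectionLift lam f) x y z
      = contract f.1 (gen lam.bracket x) (gen lam.bracket y z)
        - contract f.1 ((gen lam.bracket).flip z) (gen lam.bracket x y)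
        + contract f.1 ((gen lam.bracket).flip y) (gen lam.bracket x z) := by
  have h : ∀ u v : L, sectionLift lam f (1 ⊗ₜ u) (1 ⊗ₜ v)
      = baseMap L (HarrisonExt.sec f) (gen lam.bracket u v) := by
    intro u v
    rw [sectionLift, bilinExt_tmul, one_smul, one_smul, LinearMap.compr₂_apply]
  rw [defectCochain_apply, leibnizator, map_add, map_sub, h, h, h, coeff_retr_sectionLift_left,
    coeff_retr_sectionLift_right, coeff_retr_sectionLift_right]

variable (lam)

/-- The linear map sending a Harrison cocycle `f` to the cocycle `φ̄` of the lifting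
`sectionLift lam f` of `lam` to the one-dimensional extension given by `f`. -/
def obstructionCocycle : HarrisonCocycle ε K →ₗ[K] Z3 br where
  toFun f := ⟨defectCochain (HarrisonExt.retr f) (sectionLift lam f),
    isLifting_sectionLift.defectCochain_mem⟩
  map_add' f g := by
    ext x y z
    simp only [Submodule.coe_add, LinearMap.add_apply, defectCochain_sectionLift, contract_add]
    abel
  map_smul' k f := by
    ext x y z
    simp only [Submodule.coe_smul, LinearMap.smul_apply, RingHom.id_apply,
      defectCochain_sectionLift, contract_smul, smul_add, smul_sub]

theorem contract_coboundary_left {f : A →ₗ[K] A →ₗ[K] K} {g : A →ₗ[K] K}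
    (h : ∀ a b, f a b = ε a • g b - g (a * b) + ε b • g a) (x : L) (t : A ⊗[K] L) :
    contract f (gen lam.bracket x) t
      = coeff L g (gen lam.bracket x (coeff L ε.toLinearMap t))
        - coeff L g (lam.bracket (1 ⊗ₜ x) t) + br.bracket x (coeff L g t) := by
  have hf : ∀ (a : A) (s : A ⊗[K] L), coeff L (f a) s
      = ε a • coeff L g s - coeff L g (a • s) + g a • coeff L ε.toLinearMap s := by
    intro a s
    induction s using TensorProduct.induction_on with
    | zero => simp
    | add u v hu hv => simp only [map_add, smul_add, hu, hv]; abel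
    | tmul c l =>
      simp only [coeff_tmul, h, TensorProduct.smul_tmul', AlgHom.toLinearMap_apply, smul_eq_mul]
      module
  induction t using TensorProduct.induction_on with
  | zero => simp
  | add u v hu hv => simp only [map_add, hu, hv]; abel
  | tmul a l =>
    have h1 : lam.bracket (1 ⊗ₜ x) (a ⊗ₜ l) = a • lam.bracket (1 ⊗ₜ x) (1 ⊗ₜ l) := by
      rw [bilin_tmul, one_smul]
    rw [contract_tmul, hf, coeff_tmul, coeff_tmul, LinearMap.map_smul (gen lam.bracket x),
      LinearMap.map_smul (coeff L g), LinearMap.map_smul (br.bracket x), gen_apply, h1,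
      lam.augmentation]
    simp

theorem contract_coboundary_right {f : A →ₗ[K] A →ₗ[K] K} {g : A →ₗ[K] K}
    (h : ∀ a b, f a b = ε a • g b - g (a * b) + ε b • g a) (x : L) (t : A ⊗[K] L) :
    contract f ((gen lam.bracket).flip x) t
      = coeff L g (gen lam.bracket (coeff L ε.toLinearMap t) x)
        - coeff L g (lam.bracket t (1 ⊗ₜ x)) + br.bracket (coeff L g t) x := by
  have hf : ∀ (a : A) (s : A ⊗[K] L), coeff L (f a) s
      = ε a • coeff L g s - coeff L g (a • s) + g a • coeff L ε.toLinearMap s := by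
    intro a s
    induction s using TensorProduct.induction_on with
    | zero => simp
    | add u v hu hv => simp only [map_add, smul_add, hu, hv]; abel
    | tmul c l =>
      simp only [coeff_tmul, h, TensorProduct.smul_tmul', AlgHom.toLinearMap_apply, smul_eq_mul]
      module
  induction t using TensorProduct.induction_on with
  | zero => simp
  | add u v hu hv => simp only [map_add, LinearMap.add_apply, hu, hv]; abel
  | tmul a l =>
    have h1 : lam.bracket (a ⊗ₜ l) (1 ⊗ₜ x) = a • lam.bracket (1 ⊗ₜ l) (1 ⊗ₜ x) := by
      rw [bilin_tmul, one_smul]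
    rw [contract_tmul, hf, coeff_tmul, coeff_tmul, LinearMap.map_smul (gen lam.bracket),
      LinearMap.map_smul br.bracket, LinearMap.smul_apply, LinearMap.smul_apply,
      LinearMap.map_smul (coeff L g), LinearMap.flip_apply, gen_apply, h1, lam.augmentation]
    simp

theorem obstructionCocycle_coboundary :
    (HarrisonCoboundary ε K).submoduleOf (HarrisonCocycle ε K)
      ≤ ((B3 br).submoduleOf (Z3 br)).comap (obstructionCocycle lam) := by
  rintro ⟨f, hf⟩ ⟨g, hg⟩
  refine ⟨(gen lam.bracket).compr₂ (coeff L g), fun x y z => ?_⟩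
  have hg' : ∀ a b, f a b = ε a • g b - g (a * b) + ε b • g a := hg
  change defectCochain _ (sectionLift lam ⟨f, hf⟩) x y z = _
  have hE : ∀ u v : L, coeff L ε.toLinearMap (gen lam.bracket u v) = br.bracket u v := by
    intro u v
    rw [gen_apply, lam.augmentation]
    simp
  rw [defectCochain_sectionLift, contract_coboundary_left lam hg',
    contract_coboundary_right lam hg', contract_coboundary_right lam hg', hE, hE, hE]
  have hL := congrArg (coeff L g) (lam.leibniz (1 ⊗ₜ x) (1 ⊗ₜ y) (1 ⊗ₜ z))
  rw [map_sub] at hL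
  simp only [d2, LinearMap.compr₂_apply, gen_apply] at hL ⊢
  rw [hL]
  abel

/-- The obstruction map `θ : H²_Harr(A; K) → HL³(L; L)` of the deformation `lam`. -/
def obstructionMap : H2Harr ε →ₗ[K] HL3 br :=
  Submodule.mapQ _ _ (obstructionCocycle lam) (obstructionCocycle_coboundary lam)

end Obstruction

end LeibnizDeformation

namespace LeibnizDeformation

/-! ### The universal infinitesimal deformation -/

section Infinitesimal

variable {K : Type u} [Field K] {L : Type v} [AddCommGroup L] [Module K L]
variable (br : LeibnizBracket K L)

theorem augmentation_of_gen {A : Type*} [CommRing A] [Algebra K A] {ε : A →ₐ[K] K}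
    {b : A ⊗[K] L →ₗ[A] A ⊗[K] L →ₗ[A] A ⊗[K] L}
    (h : ∀ x y : L, coeff L ε.toLinearMap (b (1 ⊗ₜ x) (1 ⊗ₜ y)) = br.bracket x y)
    (x y : A ⊗[K] L) :
    coeff L ε.toLinearMap (b x y)
      = br.bracket (coeff L ε.toLinearMap x) (coeff L ε.toLinearMap y) := by
  induction x using TensorProduct.induction_on with
  | zero => simp
  | add x x' hx hx' => simp only [map_add, LinearMap.add_apply, hx, hx']
  | tmul r x =>
    induction y using TensorProduct.induction_on with
    | zero => simp
    | add y y' hy hy' => simp only [map_add, hy, hy']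
    | tmul s y =>
      rw [bilin_tmul, coeff_smul, coeff_smul, h]
      simp [smul_smul, mul_comm]

section SquareZero

variable {C : Type*} [CommRing C] [Algebra K C] {ι : Type*} [Fintype ι]

/-- The bilinear map `(x, y) ↦ 1 ⊗ [x, y] + ∑ᵢ cᵢ ⊗ mᵢ(x, y)`. -/
def infinitesimalGen (c : ι → C) (m : ι → Z2 br) : L →ₗ[K] L →ₗ[K] C ⊗[K] L :=
  br.bracket.compr₂ (TensorProduct.mk K C L 1) +
    ∑ i, (m i).1.compr₂ (TensorProduct.mk K C L (c i))

theorem infinitesimalGen_apply (c : ι → C) (m : ι → Z2 br) (x y : L) :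
    infinitesimalGen br c m x y = 1 ⊗ₜ br.bracket x y + ∑ i, c i ⊗ₜ[K] (m i).1 x y := by
  simp [infinitesimalGen, LinearMap.sum_apply]

theorem smul_infinitesimalGen {c : ι → C} (hc : ∀ i j, c i * c j = 0) (m : ι → Z2 br) (i : ι)
    (x y : L) : c i • infinitesimalGen br c m x y = c i ⊗ₜ br.bracket x y := by
  rw [infinitesimalGen_apply, smul_add, Finset.smul_sum, TensorProduct.smul_tmul', smul_eq_mul,
    mul_one]
  simp [TensorProduct.smul_tmul', hc]

/-- The deformation with `[1 ⊗ x, 1 ⊗ y] = 1 ⊗ [x, y] + ∑ᵢ cᵢ ⊗ mᵢ(x, y)`, where `cᵢ cⱼ = 0`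
and the `mᵢ` are cocycles. -/
def infinitesimalDeformation (ε : C →ₐ[K] K) (c : ι → C) (hc : ∀ i j, c i * c j = 0)
    (hε : ∀ i, ε (c i) = 0) (m : ι → Z2 br) : Deformation br ε where
  bracket := bilinExt (infinitesimalGen br c m)
  leibniz x y z := by
    rw [← leibnizator_eq_zero_iff]
    refine leibnizator_eq_zero _ (fun x y z => ?_) x y z
    have h0 : ∀ u w : L, bilinExt (infinitesimalGen br c m) (1 ⊗ₜ u) (1 ⊗ₜ w)
        = infinitesimalGen br c m u w := by
      intro u w
      rw [bilinExt_tmul, one_smul, one_smul]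
    have h1 : ∀ u t w : L, bilinExt (infinitesimalGen br c m) (1 ⊗ₜ u)
        (infinitesimalGen br c m t w) = infinitesimalGen br c m u (br.bracket t w) +
          ∑ i, c i ⊗ₜ[K] br.bracket u ((m i).1 t w) := by
      intro u t w
      rw [infinitesimalGen_apply br c m t w, map_add, map_sum, h0]
      congr 1
      refine Finset.sum_congr rfl fun i _ => ?_
      rw [bilinExt_tmul, one_smul, smul_infinitesimalGen br hc]
    have h2 : ∀ u t w : L, bilinExt (infinitesimalGen br c m)
        (infinitesimalGen br c m t w) (1 ⊗ₜ u) = infinitesimalGen br c m (br.bracket t w) u +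
          ∑ i, c i ⊗ₜ[K] br.bracket ((m i).1 t w) u := by
      intro u t w
      rw [infinitesimalGen_apply br c m t w, map_add, map_sum, LinearMap.add_apply,
        LinearMap.sum_apply, h0]
      congr 1
      refine Finset.sum_congr rfl fun i _ => ?_
      rw [bilinExt_tmul, one_smul, smul_infinitesimalGen br hc]
    have h3 : leibnizator (bilinExt (infinitesimalGen br c m)) (1 ⊗ₜ x) (1 ⊗ₜ y) (1 ⊗ₜ z)
        = 1 ⊗ₜ (br.bracket x (br.bracket y z) - br.bracket (br.bracket x y) z
            + br.bracket (br.bracket x z) y)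
          + ∑ i, c i ⊗ₜ[K] d2 br (m i).1 x y z := by
      rw [leibnizator, h0, h0, h0, h1, h2, h2]
      simp only [infinitesimalGen_apply, d2, TensorProduct.tmul_add, TensorProduct.tmul_sub,
        Finset.sum_add_distrib, Finset.sum_sub_distrib]
      abel
    have h4 : ∀ i, d2 br (m i).1 x y z = 0 := fun i => (m i).2 x y z
    rw [h3, br.leibniz]
    simp [h4]
  augmentation := augmentation_of_gen br fun x y => by
    rw [bilinExt_tmul, one_smul, one_smul, infinitesimalGen_apply, map_add, map_sum, coeff_tmul]
    simp [hε]

end SquareZero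

/-- The algebra `C₁ = K ⊕ ℍ'` with `(k₁, h₁) (k₂, h₂) = (k₁ k₂, k₁ h₂ + k₂ h₁)`. -/
abbrev FirstBase : Type (max u v) :=
  HarrisonExt (0 : HarrisonCocycle (AlgHom.id K K) (Module.Dual K (HL2 br)))

/-- The augmentation `C₁ → K`. -/
def firstAug : FirstBase br →ₐ[K] K := HarrisonExt.aug _

/-- The inclusion `ℍ' → C₁`. -/
def firstIncl : Module.Dual K (HL2 br) →ₗ[K] FirstBase br := HarrisonExt.incl _

theorem firstIncl_mul (g g' : Module.Dual K (HL2 br)) : firstIncl br g * firstIncl br g' = 0 :=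
  HarrisonExt.incl_mul_incl g g'

theorem firstAug_incl (g : Module.Dual K (HL2 br)) : firstAug br (firstIncl br g) = 0 :=
  HarrisonExt.aug_incl g

/-- The infinitesimal deformation `η₁` with base `C₁`:
`[1 ⊗ x, 1 ⊗ y] = 1 ⊗ [x, y] + ∑ᵢ gᵢ ⊗ μ(hᵢ)(x, y)`, where `(hᵢ)` is a basis of `ℍ` and `(gᵢ)`
is the dual basis. -/
def firstDeformation [FiniteDimensional K (HL2 br)] (μ : HL2 br →ₗ[K] Z2 br) :
    Deformation br (firstAug br) :=
  infinitesimalDeformation br (firstAug br)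
    (fun i => firstIncl br ((Module.finBasis K (HL2 br)).coord i))
    (fun _ _ => firstIncl_mul br _ _) (fun _ => firstAug_incl br _)
    (fun i => μ (Module.finBasis K (HL2 br) i))

end Infinitesimal

/-! ### The inductive step -/

section Step

variable {K : Type*} [Field K] {L : Type*} [AddCommGroup L] [Module K L]
variable {br : LeibnizBracket K L}
variable {A : Type*} [CommRing A] [Algebra K A] {ε : A →ₐ[K] K}

/-- The cocycle `f` with values in `H²_Harr(A; K)'` dual to a linear map `μ` which chooses
representatives of the cohomology classes. -/
def universalCocycle (μ : H2Harr ε →ₗ[K] HarrisonCocycle ε K) :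
    HarrisonCocycle ε (Module.Dual K (H2Harr ε)) :=
  ⟨LinearMap.mk₂ K
    (fun a b =>
      { toFun := fun c => (μ c).1 a b
        map_add' := fun c c' => by simp
        map_smul' := fun k c => by simp })
    (fun a a' b => by ext c; simp)
    (fun k a b => by ext c; simp)
    (fun a b b' => by ext c; simp)
    (fun k a b => by ext c; simp),
   fun a b => LinearMap.ext fun c => (μ c).2.1 a b,
   fun a b c => LinearMap.ext fun e => (μ e).2.2 a b c⟩

theorem universalCocycle_apply (μ : H2Harr ε →ₗ[K] HarrisonCocycle ε K) (a b : A)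
    (c : H2Harr ε) : (universalCocycle μ).1 a b c = (μ c).1 a b := rfl

variable (lam : Deformation br ε) (μ : H2Harr ε →ₗ[K] HarrisonCocycle ε K)

/-- The ideal `ī(ω'(HL³(L; L)'))` of the extension `C̄` of `A` by `H²_Harr(A; K)'`, where `ω` is the
obstruction map of `lam`. -/
def obstructionIdeal : Ideal (HarrisonExt (universalCocycle μ)) where
  carrier := {x | ∃ ψ : Module.Dual K (HL3 br),
    x = HarrisonExt.incl (universalCocycle μ) ((obstructionMap lam).dualMap ψ)}
  add_mem' := by
    rintro x y ⟨ψ, rfl⟩ ⟨ψ', rfl⟩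
    exact ⟨ψ + ψ', by rw [map_add, map_add]⟩
  zero_mem' := ⟨0, by rw [map_zero, map_zero]⟩
  smul_mem' := by
    rintro b x ⟨ψ, rfl⟩
    exact ⟨ε b.1 • ψ, by
      rw [smul_eq_mul, HarrisonExt.mul_incl, LinearMap.map_smul (obstructionMap lam).dualMap]⟩

/-- `C̄ / ī(ω'(HL³(L; L)'))`. -/
abbrev NextBase : Type _ := HarrisonExt (universalCocycle μ) ⧸ obstructionIdeal lam μ

/-- The projection of the new base to the old one. -/
def nextProj : NextBase lam μ →ₐ[K] A :=
  Ideal.Quotient.liftₐ _ (HarrisonExt.proj (universalCocycle μ)) (by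
    rintro x ⟨ψ, rfl⟩
    simp)

/-- The augmentation of the new base. -/
def nextAug : NextBase lam μ →ₐ[K] K := ε.comp (nextProj lam μ)

theorem nextBase_isLocalRing [IsLocalRing A] : IsLocalRing (NextBase lam μ) := by
  have h1 : IsLocalRing (HarrisonExt (universalCocycle μ)) := HarrisonExt.isLocalRing
  have h2 : Nontrivial (NextBase lam μ) := (nextAug lam μ).toRingHom.domain_nontrivial
  exact IsLocalRing.of_surjective' (Ideal.Quotient.mk (obstructionIdeal lam μ))
    Ideal.Quotient.mk_surjective

end Step

/-! ### The construction of the versal deformation -/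

section Construction

variable {K : Type u} [Field K] {L : Type v} [AddCommGroup L] [Module K L]

/-- A finite-dimensional local algebra with a deformation of `(L, br)` over it. -/
structure Stage (br : LeibnizBracket K L) where
  base : Type (max u v)
  [commRing : CommRing base]
  [algebra : Algebra K base]
  [finite : Module.Finite K base]
  [isLocalRing : IsLocalRing base]
  ε : base →ₐ[K] K
  η : Deformation br ε

attribute [instance] Stage.commRing Stage.algebra Stage.finite Stage.isLocalRing

variable {br : LeibnizBracket K L}

/-- The choices made in one step of the construction: representatives of the classes in
`H²_Harr(C_k; K)`, and an extension of `η_k` to a deformation with base `C_{k+1}`. -/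
structure Step (S : Stage br) where
  μ : H2Harr S.ε →ₗ[K] HarrisonCocycle S.ε K
  μ_class : ∀ c, Submodule.Quotient.mk (μ c) = c
  η : Deformation br (nextAug S.η μ)
  extends_η : η.pushout (nextProj S.η μ) rfl = S.η

/-- The stage `(C_{k+1}, η_{k+1})` obtained from `(C_k, η_k)`. -/
def Step.next {S : Stage br} (T : Step S) : Stage br where
  base := NextBase S.η T.μ
  isLocalRing := nextBase_isLocalRing S.η T.μ
  ε := nextAug S.η T.μ
  η := T.η

/-- The projection `p_{k+1} : C_{k+1} → C_k`. -/
def Step.proj {S : Stage br} (T : Step S) : T.next.base →ₐ[K] S.base := nextProj S.η T.μ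

variable (br)

/-- The choices made in the construction: representatives of the classes in `ℍ = HL²(L; L)`, and a
rule which, at the `k`-th step, makes the choices of this step at the stage reached by then. -/
structure Construction where
  μ : HL2 br →ₗ[K] Z2 br
  μ_class : ∀ α, Submodule.Quotient.mk (μ α) = α
  step : ∀ (_ : ℕ) (S : Stage br), Step S

variable {br}
variable [FiniteDimensional K (HL2 br)]

/-- The stage `(C₁, η₁)`. -/
def firstStage (μ : HL2 br →ₗ[K] Z2 br) : Stage br where
  base := FirstBase br
  isLocalRing := HarrisonExt.isLocalRing
  ε := firstAug br
  η := firstDeformation br μ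

namespace Construction

variable (D : Construction br)

/-- `D.stage k` is `(C_{k+1}, η_{k+1})`. -/
def stage : ℕ → Stage br
  | 0 => firstStage D.μ
  | k + 1 => (D.step k (stage k)).next

/-- The projections of the tower `C₁ ← C₂ ← ⋯`. -/
def proj (k : ℕ) : (D.stage (k + 1)).base →ₐ[K] (D.stage k).base :=
  (D.step k (D.stage k)).proj

/-- The algebra `C = lim C_k`. -/
def limitBase : Subalgebra K (∀ k, (D.stage k).base) where
  carrier := {x | ∀ k, D.proj k (x (k + 1)) = x k}
  mul_mem' hx hy k := by simp only [Pi.mul_apply, map_mul, hx k, hy k]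
  add_mem' hx hy k := by simp only [Pi.add_apply, map_add, hx k, hy k]
  algebraMap_mem' r k := by simp only [Pi.algebraMap_apply, AlgHom.commutes]

/-- The projection `C → C_k`. -/
def limitProj (k : ℕ) : D.limitBase →ₐ[K] (D.stage k).base :=
  (Pi.evalAlgHom K (fun k => (D.stage k).base) k).comp D.limitBase.val

/-- The augmentation of `C`. -/
def limitAug : D.limitBase →ₐ[K] K := (D.stage 0).ε.comp (D.limitProj 0)

theorem aug_comp_limitProj (k : ℕ) : (D.stage k).ε.comp (D.limitProj k) = D.limitAug := by
  induction k with
  | zero => rfl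
  | succ k ih =>
    rw [← ih]
    ext x
    change (D.stage k).ε (D.proj k (x.1 (k + 1))) = (D.stage k).ε (x.1 k)
    rw [x.2 k]

/-- The homomorphism `C/𝔐ⁿ⁺¹ → C_k` induced by the projection `C → C_k`, if the latter vanishes on
`𝔐ⁿ⁺¹`. -/
def truncProj (k n : ℕ)
    (h : (RingHom.ker D.limitAug) ^ (n + 1) ≤ RingHom.ker (D.limitProj k)) :
    Trunc D.limitAug n →ₐ[K] (D.stage k).base :=
  Ideal.Quotient.liftₐ _ (D.limitProj k) fun _ ha => h ha

theorem aug_comp_truncProj (k n : ℕ)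
    (h : (RingHom.ker D.limitAug) ^ (n + 1) ≤ RingHom.ker (D.limitProj k)) :
    (D.stage k).ε.comp (D.truncProj k n h) = truncAug D.limitAug n := by
  ext x
  obtain ⟨x, rfl⟩ := Ideal.Quotient.mk_surjective x
  exact DFunLike.congr_fun (D.aug_comp_limitProj k) x

/-- `eta` is the projective limit of the deformations `η_k`: for every `k`, the projection
`C → C_k` factors through some `C/𝔐ⁿ⁺¹`, and the push-out of `eta` to `C_k` is `η_k`. -/
def IsLimit (eta : FormalDeformation br D.limitAug) : Prop :=
  ∀ k, ∃ (n : ℕ) (h : (RingHom.ker D.limitAug) ^ (n + 1) ≤ RingHom.ker (D.limitProj k)),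
    (eta.level n).pushout (D.truncProj k n h) (D.aug_comp_truncProj k n h) = (D.stage k).η

end Construction

end Construction

end LeibnizDeformation

end

open LeibnizDeformation

noncomputable section

/-! The proof reduces everything to small extensions `B → A`: surjections whose kernel is
finite-dimensional and annihilated by the augmentation ideal. There a kernel element sees other
elements only through their augmentations, so all corrections are linear and the questions become
cohomological. A linear lift to `B` of a homomorphism `S → A` is multiplicative up to Harrison
cocycles (`SmallExt.exists_harrisonCocycle`). The operation induced by such a lift satisfies the
Leibniz identity up to the obstruction cocycles of these Harrison cocycles
(`leibnizator_linearPush`), and adding a cochain along the kernel adds its coboundary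
(`leibnizator_add_cochainExt`). Two deformations over `B` that agree over `A` differ by 2-cocycles,
and a coboundary gives an isomorphism (`SmallExt.exists_cocycle`,
`exists_isMorphism_of_coboundary`).

The choices exist because the multiplication of the new base involves only classes with zero
obstruction (`exists_dual_basis_ker`, `exists_extension`).

For versality, homomorphisms `C_{n+1} → A/𝔐ⁿ⁺¹` are built by induction together with isomorphisms of
the deformations (`Step.exists_lift`). The given deformation is first transported so that the old
isomorphism becomes the identity. Its existence over the larger truncation shows that the
obstructions to lifting the homomorphism vanish, so the homomorphism extends to the next base
(`SmallExt.exists_algHom_nextBase`). The remaining discrepancy consists of classes in `ℍ`, and it is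
absorbed by adding derivations that come from `C₁ = K ⊕ ℍ'` (`SmallExt.exists_adjustment`).

Completeness of `C` rests on minimality: the kernel of each projection lies in `𝔐²`, since a form
detecting it modulo `𝔐²` would be a derivation trivialising a nonzero Harrison class
(`nextIncl_mem_sq`). So `𝔐` is generated at every stage by lifts of generators for `C₁`. Finitely
generated ideals of the limit are closed, by a Mittag-Leffler argument
(`IsTowerLimit.mem_of_forall_mem_map`). Hence the powers of `𝔐` are closed, and the tower and the
`𝔐`-adic filtration are cofinal.

For uniqueness, `ker (C → C₁)` lies in `𝔐²`, so a homomorphism to a base with `𝔐² = 0` is determined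
on `C₁`. There it can be read off from the classes in `ℍ` of the coefficients of the push-out, which
do not change under equivalence (`FormalDeformation.Equivalent.coeff_sub`). -/

namespace LeibnizDeformation

/-! ### Leibniz defects of corrected operations and of linear push-outs. -/

section Tensor

variable {K : Type*} [Field K] {L : Type*} [AddCommGroup L] [Module K L]
variable {A : Type*} [CommRing A] [Algebra K A]
variable {B : Type*} [CommRing B] [Algebra K B] {ε : B →ₐ[K] K}

theorem baseMap_comp_linear {C : Type*} [CommRing C] [Algebra K C] (φ : A →ₗ[K] B)
    (ψ : B →ₗ[K] C) (t : A ⊗[K] L) :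
    baseMap L ψ (baseMap L φ t) = baseMap L (ψ ∘ₗ φ) t := by
  simp [baseMap, LinearMap.rTensor_comp]

theorem coeff_baseMap_linear (φ : A →ₗ[K] B) (r : B →ₗ[K] K) (t : A ⊗[K] L) :
    coeff L r (baseMap L φ t) = coeff L (r ∘ₗ φ) t := by
  simp [baseMap, coeff, LinearMap.rTensor_comp]

theorem baseMap_add_form (φ ψ : A →ₗ[K] B) (t : A ⊗[K] L) :
    baseMap L (φ + ψ) t = baseMap L φ t + baseMap L ψ t := by
  simp [baseMap, LinearMap.rTensor_add]

theorem baseMap_sum_smulRight {ι : Type*} [Fintype ι] (r : ι → A →ₗ[K] K) (e : ι → B)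
    (t : A ⊗[K] L) :
    baseMap L (∑ j, (r j).smulRight (e j)) t = ∑ j, e j ⊗ₜ[K] coeff L (r j) t := by
  induction t using TensorProduct.induction_on with
  | zero => simp
  | add x y hx hy => simp only [map_add, hx, hy, TensorProduct.tmul_add, Finset.sum_add_distrib]
  | tmul a l =>
    simp [LinearMap.sum_apply, TensorProduct.sum_tmul, TensorProduct.smul_tmul]

/-- The `B`-bilinear operation on `B ⊗ L` which extends `(x, y) ↦ ∑ⱼ eⱼ ⊗ Gⱼ(x, y)`. -/
def cochainExt {ι : Type*} [Fintype ι] (e : ι → B) (G : ι → L →ₗ[K] L →ₗ[K] L) :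
    B ⊗[K] L →ₗ[B] B ⊗[K] L →ₗ[B] B ⊗[K] L :=
  bilinExt (∑ j, (G j).compr₂ (TensorProduct.mk K B L (e j)))

variable {ι : Type*} {e : ι → B}

/-- The hypothesis `he` says that `ker ε` annihilates the `e j`. It is the defining feature of a
small extension and drives the computations that follow. -/
theorem smul_tmul_of_mul (he : ∀ b j, b * e j = ε b • e j) (b : B) (j : ι) (l : L) :
    b • (e j ⊗ₜ[K] l) = e j ⊗ₜ[K] (ε b • l) := by
  rw [TensorProduct.smul_tmul', smul_eq_mul, he, TensorProduct.smul_tmul]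

theorem smul_eq_tmul_coeff (he : ∀ b j, b * e j = ε b • e j) (j : ι) (t : B ⊗[K] L) :
    e j • t = e j ⊗ₜ[K] coeff L ε.toLinearMap t := by
  induction t using TensorProduct.induction_on with
  | zero => simp
  | add x y hx hy => rw [smul_add, hx, hy, map_add, TensorProduct.tmul_add]
  | tmul b l =>
    rw [coeff_tmul, TensorProduct.smul_tmul', smul_eq_mul, mul_comm, he, TensorProduct.smul_tmul]
    rfl

/-- Pulled out as a scalar, `e j` remembers only the augmentation of what it multiplies, so brackets
with the kernel are brackets of `L`. -/
theorem bracket_tmul_of_mul {br : LeibnizBracket K L} (he : ∀ b j, b * e j = ε b • e j)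
    {b : B ⊗[K] L →ₗ[B] B ⊗[K] L →ₗ[B] B ⊗[K] L}
    (hb : ∀ x y : L, coeff L ε.toLinearMap (b (1 ⊗ₜ x) (1 ⊗ₜ y)) = br.bracket x y)
    (x : B ⊗[K] L) (j : ι) (l : L) :
    b x (e j ⊗ₜ l) = e j ⊗ₜ br.bracket (coeff L ε.toLinearMap x) l := by
  have h : e j ⊗ₜ[K] l = e j • ((1 : B) ⊗ₜ[K] l) := by
    rw [TensorProduct.smul_tmul', smul_eq_mul, mul_one]
  rw [h, map_smul, smul_eq_tmul_coeff he, augmentation_of_gen br hb]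
  simp

theorem tmul_bracket_of_mul {br : LeibnizBracket K L} (he : ∀ b j, b * e j = ε b • e j)
    {b : B ⊗[K] L →ₗ[B] B ⊗[K] L →ₗ[B] B ⊗[K] L}
    (hb : ∀ x y : L, coeff L ε.toLinearMap (b (1 ⊗ₜ x) (1 ⊗ₜ y)) = br.bracket x y)
    (x : B ⊗[K] L) (j : ι) (l : L) :
    b (e j ⊗ₜ l) x = e j ⊗ₜ br.bracket l (coeff L ε.toLinearMap x) := by
  have h : e j ⊗ₜ[K] l = e j • ((1 : B) ⊗ₜ[K] l) := by
    rw [TensorProduct.smul_tmul', smul_eq_mul, mul_one]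
  rw [h, map_smul, LinearMap.smul_apply, smul_eq_tmul_coeff he, augmentation_of_gen br hb]
  simp

variable [Fintype ι]

theorem cochainExt_one_tmul (G : ι → L →ₗ[K] L →ₗ[K] L) (x y : L) :
    cochainExt e G (1 ⊗ₜ x) (1 ⊗ₜ y) = ∑ j, e j ⊗ₜ[K] G j x y := by
  simp [cochainExt, LinearMap.sum_apply]

theorem cochainExt_apply (he : ∀ b j, b * e j = ε b • e j) (G : ι → L →ₗ[K] L →ₗ[K] L)
    (x y : B ⊗[K] L) :
    cochainExt e G x y
      = ∑ j, e j ⊗ₜ[K] G j (coeff L ε.toLinearMap x) (coeff L ε.toLinearMap y) := by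
  induction x using TensorProduct.induction_on with
  | zero => simp
  | add x x' hx hx' =>
    simp only [map_add, LinearMap.add_apply, hx, hx', TensorProduct.tmul_add,
      Finset.sum_add_distrib]
  | tmul r x =>
    induction y using TensorProduct.induction_on with
    | zero => simp
    | add y y' hy hy' =>
      simp only [map_add, hy, hy', TensorProduct.tmul_add, Finset.sum_add_distrib]
    | tmul s y =>
      rw [bilin_tmul, cochainExt_one_tmul]
      simp only [Finset.smul_sum, smul_tmul_of_mul he, coeff_tmul, map_smul,
        LinearMap.smul_apply, AlgHom.toLinearMap_apply]
      exact Finset.sum_congr rfl fun j _ => by rw [smul_comm]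

/-- Terms quadratic in `G` put a kernel element under the augmentation, where `hε` kills it. The
mixed terms, with one factor from `b` and one from the correction, add up to the coboundary. -/
theorem leibnizator_add_cochainExt {br : LeibnizBracket K L} (he : ∀ b j, b * e j = ε b • e j)
    (hε : ∀ j, ε (e j) = 0) {b : B ⊗[K] L →ₗ[B] B ⊗[K] L →ₗ[B] B ⊗[K] L}
    (hb : ∀ x y : L, coeff L ε.toLinearMap (b (1 ⊗ₜ x) (1 ⊗ₜ y)) = br.bracket x y)
    (G : ι → L →ₗ[K] L →ₗ[K] L) (x y z : L) :
    leibnizator (b + cochainExt e G) (1 ⊗ₜ x) (1 ⊗ₜ y) (1 ⊗ₜ z)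
      = leibnizator b (1 ⊗ₜ x) (1 ⊗ₜ y) (1 ⊗ₜ z) + ∑ j, e j ⊗ₜ[K] d2 br (G j) x y z := by
  simp only [leibnizator, LinearMap.add_apply, map_add, cochainExt_apply he, hb, map_sum,
    LinearMap.sum_apply, bracket_tmul_of_mul he hb, tmul_bracket_of_mul he hb, coeff_tmul,
    AlgHom.toLinearMap_apply, map_one, one_smul, hε, zero_smul, Finset.sum_const_zero,
    map_zero, LinearMap.zero_apply, TensorProduct.tmul_zero, add_zero, d2,
    TensorProduct.tmul_add, TensorProduct.tmul_sub, Finset.sum_add_distrib,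
    Finset.sum_sub_distrib]
  abel

/-- The `B`-bilinear operation on `B ⊗ L` with `{1 ⊗ x, 1 ⊗ y} = (σ ⊗ id) [1 ⊗ x, 1 ⊗ y]`. -/
def linearPush (σ : A →ₗ[K] B) (b : A ⊗[K] L →ₗ[A] A ⊗[K] L →ₗ[A] A ⊗[K] L) :
    B ⊗[K] L →ₗ[B] B ⊗[K] L →ₗ[B] B ⊗[K] L :=
  bilinExt ((gen b).compr₂ (baseMap L σ))

theorem linearPush_one_tmul (σ : A →ₗ[K] B) (b : A ⊗[K] L →ₗ[A] A ⊗[K] L →ₗ[A] A ⊗[K] L)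
    (x y : L) :
    linearPush σ b (1 ⊗ₜ x) (1 ⊗ₜ y) = baseMap L σ (b (1 ⊗ₜ x) (1 ⊗ₜ y)) := by
  simp [linearPush]

/-- The bracket of a push-out on `1 ⊗ L`. -/
theorem Deformation.pushout_one_tmul {br : LeibnizBracket K L} {εA : A →ₐ[K] K} (φ : A →ₐ[K] B)
    (hφ : ε.comp φ = εA) (lam : Deformation br εA) (x y : L) :
    (lam.pushout φ hφ).bracket (1 ⊗ₜ x) (1 ⊗ₜ y)
      = baseMap L φ.toLinearMap (lam.bracket (1 ⊗ₜ x) (1 ⊗ₜ y)) :=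
  linearPush_one_tmul _ _ _ _

/-- The forms `f j a` measure how far multiplication by `σ a` is from commuting with `σ ⊗ id`.
Contracted with the bracket, these errors become the terms of `defectCochain_sectionLift`. -/
theorem smul_baseMap_of_mul {σ : A →ₗ[K] B} {f : ι → A →ₗ[K] A →ₗ[K] K}
    (hσ : ∀ a b, σ a * σ b = σ (a * b) + ∑ j, f j a b • e j) (a : A) (t : A ⊗[K] L) :
    σ a • baseMap L σ t = baseMap L σ (a • t) + ∑ j, e j ⊗ₜ[K] coeff L (f j a) t := by
  induction t using TensorProduct.induction_on with
  | zero => simp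
  | add x y hx hy =>
    simp only [map_add, smul_add, hx, hy, TensorProduct.tmul_add, Finset.sum_add_distrib]
    abel
  | tmul c l =>
    simp only [baseMap_tmul, coeff_tmul, TensorProduct.smul_tmul', smul_eq_mul, hσ,
      TensorProduct.add_tmul, TensorProduct.sum_tmul, TensorProduct.tmul_smul]

theorem linearPush_baseMap_right {σ : A →ₗ[K] B} {f : ι → A →ₗ[K] A →ₗ[K] K}
    (hσ : ∀ a b, σ a * σ b = σ (a * b) + ∑ j, f j a b • e j)
    (b : A ⊗[K] L →ₗ[A] A ⊗[K] L →ₗ[A] A ⊗[K] L) (x : L) (t : A ⊗[K] L) :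
    linearPush σ b (1 ⊗ₜ x) (baseMap L σ t)
      = baseMap L σ (b (1 ⊗ₜ x) t) + ∑ j, e j ⊗ₜ[K] contract (f j) (gen b x) t := by
  induction t using TensorProduct.induction_on with
  | zero => simp
  | add x y hx hy =>
    simp only [map_add, hx, hy, TensorProduct.tmul_add, Finset.sum_add_distrib]
    abel
  | tmul a l =>
    rw [baseMap_tmul, bilin_tmul, linearPush_one_tmul, one_smul, smul_baseMap_of_mul hσ,
      bilin_tmul b 1 a, one_smul]
    simp

theorem linearPush_baseMap_left {σ : A →ₗ[K] B} {f : ι → A →ₗ[K] A →ₗ[K] K}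
    (hσ : ∀ a b, σ a * σ b = σ (a * b) + ∑ j, f j a b • e j)
    (b : A ⊗[K] L →ₗ[A] A ⊗[K] L →ₗ[A] A ⊗[K] L) (x : L) (t : A ⊗[K] L) :
    linearPush σ b (baseMap L σ t) (1 ⊗ₜ x)
      = baseMap L σ (b t (1 ⊗ₜ x)) + ∑ j, e j ⊗ₜ[K] contract (f j) ((gen b).flip x) t := by
  induction t using TensorProduct.induction_on with
  | zero => simp
  | add x y hx hy =>
    simp only [map_add, LinearMap.add_apply, hx, hy, TensorProduct.tmul_add,
      Finset.sum_add_distrib]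
    abel
  | tmul a l =>
    rw [baseMap_tmul, bilin_tmul, linearPush_one_tmul, one_smul, smul_baseMap_of_mul hσ,
      bilin_tmul b a 1, one_smul]
    simp

/-- The defect of the operation given by a linear map `σ` which is multiplicative up to the
cocycles `fⱼ`. -/
theorem leibnizator_linearPush {br : LeibnizBracket K L} {εA : A →ₐ[K] K}
    (lam : Deformation br εA) {σ : A →ₗ[K] B} {f : ι → HarrisonCocycle εA K}
    (hσ : ∀ a b, σ a * σ b = σ (a * b) + ∑ j, (f j).1 a b • e j) (x y z : L) :
    leibnizator (linearPush σ lam.bracket) (1 ⊗ₜ x) (1 ⊗ₜ y) (1 ⊗ₜ z)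
      = ∑ j, e j ⊗ₜ[K] (obstructionCocycle lam (f j)).1 x y z := by
  have h : ∀ j, (obstructionCocycle lam (f j)).1 x y z
      = defectCochain (HarrisonExt.retr (f j)) (sectionLift lam (f j)) x y z := fun _ => rfl
  -- The part inside `σ ⊗ id` cancels by the Leibniz identity of `lam`. The error terms have the
  -- same contraction formula as the defect of the section lift to the one-dimensional extension
  -- given by `f j`.
  simp only [leibnizator, linearPush_one_tmul, h, defectCochain_sectionLift,
    linearPush_baseMap_right hσ, linearPush_baseMap_left hσ, lam.leibniz (1 ⊗ₜ x),
    TensorProduct.tmul_add, TensorProduct.tmul_sub, Finset.sum_add_distrib,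
    Finset.sum_sub_distrib, map_sub, gen_apply]
  abel

end Tensor

/-! ### Small extensions. -/

section SmallExt

variable {K : Type*} [Field K] {L : Type*} [AddCommGroup L] [Module K L]
variable {A : Type*} [CommRing A] [Algebra K A]
variable {B : Type*} [CommRing B] [Algebra K B] {p : B →ₐ[K] A} {ε : B →ₐ[K] K}

/-- A split presentation of a surjection `p : B → A` whose kernel is finite-dimensional and is
annihilated by `ker ε`: a linear section of `p`, a basis `eⱼ` of the kernel, and linear forms `rⱼ`
on `B` which extend the dual basis. -/
structure SmallExt (p : B →ₐ[K] A) (ε : B →ₐ[K] K) (n : ℕ) where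
  e : Fin n → B
  sec : A →ₗ[K] B
  r : Fin n → B →ₗ[K] K
  mul_e : ∀ b j, b * e j = ε b • e j
  proj_e : ∀ j, p (e j) = 0
  proj_sec : ∀ a, p (sec a) = a
  r_e : ∀ i j, r i (e j) = if i = j then 1 else 0
  decomp : ∀ b, b = sec (p b) + ∑ j, r j b • e j

/-- Over a field both the projection and the inclusion of its kernel split; the forms `r j` are the
kernel coordinates given by the second splitting. -/
theorem SmallExt.exists (p : B →ₐ[K] A) (ε : B →ₐ[K] K) (hp : Function.Surjective p)
    [FiniteDimensional K p.toLinearMap.ker] (h : ∀ b w, p w = 0 → b * w = ε b • w) :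
    ∃ n, Nonempty (SmallExt p ε n) := by
  obtain ⟨s, hs⟩ := p.toLinearMap.exists_rightInverse_of_surjective (LinearMap.range_eq_top.2 hp)
  obtain ⟨t, ht⟩ := p.toLinearMap.ker.subtype.exists_leftInverse_of_injective (by simp)
  have hs' : ∀ a, p (s a) = a := fun a => LinearMap.congr_fun hs a
  have ht' : ∀ w (hw : p w = 0), t w = ⟨w, hw⟩ := fun w hw => LinearMap.congr_fun ht ⟨w, hw⟩
  let b := Module.finBasis K p.toLinearMap.ker
  refine ⟨_, ⟨{ e := fun j => (b j).1
                -- Removing the kernel component of `s` puts the section inside `ker t`, so that `x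
                -- = sec (p x) + t x`.
                sec := s - (p.toLinearMap.ker.subtype ∘ₗ t) ∘ₗ s
                r := fun j => b.coord j ∘ₗ t
                mul_e := fun x j => h x _ (b j).2
                proj_e := fun j => (b j).2
                proj_sec := fun a => ?_
                r_e := fun i j => ?_
                decomp := fun x => ?_ }⟩⟩
  · have h2 : p (t (s a)).1 = 0 := (t (s a)).2
    simp [hs', h2]
  · have h2 : t (b j).1 = b j := ht' _ (b j).2
    simp [h2, Finsupp.single_apply, eq_comm]
  · have h1 : ∑ j, (b.coord j ∘ₗ t) x • (b j).1 = (t x).1 := by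
      have h2 := congrArg (Submodule.subtype _) (b.sum_repr (t x))
      rwa [map_sum] at h2
    have h2 : t (x - s (p x)) = ⟨x - s (p x), by simp [hs']⟩ := ht' _ _
    have h3 := congrArg Subtype.val h2
    rw [map_sub] at h3
    rw [h1]
    simp only [LinearMap.sub_apply, LinearMap.comp_apply, Submodule.subtype_apply,
      Submodule.coe_sub] at h3 ⊢
    linear_combination -h3

variable {n : ℕ} (E : SmallExt p ε n)

namespace SmallExt

theorem tensor_decomp (t : B ⊗[K] L) :
    t = baseMap L E.sec (baseMap L p.toLinearMap t) + ∑ j, E.e j ⊗ₜ[K] coeff L (E.r j) t := by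
  rw [← baseMap_sum_smulRight, baseMap_comp_linear, ← baseMap_add_form]
  have h : E.sec ∘ₗ p.toLinearMap + ∑ j, (E.r j).smulRight (E.e j) = LinearMap.id :=
    LinearMap.ext fun b => by
      conv_rhs => rw [LinearMap.id_apply, E.decomp b]
      simp [LinearMap.sum_apply]
  rw [h, baseMap, LinearMap.rTensor_id, LinearMap.id_apply]

theorem coeff_sum (c : Fin n → L) (i : Fin n) :
    coeff L (E.r i) (∑ j, E.e j ⊗ₜ[K] c j) = c i := by
  simp [E.r_e]

theorem sum_injective {c c' : Fin n → L}
    (h : ∑ j, E.e j ⊗ₜ[K] c j = ∑ j, E.e j ⊗ₜ[K] c' j) : c = c' :=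
  funext fun i => by rw [← E.coeff_sum c i, h, E.coeff_sum]

/-- Two operations on `B ⊗ L` which agree over `A` differ by cochains along the kernel. -/
theorem exists_cochain {b b' : B ⊗[K] L →ₗ[B] B ⊗[K] L →ₗ[B] B ⊗[K] L}
    (h : ∀ x y : L, baseMap L p.toLinearMap (b (1 ⊗ₜ x) (1 ⊗ₜ y))
      = baseMap L p.toLinearMap (b' (1 ⊗ₜ x) (1 ⊗ₜ y))) :
    ∃ G : Fin n → L →ₗ[K] L →ₗ[K] L, b' = b + cochainExt E.e G := by
  refine ⟨fun j => (gen b' - gen b).compr₂ (coeff L (E.r j)), bilin_ext fun x y => ?_⟩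
  have h1 := E.tensor_decomp (b' (1 ⊗ₜ[K] x) (1 ⊗ₜ y) - b (1 ⊗ₜ x) (1 ⊗ₜ y))
  rw [map_sub, h, sub_self, map_zero, zero_add] at h1
  rw [LinearMap.add_apply, LinearMap.add_apply, cochainExt_one_tmul, ← sub_eq_iff_eq_add', h1]
  rfl

end SmallExt

end SmallExt

/-! ### Morphisms of deformations over the identity of `L`. -/

section Morphism

variable {K : Type*} [Field K] {L : Type*} [AddCommGroup L] [Module K L]
variable {br : LeibnizBracket K L}
variable {A : Type*} [CommRing A] [Algebra K A] {ε : A →ₐ[K] K}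
variable {B : Type*} [CommRing B] [Algebra K B] {εB : B →ₐ[K] K}

/-- A homomorphism of deformations over the identity of `L`. -/
structure IsMorphism (ρ : A ⊗[K] L →ₗ[A] A ⊗[K] L) (lam mu : Deformation br ε) : Prop where
  bracket : ∀ x y, ρ (lam.bracket x y) = mu.bracket (ρ x) (ρ y)
  aug : ∀ x, coeff L ε.toLinearMap (ρ x) = coeff L ε.toLinearMap x

theorem one_tmul_smul (a : A) (l : L) : a ⊗ₜ[K] l = a • ((1 : A) ⊗ₜ[K] l) := by
  rw [TensorProduct.smul_tmul', smul_eq_mul, mul_one]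

theorem aug_of_gen {ρ : A ⊗[K] L →ₗ[A] A ⊗[K] L}
    (h : ∀ l : L, coeff L ε.toLinearMap (ρ (1 ⊗ₜ l)) = l) (x : A ⊗[K] L) :
    coeff L ε.toLinearMap (ρ x) = coeff L ε.toLinearMap x := by
  induction x using TensorProduct.induction_on with
  | zero => simp
  | add x y hx hy => simp only [map_add, hx, hy]
  | tmul a l => rw [one_tmul_smul, map_smul, coeff_smul, coeff_smul, h]; simp

theorem IsMorphism.of_gen {ρ : A ⊗[K] L →ₗ[A] A ⊗[K] L} {lam mu : Deformation br ε}
    (h : ∀ x y : L, ρ (lam.bracket (1 ⊗ₜ x) (1 ⊗ₜ y)) = mu.bracket (ρ (1 ⊗ₜ x)) (ρ (1 ⊗ₜ y)))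
    (haug : ∀ l : L, coeff L ε.toLinearMap (ρ (1 ⊗ₜ l)) = l) : IsMorphism ρ lam mu where
  bracket x y := by
    have h1 : lam.bracket.compr₂ ρ = mu.bracket.compl₁₂ ρ ρ := bilin_ext h
    exact LinearMap.congr_fun (LinearMap.congr_fun h1 x) y
  aug := aug_of_gen haug

theorem IsMorphism.id (lam : Deformation br ε) : IsMorphism LinearMap.id lam lam :=
  ⟨fun _ _ => rfl, fun _ => rfl⟩

theorem IsMorphism.comp {ρ σ : A ⊗[K] L →ₗ[A] A ⊗[K] L} {lam mu nu : Deformation br ε}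
    (hσ : IsMorphism σ mu nu) (hρ : IsMorphism ρ lam mu) : IsMorphism (σ ∘ₗ ρ) lam nu :=
  ⟨fun x y => by simp only [LinearMap.comp_apply, hρ.bracket, hσ.bracket],
   fun x => by simp only [LinearMap.comp_apply, hρ.aug, hσ.aug]⟩

theorem sub_one_tmul_mem (x : A ⊗[K] L) :
    x - 1 ⊗ₜ[K] coeff L ε.toLinearMap x ∈ (RingHom.ker ε) • (⊤ : Submodule A (A ⊗[K] L)) := by
  induction x using TensorProduct.induction_on with
  | zero => simp
  | add x y hx hy =>
    have h : x + y - 1 ⊗ₜ[K] coeff L ε.toLinearMap (x + y)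
        = (x - 1 ⊗ₜ[K] coeff L ε.toLinearMap x) + (y - 1 ⊗ₜ[K] coeff L ε.toLinearMap y) := by
      rw [map_add, TensorProduct.tmul_add]; abel
    rw [h]
    exact add_mem hx hy
  | tmul a l =>
    have h : a ⊗ₜ[K] l - 1 ⊗ₜ[K] coeff L ε.toLinearMap (a ⊗ₜ[K] l)
        = (a - algebraMap K A (ε a)) • ((1 : A) ⊗ₜ[K] l) := by
      rw [sub_smul, ← one_tmul_smul, coeff_tmul, algebraMap_smul, TensorProduct.tmul_smul]
      rfl
    rw [h]
    exact Submodule.smul_mem_smul (by simp [RingHom.mem_ker]) trivial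

/-- `ρ - 1` raises the `𝔐`-adic filtration by one, so it is nilpotent and `ρ` is unipotent. Hence
morphisms over `L` are automatically isomorphisms and `IsMorphism` need not ask for invertibility.
-/
theorem bijective_of_aug (hε : IsNilpotent (RingHom.ker ε)) {ρ : A ⊗[K] L →ₗ[A] A ⊗[K] L}
    (hρ : ∀ x, coeff L ε.toLinearMap (ρ x) = coeff L ε.toLinearMap x) : Function.Bijective ρ := by
  obtain ⟨n, hn⟩ := hε
  let N : Module.End A (A ⊗[K] L) := ρ - 1
  have h1 : ∀ x, N x ∈ (RingHom.ker ε) • (⊤ : Submodule A (A ⊗[K] L)) := fun x => by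
    have h2 := sub_mem (sub_one_tmul_mem (ε := ε) (ρ x)) (sub_one_tmul_mem (ε := ε) x)
    rw [hρ, sub_sub_sub_cancel_right] at h2
    exact h2
  have h3 : ∀ k x, (N ^ k) x ∈ (RingHom.ker ε) ^ k • (⊤ : Submodule A (A ⊗[K] L)) := by
    intro k
    induction k with
    | zero => simp
    | succ k ih =>
      intro x
      have h4 : (RingHom.ker ε) ^ k • (⊤ : Submodule A (A ⊗[K] L))
          ≤ ((RingHom.ker ε) ^ (k + 1) • (⊤ : Submodule A (A ⊗[K] L))).comap N := by
        refine Submodule.smul_le.2 fun r hr y _ => ?_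
        rw [Submodule.mem_comap, map_smul, pow_succ, Submodule.mul_smul]
        exact Submodule.smul_mem_smul hr (h1 y)
      rw [pow_succ' N k]
      exact h4 (ih x)
  have h5 : N ^ n = 0 := LinearMap.ext fun x => by
    have h6 := h3 n x
    rw [hn] at h6
    simpa using h6
  have h7 : IsUnit (1 + N) := IsNilpotent.isUnit_one_add ⟨n, h5⟩
  have h8 : 1 + N = ρ := add_sub_cancel _ _
  rw [h8] at h7
  exact (Module.End.isUnit_iff ρ).1 h7

/-- The `B`-linear map of `B ⊗ L` which is a lift, along a linear section `s`, of an `A`-linear map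
of `A ⊗ L`. -/
def liftEnd (s : A →ₗ[K] B) (ρ : A ⊗[K] L →ₗ[A] A ⊗[K] L) : B ⊗[K] L →ₗ[B] B ⊗[K] L :=
  LinearMap.liftBaseChange B (baseMap L s ∘ₗ ρ.restrictScalars K ∘ₗ TensorProduct.mk K A L 1)

theorem liftEnd_one_tmul (s : A →ₗ[K] B) (ρ : A ⊗[K] L →ₗ[A] A ⊗[K] L) (l : L) :
    liftEnd s ρ (1 ⊗ₜ l) = baseMap L s (ρ (1 ⊗ₜ l)) := by
  simp [liftEnd]

theorem baseMap_liftEnd {p : B →ₐ[K] A} {s : A →ₗ[K] B} (hs : ∀ a, p (s a) = a)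
    (ρ : A ⊗[K] L →ₗ[A] A ⊗[K] L) (t : B ⊗[K] L) :
    baseMap L p.toLinearMap (liftEnd s ρ t) = ρ (baseMap L p.toLinearMap t) := by
  have h : p.toLinearMap ∘ₗ s = LinearMap.id := LinearMap.ext hs
  induction t using TensorProduct.induction_on with
  | zero => simp
  | add x y hx hy => simp only [map_add, hx, hy]
  | tmul b l =>
    rw [one_tmul_smul b, map_smul, baseMap_smul, baseMap_smul, liftEnd_one_tmul,
      baseMap_comp_linear, h, map_smul, baseMap_tmul, AlgHom.toLinearMap_apply, map_one,
      baseMap, LinearMap.rTensor_id, LinearMap.id_apply]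

/-- The deformation obtained from `lam` by an automorphism of `A ⊗ L` over `L`. -/
def Deformation.transport (lam : Deformation br ε) (ρ : A ⊗[K] L ≃ₗ[A] A ⊗[K] L)
    (hρ : ∀ x, coeff L ε.toLinearMap (ρ x) = coeff L ε.toLinearMap x) : Deformation br ε where
  bracket := (lam.bracket.compl₁₂ ρ.symm.toLinearMap ρ.symm.toLinearMap).compr₂ ρ.toLinearMap
  leibniz x y z := by simp [lam.leibniz]
  augmentation x y := by
    have h : ∀ x, coeff L ε.toLinearMap (ρ.symm x) = coeff L ε.toLinearMap x := fun x => by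
      rw [← hρ, LinearEquiv.apply_symm_apply]
    simp [hρ, lam.augmentation, h]

theorem Deformation.isMorphism_transport (lam : Deformation br ε) (ρ : A ⊗[K] L ≃ₗ[A] A ⊗[K] L)
    (hρ : ∀ x, coeff L ε.toLinearMap (ρ x) = coeff L ε.toLinearMap x) :
    IsMorphism ρ.toLinearMap lam (lam.transport ρ hρ) :=
  ⟨fun x y => by simp [transport], hρ⟩

/-- A morphism between deformations over `A` can be made the identity by changing a lift of its
source to `B`. -/
theorem exists_transport {p : B →ₐ[K] A} (hp : ε.comp p = εB) (hε : IsNilpotent (RingHom.ker εB))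
    {s : A →ₗ[K] B} (hs : ∀ a, p (s a) = a) (lam : Deformation br εB) {mu : Deformation br ε}
    {ρ : A ⊗[K] L →ₗ[A] A ⊗[K] L} (hρ : IsMorphism ρ (lam.pushout p hp) mu) :
    ∃ (lam' : Deformation br εB) (τ : B ⊗[K] L →ₗ[B] B ⊗[K] L), IsMorphism τ lam lam' ∧
      lam'.pushout p hp = mu ∧
      ∀ t, baseMap L p.toLinearMap (τ t) = ρ (baseMap L p.toLinearMap t) := by
  -- A lift of `ρ` still covers the identity of `L`, so it is invertible and can transport `lam`.
  have h1 : ∀ x, coeff L εB.toLinearMap (liftEnd s ρ x) = coeff L εB.toLinearMap x := fun x => by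
    rw [← coeff_baseMap p hp, baseMap_liftEnd hs, hρ.aug, coeff_baseMap p hp]
  let τ : B ⊗[K] L ≃ₗ[B] B ⊗[K] L := LinearEquiv.ofBijective _ (bijective_of_aug hε h1)
  have hτ : ∀ t, baseMap L p.toLinearMap (τ t) = ρ (baseMap L p.toLinearMap t) :=
    baseMap_liftEnd hs ρ
  have h2 : ∀ t, ρ (baseMap L p.toLinearMap (τ.symm t)) = baseMap L p.toLinearMap t := fun t => by
    rw [← hτ, LinearEquiv.apply_symm_apply]
  refine ⟨lam.transport τ h1, τ.toLinearMap, lam.isMorphism_transport τ h1, ?_, hτ⟩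
  refine Deformation.ext_gen fun x y => ?_
  rw [Deformation.pushout_one_tmul]
  change baseMap L p.toLinearMap (τ (lam.bracket (τ.symm (1 ⊗ₜ x)) (τ.symm (1 ⊗ₜ y)))) = _
  rw [hτ, ← Deformation.pushout_baseMap p hp, hρ.bracket, h2, h2]
  simp

/-- Lifts which differ by coboundaries are isomorphic. -/
theorem exists_isMorphism_of_coboundary {ι : Type*} [Fintype ι] {e : ι → B}
    (he : ∀ b j, b * e j = εB b • e j) (hε : ∀ j, εB (e j) = 0) (g : ι → L →ₗ[K] L)
    {lam mu : Deformation br εB}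
    (h : ∀ x y : L, lam.bracket (1 ⊗ₜ x) (1 ⊗ₜ y)
      = mu.bracket (1 ⊗ₜ x) (1 ⊗ₜ y) + ∑ j, e j ⊗ₜ[K] d1 br (g j) x y) :
    ∃ τ : B ⊗[K] L →ₗ[B] B ⊗[K] L, IsMorphism τ lam mu ∧
      ∀ l : L, τ (1 ⊗ₜ l) = 1 ⊗ₜ l + ∑ j, e j ⊗ₜ[K] g j l := by
  -- The isomorphism is the identity plus `∑ e j ⊗ g j`; terms quadratic in the `g j` vanish because
  -- products of the `e j` are zero.
  let τ : B ⊗[K] L →ₗ[B] B ⊗[K] L := LinearMap.liftBaseChange B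
    (TensorProduct.mk K B L 1 + ∑ j, TensorProduct.mk K B L (e j) ∘ₗ g j)
  have h1 : ∀ l : L, τ (1 ⊗ₜ l) = 1 ⊗ₜ l + ∑ j, e j ⊗ₜ[K] g j l := fun l => by
    simp [τ, LinearMap.sum_apply]
  have h2 : ∀ t, τ t = t + ∑ j, e j ⊗ₜ[K] g j (coeff L εB.toLinearMap t) := by
    intro t
    induction t using TensorProduct.induction_on with
    | zero => simp
    | add x y hx hy =>
      simp only [map_add, hx, hy, TensorProduct.tmul_add, Finset.sum_add_distrib]; abel
    | tmul b l =>
      rw [one_tmul_smul b l, map_smul, h1, smul_add, Finset.smul_sum]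
      simp only [smul_tmul_of_mul he, coeff_smul, coeff_tmul, AlgHom.toLinearMap_apply, map_one,
        one_smul, map_smul]
  have hmu : ∀ x y : L, coeff L εB.toLinearMap (mu.bracket (1 ⊗ₜ x) (1 ⊗ₜ y)) = br.bracket x y :=
    fun x y => by rw [mu.augmentation]; simp
  refine ⟨τ, IsMorphism.of_gen (fun x y => ?_) fun l => ?_, h1⟩
  · rw [h2, lam.augmentation, h, h1, h1]
    simp only [map_add, map_sum, LinearMap.add_apply, LinearMap.sum_apply,
      bracket_tmul_of_mul he hmu, tmul_bracket_of_mul he hmu, coeff_tmul, hε, zero_smul,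
      AlgHom.toLinearMap_apply, map_one, one_smul, Finset.sum_const_zero, add_zero, map_zero,
      LinearMap.zero_apply, TensorProduct.tmul_zero, d1, TensorProduct.tmul_add,
      TensorProduct.tmul_sub, Finset.sum_add_distrib, Finset.sum_sub_distrib]
    abel
  · rw [h1]
    simp [hε]

end Morphism

/-! ### Extension of a deformation to the next base. -/

section Obstruction

variable {K : Type*} [Field K] {L : Type*} [AddCommGroup L] [Module K L]
variable {br : LeibnizBracket K L}
variable {A : Type*} [CommRing A] [Algebra K A] {ε : A →ₐ[K] K}

theorem obstructionMap_mk_eq_zero_iff (lam : Deformation br ε) (f : HarrisonCocycle ε K) :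
    obstructionMap lam (Submodule.Quotient.mk f) = 0 ↔
      ∃ G : L →ₗ[K] L →ₗ[K] L, ∀ x y z, (obstructionCocycle lam f).1 x y z = d2 br G x y z :=
  Submodule.Quotient.mk_eq_zero _

/-- The map `H²_Harr(A; K)' → C̄ / ī(ω'(HL³(L; L)'))`. -/
def nextIncl (lam : Deformation br ε) (μ : H2Harr ε →ₗ[K] HarrisonCocycle ε K) :
    Module.Dual K (H2Harr ε) →ₗ[K] NextBase lam μ :=
  (Ideal.Quotient.mkₐ K (obstructionIdeal lam μ)).toLinearMap ∘ₗ HarrisonExt.incl _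

/-- The linear section of the projection of the new base to the old one. -/
def nextSec (lam : Deformation br ε) (μ : H2Harr ε →ₗ[K] HarrisonCocycle ε K) :
    A →ₗ[K] NextBase lam μ :=
  (Ideal.Quotient.mkₐ K (obstructionIdeal lam μ)).toLinearMap ∘ₗ HarrisonExt.sec _

section

variable (lam : Deformation br ε) (μ : H2Harr ε →ₗ[K] HarrisonCocycle ε K)

theorem nextSec_mul (a b : A) : nextSec lam μ a * nextSec lam μ b
    = nextSec lam μ (a * b) + nextIncl lam μ ((universalCocycle μ).1 a b) := by
  change Ideal.Quotient.mk (obstructionIdeal lam μ) (HarrisonExt.sec _ a * HarrisonExt.sec _ b)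
    = Ideal.Quotient.mk _ (HarrisonExt.sec _ (a * b) + HarrisonExt.incl _ _)
  congr 1
  ext <;> simp

theorem mul_nextIncl (b : NextBase lam μ) (v : Module.Dual K (H2Harr ε)) :
    b * nextIncl lam μ v = nextAug lam μ b • nextIncl lam μ v := by
  obtain ⟨b, rfl⟩ := Ideal.Quotient.mk_surjective b
  rw [← map_smul]
  exact congrArg (Ideal.Quotient.mk (obstructionIdeal lam μ)) (HarrisonExt.mul_incl b v)

theorem nextProj_nextIncl (v : Module.Dual K (H2Harr ε)) :
    nextProj lam μ (nextIncl lam μ v) = 0 := rfl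

theorem nextProj_nextSec (a : A) : nextProj lam μ (nextSec lam μ a) = a := rfl

theorem nextProj_surjective : Function.Surjective (nextProj lam μ) := fun a =>
  ⟨_, nextProj_nextSec lam μ a⟩

theorem nextAug_nextIncl (v : Module.Dual K (H2Harr ε)) : nextAug lam μ (nextIncl lam μ v) = 0 :=
  map_zero ε

theorem eq_nextSec_add (x : NextBase lam μ) :
    ∃ v, x = nextSec lam μ (nextProj lam μ x) + nextIncl lam μ v := by
  obtain ⟨x, rfl⟩ := Ideal.Quotient.mk_surjective x
  refine ⟨x.2, ?_⟩
  change Ideal.Quotient.mk (obstructionIdeal lam μ) x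
    = Ideal.Quotient.mk _ (HarrisonExt.sec _ x.1 + HarrisonExt.incl _ x.2)
  congr 1
  ext <;> simp

/-- A form killing the kernel of `ω` lies in the range of the dual map `ω'`, and this range is
exactly what the quotient divides out. -/
theorem nextIncl_eq_zero {v : Module.Dual K (H2Harr ε)}
    (hv : ∀ c, obstructionMap lam c = 0 → v c = 0) : nextIncl lam μ v = 0 := by
  have h1 : v ∈ (obstructionMap lam).dualMap.range := by
    rw [LinearMap.range_dualMap_eq_dualAnnihilator_ker, Submodule.mem_dualAnnihilator]
    exact hv
  obtain ⟨ψ, rfl⟩ := h1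
  exact Ideal.Quotient.eq_zero_iff_mem.2 ⟨ψ, rfl⟩

end

/-- A deformation extends along a surjection with a linear section which is multiplicative up to
cocycles with vanishing obstruction. -/
theorem exists_extension_of_section {B : Type*} [CommRing B] [Algebra K B] {εB : B →ₐ[K] K}
    (lam : Deformation br ε) {p : B →ₐ[K] A} (hp : ε.comp p = εB) {σ : A →ₗ[K] B}
    (hpσ : p.toLinearMap ∘ₗ σ = LinearMap.id) {ι : Type*} [Fintype ι] {e : ι → B}
    (he : ∀ b j, b * e j = εB b • e j) (hpe : ∀ j, p (e j) = 0) {f : ι → HarrisonCocycle ε K}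
    (hσ : ∀ a b, σ a * σ b = σ (a * b) + ∑ j, (f j).1 a b • e j)
    {G : ι → L →ₗ[K] L →ₗ[K] L}
    (hG : ∀ j x y z, (obstructionCocycle lam (f j)).1 x y z = d2 br (G j) x y z) :
    ∃ lam' : Deformation br εB, lam'.pushout p hp = lam := by
  have hε : ∀ j, εB (e j) = 0 := fun j => by rw [← hp, AlgHom.comp_apply, hpe, map_zero]
  have hproj : ∀ x y : L, baseMap L p.toLinearMap
      ((linearPush σ lam.bracket + cochainExt e (-G)) (1 ⊗ₜ x) (1 ⊗ₜ y))
        = lam.bracket (1 ⊗ₜ x) (1 ⊗ₜ y) := fun x y => by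
    rw [LinearMap.add_apply, LinearMap.add_apply, linearPush_one_tmul, cochainExt_one_tmul,
      map_add, baseMap_comp_linear, hpσ, map_sum]
    simp [hpe, baseMap]
  have haug : ∀ x y : L, coeff L εB.toLinearMap
      (linearPush σ lam.bracket (1 ⊗ₜ x) (1 ⊗ₜ y)) = br.bracket x y := fun x y => by
    rw [linearPush_one_tmul, ← coeff_baseMap p hp, baseMap_comp_linear, hpσ,
      baseMap, LinearMap.rTensor_id, LinearMap.id_apply, lam.augmentation]
    simp
  -- The defect of `linearPush σ` is `∑ e j ⊗ d2 (G j)`, so subtracting the cochains `G j` cancels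
  -- it.
  refine ⟨{ bracket := linearPush σ lam.bracket + cochainExt e (-G)
            leibniz := fun x y z => ?_
            augmentation := augmentation_of_gen br fun x y => ?_ }, ?_⟩
  · rw [← leibnizator_eq_zero_iff]
    refine leibnizator_eq_zero _ (fun x y z => ?_) x y z
    rw [leibnizator_add_cochainExt he hε haug, leibnizator_linearPush lam hσ,
      ← Finset.sum_add_distrib]
    refine Finset.sum_eq_zero fun j _ => ?_
    rw [hG, ← TensorProduct.tmul_add]
    have h : d2 br ((-G) j) x y z = - d2 br (G j) x y z := by
      simp only [d2, Pi.neg_apply, LinearMap.neg_apply, map_neg]; abel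
    rw [h, add_neg_cancel, TensorProduct.tmul_zero]
  · rw [← coeff_baseMap p hp, hproj, lam.augmentation]
    simp
  · refine Deformation.ext_gen fun x y => ?_
    rw [Deformation.pushout_one_tmul]
    exact hproj x y

/-- `N` depends only on the restriction of a form to `ker ω`. That restriction is expanded in a
basis of `ker ω`, whose dual basis is extended to `V` by a projection `π`. Applied to `nextIncl`,
this shows that only unobstructed classes enter the multiplication of the new base. -/
theorem exists_dual_basis_ker {V W X : Type*} [AddCommGroup V] [Module K V] [AddCommGroup W]
    [Module K W] [AddCommGroup X] [Module K X] [FiniteDimensional K V] (ω : V →ₗ[K] W)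
    (N : Module.Dual K V →ₗ[K] X) (hN : ∀ v, (∀ c, ω c = 0 → v c = 0) → N v = 0) :
    ∃ (n : ℕ) (c : Fin n → V) (e : Fin n → Module.Dual K V), (∀ j, ω (c j) = 0) ∧
      ∀ v, N v = ∑ j, v (c j) • N (e j) := by
  obtain ⟨π, hπ⟩ := ω.ker.subtype.exists_leftInverse_of_injective (Submodule.ker_subtype _)
  let b := Module.finBasis K ω.ker
  refine ⟨_, fun j => (b j).1, fun j => b.coord j ∘ₗ π, fun j => (b j).2, fun v => ?_⟩
  rw [← sub_eq_zero]
  simp only [← map_smul, ← map_sum, ← map_sub]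
  refine hN _ fun c hc => ?_
  have h2 : π c = ⟨c, hc⟩ := LinearMap.congr_fun hπ ⟨c, hc⟩
  have h3 := congrArg (v ∘ₗ Submodule.subtype _) (b.sum_repr ⟨c, hc⟩)
  rw [map_sum] at h3
  simp only [map_smul, LinearMap.comp_apply, Submodule.subtype_apply] at h3
  rw [LinearMap.sub_apply, ← h3, sub_eq_zero, LinearMap.sum_apply]
  refine Finset.sum_congr rfl fun j _ => ?_
  rw [LinearMap.smul_apply, LinearMap.comp_apply, h2, Module.Basis.coord_apply, smul_eq_mul,
    smul_eq_mul, mul_comm]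

/-- A deformation extends to the new base. -/
theorem exists_extension (lam : Deformation br ε) (μ : H2Harr ε →ₗ[K] HarrisonCocycle ε K)
    (hμ : ∀ c, Submodule.Quotient.mk (μ c) = c) [FiniteDimensional K (H2Harr ε)] :
    ∃ lam' : Deformation br (nextAug lam μ), lam'.pushout (nextProj lam μ) rfl = lam := by
  obtain ⟨n, c, e, hc, hspan⟩ := exists_dual_basis_ker (obstructionMap lam) (nextIncl lam μ)
    fun _ => nextIncl_eq_zero lam μ
  have hc' : ∀ j, ∃ G : L →ₗ[K] L →ₗ[K] L, ∀ x y z,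
      (obstructionCocycle lam (μ (c j))).1 x y z = d2 br G x y z := fun j => by
    rw [← obstructionMap_mk_eq_zero_iff, hμ, hc]
  choose G hG using hc'
  refine exists_extension_of_section lam rfl (σ := nextSec lam μ)
    (e := fun j => nextIncl lam μ (e j)) (f := fun j => μ (c j)) (LinearMap.ext fun a => rfl)
    (fun b j => mul_nextIncl lam μ b _) (fun j => nextProj_nextIncl lam μ _) (fun a b => ?_) hG
  rw [nextSec_mul, hspan]
  rfl

end Obstruction

/-! ### Existence of the choices. -/

section Construction

variable {K : Type u} [Field K] {L : Type v} [AddCommGroup L] [Module K L]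
variable {br : LeibnizBracket K L}

/-- A surjection of vector spaces splits, which gives representatives, and the obstructions to
extending `S.η` have been divided out. -/
theorem nonempty_step (S : Stage br) : Nonempty (Step S) := by
  obtain ⟨μ, hμ⟩ := ((HarrisonCoboundary S.ε K).submoduleOf
    (HarrisonCocycle S.ε K)).mkQ.exists_rightInverse_of_surjective (Submodule.range_mkQ _)
  have hμ' : ∀ c, Submodule.Quotient.mk (μ c) = c := fun c => LinearMap.congr_fun hμ c
  obtain ⟨lam, h⟩ := exists_extension S.η μ hμ'
  exact ⟨⟨μ, hμ', lam, h⟩⟩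

variable (br) in
theorem nonempty_construction : Nonempty (Construction br) := by
  obtain ⟨μ, hμ⟩ := ((B2 br).submoduleOf (Z2 br)).mkQ.exists_rightInverse_of_surjective
    (Submodule.range_mkQ _)
  exact ⟨⟨μ, fun c => LinearMap.congr_fun hμ c, fun _ S => (nonempty_step S).some⟩⟩

end Construction

/-! ### Lifting algebra homomorphisms through small extensions. -/

section Lifting

variable {K : Type*} [Field K]
variable {A : Type*} [CommRing A] [Algebra K A] {εA : A →ₐ[K] K}
variable {B : Type*} [CommRing B] [Algebra K B] {p : B →ₐ[K] A} {εB : B →ₐ[K] K} {n : ℕ}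
variable {S : Type*} [CommRing S] [Algebra K S] {ε : S →ₐ[K] K}

theorem aug_eq_zero_of_proj (hp : εA.comp p = εB) {w : B} (hw : p w = 0) : εB w = 0 := by
  rw [← hp, AlgHom.comp_apply, hw, map_zero]

theorem exists_algHom_quotient {R : Type*} [CommRing R] [Algebra K R] (I : Ideal R) (Ψ : R →ₐ[K] B)
    (hΨ : ∀ x ∈ I, Ψ x = 0) {φ : R ⧸ I →ₐ[K] A} (hφ : ∀ x, p (Ψ x) = φ (Ideal.Quotient.mk I x)) :
    ∃ ψ : R ⧸ I →ₐ[K] B, p.comp ψ = φ := by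
  refine ⟨Ideal.Quotient.liftₐ I Ψ hΨ, AlgHom.ext fun x => ?_⟩
  obtain ⟨x, rfl⟩ := Ideal.Quotient.mk_surjective x
  exact hφ x

namespace SmallExt

variable (E : SmallExt p εB n)

include E in
theorem mul_of_proj_eq_zero {w : B} (hw : p w = 0) (b : B) : b * w = εB b • w := by
  rw [E.decomp w, hw, map_zero, zero_add, Finset.mul_sum, Finset.smul_sum]
  exact Finset.sum_congr rfl fun j _ => by rw [mul_smul_comm, E.mul_e, smul_comm]

theorem eq_sum_of_proj_eq_zero {w : B} (hw : p w = 0) : w = ∑ j, E.r j w • E.e j := by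
  conv_lhs => rw [E.decomp w, hw, map_zero, zero_add]

/-- A linear lift of a homomorphism is multiplicative up to Harrison cocycles. -/
theorem exists_harrisonCocycle (hp : εA.comp p = εB) {φ : S →ₐ[K] A} (hφ : εA.comp φ = ε)
    {σ : S →ₗ[K] B} (hσ : ∀ a, p (σ a) = φ a) :
    ∃ f : Fin n → HarrisonCocycle ε K,
      ∀ a b, σ a * σ b = σ (a * b) + ∑ j, (f j).1 a b • E.e j := by
  let F : S → S → B := fun a b => σ a * σ b - σ (a * b)
  have hF : ∀ a b, p (F a b) = 0 := fun a b => by simp [F, hσ]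
  have hεσ : ∀ a, εB (σ a) = ε a := fun a => by
    rw [← hp, ← hφ, AlgHom.comp_apply, hσ, AlgHom.comp_apply]
  refine ⟨fun j => ⟨((LinearMap.mul K B).compl₁₂ σ σ).compr₂ (E.r j)
    - (LinearMap.mul K S).compr₂ (E.r j ∘ₗ σ), fun a b => ?_, fun a b c => ?_⟩, fun a b => ?_⟩
  · simp [mul_comm]
  · have h1 : σ a * F b c - σ c * F a b - F (a * b) c + F a (b * c) = 0 := by
      simp only [F, mul_assoc]; ring
    rw [E.mul_of_proj_eq_zero (hF b c), E.mul_of_proj_eq_zero (hF a b), hεσ, hεσ] at h1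
    have h2 := congrArg (E.r j) h1
    simp only [F, map_add, map_sub, map_smul, map_zero, smul_eq_mul] at h2
    simp only [LinearMap.sub_apply, LinearMap.compr₂_apply, LinearMap.compl₁₂_apply,
      LinearMap.mul_apply', LinearMap.comp_apply, smul_eq_mul]
    linear_combination h2
  · have h1 := E.eq_sum_of_proj_eq_zero (hF a b)
    rw [← sub_eq_iff_eq_add']
    refine h1.trans (Finset.sum_congr rfl fun j _ => ?_)
    rw [map_sub]
    rfl

/-- The cocycles of a linear lift of a homomorphism may be replaced by cohomologous ones. -/
theorem exists_lift_of_representatives (hp : εA.comp p = εB) {φ : S →ₐ[K] A}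
    (hφ : εA.comp φ = ε) (μ : H2Harr ε →ₗ[K] HarrisonCocycle ε K)
    (hμ : ∀ c, Submodule.Quotient.mk (μ c) = c) :
    ∃ (σ : S →ₗ[K] B) (c : Fin n → H2Harr ε), (∀ a, p (σ a) = φ a) ∧
      ∀ a b, σ a * σ b = σ (a * b) + ∑ j, (μ (c j)).1 a b • E.e j := by
  have hσ : ∀ a, p ((E.sec ∘ₗ φ.toLinearMap) a) = φ a := fun a => E.proj_sec _
  obtain ⟨f, hf⟩ := E.exists_harrisonCocycle hp hφ hσ
  set σ := E.sec ∘ₗ φ.toLinearMap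
  have h1 : ∀ j, ∃ g : S →ₗ[K] K, ∀ a b, (f j).1 a b
      = (μ (Submodule.Quotient.mk (f j))).1 a b + (ε a • g b - g (a * b) + ε b • g a) := by
    intro j
    have h2 : f j - μ (Submodule.Quotient.mk (f j))
        ∈ (HarrisonCoboundary ε K).submoduleOf (HarrisonCocycle ε K) :=
      (Submodule.Quotient.eq _).1 (hμ _).symm
    obtain ⟨g, hg⟩ := h2
    refine ⟨g, fun a b => ?_⟩
    rw [← hg]
    simp
  choose g hg using h1
  have hεσ : ∀ a, εB (σ a) = ε a := fun a => by
    rw [← hp, ← hφ, AlgHom.comp_apply, hσ, AlgHom.comp_apply]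
  -- Subtracting `∑ g j • e j` from `σ` subtracts the coboundary of `g j` from the `j`-th cocycle,
  -- since products of two kernel elements vanish.
  refine ⟨σ - ∑ j, (g j).smulRight (E.e j), fun j => Submodule.Quotient.mk (f j), fun a => ?_,
    fun a b => ?_⟩
  · simp [hσ, LinearMap.sum_apply, E.proj_e]
  · have hk : ∀ a, p (∑ j, g j a • E.e j) = 0 := fun a => by simp [E.proj_e]
    have h3 : (∑ j, g j a • E.e j) * (∑ j, g j b • E.e j) = 0 := by
      rw [E.mul_of_proj_eq_zero (hk b), aug_eq_zero_of_proj hp (hk a), zero_smul]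
    have h4 := E.mul_of_proj_eq_zero (hk b) (σ a)
    have h5 := E.mul_of_proj_eq_zero (hk a) (σ b)
    rw [hεσ] at h4 h5
    simp only [LinearMap.sub_apply, LinearMap.sum_apply, LinearMap.smulRight_apply]
    have h6 : (∑ j, (f j).1 a b • E.e j) = (∑ j, (μ (Submodule.Quotient.mk (f j))).1 a b • E.e j)
        + (ε a • (∑ j, g j b • E.e j) - (∑ j, g j (a * b) • E.e j)
          + ε b • ∑ j, g j a • E.e j) := by
      simp only [hg, add_smul, sub_smul, Finset.sum_add_distrib, Finset.sum_sub_distrib,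
        Finset.smul_sum, smul_assoc]
    linear_combination hf a b + h3 - h4 - h5 + h6

include E in
/-- A homomorphism changes to another one by adding derivations with values in the kernel. -/
theorem exists_algHom_add (hp : εA.comp p = εB) {ψ : S →ₐ[K] B} (hψ : εB.comp ψ = ε)
    (δ : Fin n → S →ₗ[K] K) (hδ1 : ∀ j, δ j 1 = 0)
    (hδ : ∀ j a b, δ j (a * b) = ε a * δ j b + ε b * δ j a) :
    ∃ ψ' : S →ₐ[K] B, ∀ a, ψ' a = ψ a + ∑ j, δ j a • E.e j := by
  have hk : ∀ a, p (∑ j, δ j a • E.e j) = 0 := fun a => by simp [E.proj_e]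
  refine ⟨AlgHom.ofLinearMap (ψ.toLinearMap + ∑ j, (δ j).smulRight (E.e j)) ?_ fun a b => ?_,
    fun a => ?_⟩
  · simp [LinearMap.sum_apply, hδ1]
  · have h3 : (∑ j, δ j a • E.e j) * (∑ j, δ j b • E.e j) = 0 := by
      rw [E.mul_of_proj_eq_zero (hk b), aug_eq_zero_of_proj hp (hk a), zero_smul]
    have h4 := E.mul_of_proj_eq_zero (hk b) (ψ a)
    have h5 := E.mul_of_proj_eq_zero (hk a) (ψ b)
    rw [← AlgHom.comp_apply, hψ] at h4 h5
    have h6 : ∑ j, δ j (a * b) • E.e j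
        = ε a • (∑ j, δ j b • E.e j) + ε b • ∑ j, δ j a • E.e j := by
      simp only [hδ, add_smul, Finset.sum_add_distrib, Finset.smul_sum, mul_smul]
    simp only [LinearMap.add_apply, LinearMap.sum_apply, LinearMap.smulRight_apply,
      AlgHom.toLinearMap_apply, map_mul]
    linear_combination h6 - h3 - h4 - h5
  · change ψ a + (∑ j, (δ j).smulRight (E.e j)) a = _
    rw [LinearMap.sum_apply]
    rfl

end SmallExt

variable {L : Type*} [AddCommGroup L] [Module K L] {br : LeibnizBracket K L}

/-- The homomorphism is induced by `(a, v) ↦ σ a + ∑ v (c j) • e j`. It is multiplicative because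
the universal cocycle evaluated at `c j` is `μ (c j)`, and it kills the obstruction ideal because
each `c j` has zero obstruction. This is the mapping property for which the new base is made. -/
theorem SmallExt.exists_algHom_nextBase (E : SmallExt p εB n) (hp : εA.comp p = εB)
    {φ : S →ₐ[K] A} (hφ : εA.comp φ = ε) {lam : Deformation br ε}
    {μ : H2Harr ε →ₗ[K] HarrisonCocycle ε K}
    {σ : S →ₗ[K] B} {c : Fin n → H2Harr ε} (hpσ : ∀ a, p (σ a) = φ a)
    (hσ : ∀ a b, σ a * σ b = σ (a * b) + ∑ j, (μ (c j)).1 a b • E.e j)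
    (hc : ∀ j, obstructionMap lam (c j) = 0) :
    ∃ ψ : NextBase lam μ →ₐ[K] B, p.comp ψ = φ.comp (nextProj lam μ) := by
  have hεσ : ∀ a, εB (σ a) = ε a := fun a => by
    rw [← hp, ← hφ, AlgHom.comp_apply, hpσ, AlgHom.comp_apply]
  have hk : ∀ v : Module.Dual K (H2Harr ε), p (∑ j, v (c j) • E.e j) = 0 := fun v => by
    simp [E.proj_e]
  let Ψ : HarrisonExt (universalCocycle μ) →ₗ[K] B :=
    σ ∘ₗ (HarrisonExt.proj (universalCocycle μ)).toLinearMap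
      + ∑ j, ((Module.Dual.eval K _ (c j)) ∘ₗ HarrisonExt.retr _).smulRight (E.e j)
  have hΨ : ∀ x, Ψ x = σ x.1 + ∑ j, x.2 (c j) • E.e j := fun x => by
    simp [Ψ, LinearMap.sum_apply]
  -- The unit of the extension is `(1, -f(1, 1))` and `σ 1` need not be `1`. Since `σ 1 - 1` lies in
  -- the kernel, its square is zero, and comparison with `σ 1 * σ 1` shows that it equals `∑ (μ (c
  -- j))(1, 1) • e j`.
  have h1 : Ψ 1 = 1 := by
    have hu : p (σ 1 - 1) = 0 := by simp [hpσ]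
    have h2 := E.mul_of_proj_eq_zero hu (σ 1 - 1)
    rw [aug_eq_zero_of_proj hp hu, zero_smul] at h2
    have h3 := hσ 1 1
    rw [mul_one] at h3
    rw [hΨ]
    have h4 : ∑ j, (1 : HarrisonExt (universalCocycle μ)).2 (c j) • E.e j
        = - ∑ j, (μ (c j)).1 1 1 • E.e j := by
      rw [← Finset.sum_neg_distrib]
      refine Finset.sum_congr rfl fun j _ => ?_
      rw [HarrisonExt.one_snd, LinearMap.neg_apply, universalCocycle_apply, neg_smul]
    rw [h4, HarrisonExt.one_fst]
    linear_combination h3 - h2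
  have h2 : ∀ x y, Ψ (x * y) = Ψ x * Ψ y := fun x y => by
    have h3 : (∑ j, x.2 (c j) • E.e j) * (∑ j, y.2 (c j) • E.e j) = 0 := by
      rw [E.mul_of_proj_eq_zero (hk _), aug_eq_zero_of_proj hp (hk _), zero_smul]
    have h4 := E.mul_of_proj_eq_zero (hk y.2) (σ x.1)
    have h5 := E.mul_of_proj_eq_zero (hk x.2) (σ y.1)
    rw [hεσ] at h4 h5
    have h6 : ∑ j, (x * y).2 (c j) • E.e j = ε x.1 • (∑ j, y.2 (c j) • E.e j)
        + ε y.1 • (∑ j, x.2 (c j) • E.e j) + ∑ j, (μ (c j)).1 x.1 y.1 • E.e j := by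
      simp only [HarrisonExt.mul_snd, LinearMap.add_apply, LinearMap.smul_apply,
        universalCocycle_apply, add_smul, Finset.sum_add_distrib, Finset.smul_sum, smul_assoc]
    rw [hΨ, hΨ, hΨ, HarrisonExt.mul_fst]
    linear_combination h6 - h3 - h4 - h5 - hσ x.1 y.1
  refine exists_algHom_quotient (obstructionIdeal lam μ) (AlgHom.ofLinearMap Ψ h1 h2) ?_
    fun x => ?_
  · rintro x ⟨v, rfl⟩
    change Ψ _ = 0
    rw [hΨ, HarrisonExt.incl_fst, map_zero, zero_add]
    refine Finset.sum_eq_zero fun j _ => ?_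
    rw [HarrisonExt.incl_snd, LinearMap.dualMap_apply, hc, map_zero, zero_smul]
  · change p (Ψ x) = φ x.1
    rw [hΨ, map_add, hpσ, hk, add_zero]

end Lifting

/-! ### Derivations of the base and infinitesimal parts of deformations. -/

section First

variable {K : Type u} [Field K] {L : Type v} [AddCommGroup L] [Module K L]
variable (br : LeibnizBracket K L)

/-- The linear form `(k, h') ↦ h'(α)` on `C₁ = K ⊕ ℍ'`. -/
def firstForm (α : HL2 br) : FirstBase br →ₗ[K] K :=
  Module.Dual.eval K _ α ∘ₗ HarrisonExt.retr _

theorem firstForm_one (α : HL2 br) : firstForm br α 1 = 0 := by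
  change (-(0 : Module.Dual K (HL2 br))) α = 0
  simp

theorem firstForm_incl (α : HL2 br) (v : Module.Dual K (HL2 br)) :
    firstForm br α (firstIncl br v) = v α := rfl

theorem firstForm_mul (α : HL2 br) (a b : FirstBase br) :
    firstForm br α (a * b)
      = firstAug br a * firstForm br α b + firstAug br b * firstForm br α a := by
  change (firstAug br a • b.2 + firstAug br b • a.2 + 0) α = _
  simp [firstForm]

theorem infinitesimalDeformation_one_tmul {C : Type*} [CommRing C] [Algebra K C] {ι : Type*}
    [Fintype ι] (ε : C →ₐ[K] K) (c : ι → C) (hc : ∀ i j, c i * c j = 0) (hε : ∀ i, ε (c i) = 0)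
    (m : ι → Z2 br) (x y : L) :
    (infinitesimalDeformation br ε c hc hε m).bracket (1 ⊗ₜ x) (1 ⊗ₜ y)
      = 1 ⊗ₜ br.bracket x y + ∑ i, c i ⊗ₜ[K] (m i).1 x y := by
  rw [← infinitesimalGen_apply]
  change bilinExt _ _ _ = _
  rw [bilinExt_tmul, one_smul, one_smul]

theorem coeff_infinitesimalDeformation {C : Type*} [CommRing C] [Algebra K C] {ι : Type*}
    [Fintype ι] (ε : C →ₐ[K] K) (c : ι → C) (hc : ∀ i j, c i * c j = 0) (hε : ∀ i, ε (c i) = 0)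
    (m : ι → Z2 br) {d : C →ₗ[K] K} (hd : d 1 = 0) (x y : L) :
    coeff L d ((infinitesimalDeformation br ε c hc hε m).bracket (1 ⊗ₜ x) (1 ⊗ₜ y))
      = (∑ i, d (c i) • m i).1 x y := by
  rw [infinitesimalDeformation_one_tmul, map_add, map_sum, coeff_tmul, hd, zero_smul, zero_add]
  simp only [coeff_tmul, Submodule.coe_sum, Submodule.coe_smul, LinearMap.sum_apply,
    LinearMap.smul_apply]

/-- The linear forms `δ_α`, `α ∈ ℍ`, are derivations of the base along which the deformation `ν` has
the infinitesimal part `μ(α)`. -/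
structure IsInfinitesimalFamily {N : Type*} [CommRing N] [Algebra K N] {ε : N →ₐ[K] K}
    (ν : Deformation br ε) (μ : HL2 br →ₗ[K] Z2 br) (δ : HL2 br → N →ₗ[K] K) : Prop where
  one : ∀ α, δ α 1 = 0
  mul : ∀ α a b, δ α (a * b) = ε a * δ α b + ε b * δ α a
  coeff : ∀ α x y, coeff L (δ α) (ν.bracket (1 ⊗ₜ x) (1 ⊗ₜ y)) = (μ α).1 x y

variable {br}

/-- Derivations pull back along `q` without changing their coefficients. This makes the derivations
of `C₁` available at every later stage. -/
theorem IsInfinitesimalFamily.comp {N : Type*} [CommRing N] [Algebra K N] {ε : N →ₐ[K] K}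
    {ν : Deformation br ε} {μ : HL2 br →ₗ[K] Z2 br} {δ : HL2 br → N →ₗ[K] K}
    (h : IsInfinitesimalFamily br ν μ δ) {M : Type*} [CommRing M] [Algebra K M] {εM : M →ₐ[K] K}
    {q : M →ₐ[K] N} (hq : ε.comp q = εM) {κ : Deformation br εM} (hκ : κ.pushout q hq = ν) :
    IsInfinitesimalFamily br κ μ (fun α => δ α ∘ₗ q.toLinearMap) where
  one α := by simp [h.one]
  mul α a b := by subst hq; simp [h.mul]
  coeff α x y := by
    rw [← h.coeff, ← hκ, Deformation.pushout_one_tmul, coeff_baseMap_linear]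

variable (br) [FiniteDimensional K (HL2 br)]

theorem isInfinitesimalFamily_first (μ : HL2 br →ₗ[K] Z2 br) :
    IsInfinitesimalFamily br (firstDeformation br μ) μ (firstForm br) where
  one := firstForm_one br
  mul := firstForm_mul br
  coeff α x y := by
    refine (coeff_infinitesimalDeformation br (firstAug br) _ _ _ _ (firstForm_one br α) x
      y).trans ?_
    -- This is the expansion of `α` in the basis `hᵢ`, the dual basis supplying the coordinates.
    have h : ∑ i, firstForm br α (firstIncl br ((Module.finBasis K (HL2 br)).coord i))
        • μ (Module.finBasis K (HL2 br) i) = μ α := by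
      conv_rhs => rw [← (Module.finBasis K (HL2 br)).sum_repr α, map_sum]
      refine Finset.sum_congr rfl fun i _ => ?_
      rw [map_smul, firstForm_incl, Module.Basis.coord_apply]
    rw [h]

end First

/-! ### The inductive step of versality. -/

section Step

variable {K : Type u} [Field K] {L : Type v} [AddCommGroup L] [Module K L]
variable {br : LeibnizBracket K L}
variable {A : Type*} [CommRing A] [Algebra K A] {εA : A →ₐ[K] K}
variable {B : Type*} [CommRing B] [Algebra K B] {p : B →ₐ[K] A} {εB : B →ₐ[K] K} {n : ℕ}

theorem Deformation.coeff_one_tmul (lam : Deformation br εB) (x y : L) :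
    coeff L εB.toLinearMap (lam.bracket (1 ⊗ₜ x) (1 ⊗ₜ y)) = br.bracket x y := by
  rw [lam.augmentation]; simp

/-- Two lifts of a deformation differ by cocycles. -/
theorem SmallExt.exists_cocycle (E : SmallExt p εB n) (hε : ∀ j, εB (E.e j) = 0)
    {lam mu : Deformation br εB}
    (h : ∀ x y : L, baseMap L p.toLinearMap (lam.bracket (1 ⊗ₜ x) (1 ⊗ₜ y))
      = baseMap L p.toLinearMap (mu.bracket (1 ⊗ₜ x) (1 ⊗ₜ y))) :
    ∃ G : Fin n → Z2 br, ∀ x y : L, mu.bracket (1 ⊗ₜ x) (1 ⊗ₜ y)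
      = lam.bracket (1 ⊗ₜ x) (1 ⊗ₜ y) + ∑ j, E.e j ⊗ₜ[K] (G j).1 x y := by
  obtain ⟨G, hG⟩ := E.exists_cochain h
  have h0 : ∀ nu : Deformation br εB, ∀ x y z : L,
      leibnizator nu.bracket (1 ⊗ₜ x) (1 ⊗ₜ y) (1 ⊗ₜ z) = 0 := fun nu x y z =>
    leibnizator_eq_zero_iff.2 (nu.leibniz _ _ _)
  refine ⟨fun j => ⟨G j, fun x y z => ?_⟩, fun x y => ?_⟩
  -- Both brackets have zero defect, so the coboundary of each `G j` vanishes.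
  · have h1 := leibnizator_add_cochainExt E.mul_e hε lam.coeff_one_tmul G x y z
    rw [← hG, h0, h0, zero_add] at h1
    have h2 := E.sum_injective (c := fun j => d2 br (G j) x y z) (c' := 0)
      (by rw [← h1]; simp)
    exact congrFun h2 j
  · change _ = _ + ∑ j, E.e j ⊗ₜ[K] G j x y
    rw [hG, LinearMap.add_apply, LinearMap.add_apply, cochainExt_one_tmul]

/-- The obstruction to a lift which is realized by a deformation vanishes. -/
theorem SmallExt.obstructionMap_eq_zero (E : SmallExt p εB n) (hε : ∀ j, εB (E.e j) = 0)
    {S : Type*} [CommRing S] [Algebra K S] {ε : S →ₐ[K] K} {lam : Deformation br ε}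
    {σ : S →ₗ[K] B} {f : Fin n → HarrisonCocycle ε K}
    (hσ : ∀ a b, σ a * σ b = σ (a * b) + ∑ j, (f j).1 a b • E.e j) {mu : Deformation br εB}
    (h : ∀ x y : L, baseMap L p.toLinearMap (mu.bracket (1 ⊗ₜ x) (1 ⊗ₜ y))
      = baseMap L p.toLinearMap (baseMap L σ (lam.bracket (1 ⊗ₜ x) (1 ⊗ₜ y)))) (j : Fin n) :
    obstructionMap lam (Submodule.Quotient.mk (f j)) = 0 := by
  -- `linearPush σ` differs from `mu`, which has zero defect, by the cochains `G j`; its own defect,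
  -- the obstruction, is therefore their coboundary.
  obtain ⟨G, hG⟩ := E.exists_cochain (b := mu.bracket) (b' := linearPush σ lam.bracket)
    fun x y => by rw [linearPush_one_tmul, h]
  rw [obstructionMap_mk_eq_zero_iff]
  refine ⟨G j, fun x y z => ?_⟩
  have h1 := leibnizator_add_cochainExt E.mul_e hε mu.coeff_one_tmul G x y z
  rw [← hG, leibnizator_linearPush lam hσ, leibnizator_eq_zero_iff.2 (mu.leibniz _ _ _),
    zero_add] at h1
  exact congrFun (E.sum_injective h1) j

theorem eq_add_of_class_eq {f g : Z2 br}
    (h : (Submodule.Quotient.mk f : HL2 br) = Submodule.Quotient.mk g) :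
    ∃ k : L →ₗ[K] L, ∀ x y, f.1 x y = g.1 x y + d1 br k x y := by
  obtain ⟨k, hk⟩ := (Submodule.Quotient.eq _).1 h
  refine ⟨k, fun x y => ?_⟩
  rw [← hk]
  simp

/-- A lift of a homomorphism can be changed by derivations so that two lifts of a
deformation become isomorphic. -/
theorem SmallExt.exists_adjustment (E : SmallExt p εB n) (hp : εA.comp p = εB)
    {N : Type*} [CommRing N] [Algebra K N] {εN : N →ₐ[K] K} {ν : Deformation br εN}
    {μ : HL2 br →ₗ[K] Z2 br} (hμ : ∀ α, Submodule.Quotient.mk (μ α) = α)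
    {d : HL2 br → N →ₗ[K] K} (hd : IsInfinitesimalFamily br ν μ d)
    {ψ : N →ₐ[K] B} (hψ : εB.comp ψ = εN) {lam : Deformation br εB}
    (hlam : ∀ x y : L, baseMap L p.toLinearMap (baseMap L ψ.toLinearMap
        (ν.bracket (1 ⊗ₜ x) (1 ⊗ₜ y))) = baseMap L p.toLinearMap (lam.bracket (1 ⊗ₜ x) (1 ⊗ₜ y))) :
    ∃ (φ : N →ₐ[K] B) (hφ : εB.comp φ = εN) (θ : B ⊗[K] L →ₗ[B] B ⊗[K] L),
      p.comp φ = p.comp ψ ∧ IsMorphism θ lam (ν.pushout φ hφ) ∧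
      ∀ t, baseMap L p.toLinearMap (θ t) = baseMap L p.toLinearMap t := by
  have hε : ∀ j, εB (E.e j) = 0 := fun j => aug_eq_zero_of_proj hp (E.proj_e j)
  obtain ⟨G, hG⟩ := E.exists_cocycle hε (lam := ν.pushout ψ hψ) (mu := lam) fun x y => by
    rw [← hlam, Deformation.pushout_one_tmul]
  -- The `α j` are the classes by which `lam` differs from the push-out along `ψ`. Adding `∑ d (α j)
  -- • e j` to `ψ` moves the push-out by the representatives `μ (α j)`, so that only coboundaries
  -- remain.
  let α : Fin n → HL2 br := fun j => Submodule.Quotient.mk (G j)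
  let δ : Fin n → N →ₗ[K] K := fun j => d (α j)
  obtain ⟨φ, hφ⟩ := E.exists_algHom_add hp hψ δ (fun j => hd.one _) (fun j => hd.mul _)
  have hpφ : p.comp φ = p.comp ψ := AlgHom.ext fun a => by
    rw [AlgHom.comp_apply, hφ, map_add, map_sum, AlgHom.comp_apply, add_eq_left]
    exact Finset.sum_eq_zero fun j _ => by rw [map_smul, E.proj_e, smul_zero]
  have hφε : εB.comp φ = εN := by
    subst hp
    rw [AlgHom.comp_assoc, hpφ, ← AlgHom.comp_assoc, hψ]
  have hφL : φ.toLinearMap = ψ.toLinearMap + ∑ j, (δ j).smulRight (E.e j) :=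
    LinearMap.ext fun a => by
      rw [LinearMap.add_apply, LinearMap.sum_apply]
      exact hφ a
  have hk : ∀ j, ∃ k : L →ₗ[K] L, ∀ x y, (G j).1 x y = (μ (α j)).1 x y + d1 br k x y :=
    fun j => eq_add_of_class_eq (hμ _).symm
  choose k hk using hk
  obtain ⟨θ, hθ, hθ1⟩ := exists_isMorphism_of_coboundary E.mul_e hε k (lam := lam)
    (mu := ν.pushout φ hφε) fun x y => by
      rw [hG, Deformation.pushout_one_tmul, Deformation.pushout_one_tmul, hφL, baseMap_add_form,
        baseMap_sum_smulRight, add_assoc, ← Finset.sum_add_distrib]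
      congr 1
      refine Finset.sum_congr rfl fun j _ => ?_
      rw [hk, hd.coeff, TensorProduct.tmul_add]
  refine ⟨φ, hφε, θ, hpφ, hθ, fun t => ?_⟩
  induction t using TensorProduct.induction_on with
  | zero => simp
  | add x y hx hy => simp only [map_add, hx, hy]
  | tmul b l =>
    rw [one_tmul_smul b l, map_smul, baseMap_smul, baseMap_smul, hθ1, map_add, map_sum]
    simp [E.proj_e]

theorem Step.baseMap_η {S : Stage br} (T : Step S) (x y : L) :
    baseMap L T.proj.toLinearMap (T.next.η.bracket (1 ⊗ₜ x) (1 ⊗ₜ y))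
      = S.η.bracket (1 ⊗ₜ x) (1 ⊗ₜ y) :=
  (Deformation.pushout_one_tmul (nextProj S.η T.μ) rfl T.η x y).symm.trans
    (by rw [T.extends_η])

/-- The inductive step of the versality property. -/
theorem Step.exists_lift {S : Stage br} (T : Step S) {μ : HL2 br →ₗ[K] Z2 br}
    (hμ : ∀ α, Submodule.Quotient.mk (μ α) = α)
    {d : HL2 br → T.next.base →ₗ[K] K} (hd : IsInfinitesimalFamily br T.next.η μ d)
    (hp : εA.comp p = εB) (E : SmallExt p εB n) (hnil : IsNilpotent (RingHom.ker εB))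
    (lam : Deformation br εB) {φ : S.base →ₐ[K] A} (hφ : εA.comp φ = S.ε)
    {ρ : A ⊗[K] L →ₗ[A] A ⊗[K] L}
    (hρ : IsMorphism ρ (lam.pushout p hp) (S.η.pushout φ hφ)) :
    ∃ (φ' : T.next.base →ₐ[K] B) (hφ' : εB.comp φ' = T.next.ε) (ρ' : B ⊗[K] L →ₗ[B] B ⊗[K] L),
      p.comp φ' = φ.comp T.proj ∧ IsMorphism ρ' lam (T.next.η.pushout φ' hφ') ∧
      ∀ t, baseMap L p.toLinearMap (ρ' t) = ρ (baseMap L p.toLinearMap t) := by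
  have hε : ∀ j, εB (E.e j) = 0 := fun j => aug_eq_zero_of_proj hp (E.proj_e j)
  -- After the transport the push-out to `A` equals that of `S.η` and is not merely isomorphic to
  -- it.
  obtain ⟨lam', τ, hτ, hlam', hτp⟩ := exists_transport hp hnil E.proj_sec lam hρ
  have hlam : ∀ x y : L, baseMap L p.toLinearMap (lam'.bracket (1 ⊗ₜ x) (1 ⊗ₜ y))
      = baseMap L φ.toLinearMap (S.η.bracket (1 ⊗ₜ x) (1 ⊗ₜ y)) := fun x y => by
    rw [← Deformation.pushout_one_tmul p hp, hlam', Deformation.pushout_one_tmul]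
  obtain ⟨σ, c, hpσ, hσ⟩ := E.exists_lift_of_representatives hp hφ T.μ T.μ_class
  have hpσ' : p.toLinearMap ∘ₗ σ = φ.toLinearMap := LinearMap.ext hpσ
  -- `lam'` is an actual deformation over `B` above the push-out of `S.η`, which forces these
  -- obstructions to vanish.
  have hc : ∀ j, obstructionMap S.η (c j) = 0 := fun j => by
    rw [← T.μ_class (c j)]
    refine E.obstructionMap_eq_zero hε (f := fun j => T.μ (c j)) hσ (mu := lam') (fun x y => ?_) j
    rw [hlam, baseMap_comp_linear, hpσ']
  obtain ⟨ψ, hψ⟩ : ∃ ψ : T.next.base →ₐ[K] B, p.comp ψ = φ.comp T.proj :=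
    E.exists_algHom_nextBase hp hφ hpσ hσ hc
  have hψε : εB.comp ψ = T.next.ε := by
    have h : εA.comp (φ.comp T.proj) = S.ε.comp T.proj := by rw [← AlgHom.comp_assoc, hφ]
    rw [← hψ, ← AlgHom.comp_assoc, hp] at h
    exact h
  -- The push-out along `ψ` need not be isomorphic to `lam'`; adding derivations with values in the
  -- kernel repairs this without changing `p.comp ψ`.
  obtain ⟨φ', hφ', θ, hpφ', hθ, hθp⟩ := E.exists_adjustment hp hμ hd hψε (lam := lam')
    fun x y => by rw [hlam, baseMap_comp, hψ, ← baseMap_comp, T.baseMap_η]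
  exact ⟨φ', hφ', θ ∘ₗ τ, hpφ'.trans hψ, hθ.comp hτ, fun t => by
    rw [LinearMap.comp_apply, hθp, hτp]⟩

end Step

/-! ### Compatible families in towers of finite-dimensional spaces. -/

section MittagLeffler

variable {K : Type*} [Field K]

theorem exists_seq_of_forall_exists {P : ℕ → Type*} {R : ∀ n, P n → P (n + 1) → Prop} (x : P 0)
    (h : ∀ n x, ∃ y, R n x y) : ∃ f : ∀ n, P n, f 0 = x ∧ ∀ n, R n (f n) (f (n + 1)) := by
  choose g hg using h
  exact ⟨fun n => Nat.rec x g n, rfl, fun n => hg n _⟩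

/-- Downwards the family is forced by its value at level `M`; above `M` nothing is required and the
entries are zero. -/
theorem exists_compatible_below {E : ℕ → Type*} [∀ k, Zero (E k)] (p : ∀ k, E (k + 1) → E k)
    (M : ℕ) (e : E M) : ∃ w : ∀ k, E k, (∀ k < M, p k (w (k + 1)) = w k) ∧ w M = e := by
  induction M with
  | zero => exact ⟨Function.update 0 0 e, fun k hk => absurd hk (Nat.not_lt_zero k),
      Function.update_self _ _ _⟩
  | succ M ih =>
    obtain ⟨w, hw, hwM⟩ := ih (p M e)
    refine ⟨Function.update w (M + 1) e, fun k hk => ?_, Function.update_self _ _ _⟩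
    rcases Nat.lt_succ_iff_lt_or_eq.1 hk with hk' | rfl
    · rw [Function.update_of_ne (by omega), Function.update_of_ne (by omega), hw k hk']
    · rw [Function.update_self, Function.update_of_ne (by omega), hwM]

/-- The Mittag-Leffler property of finite-dimensional vector spaces: compatible linear forms which
do not vanish at any level take the value `1` on a compatible family. -/
theorem exists_compatible_of_forms {E : ℕ → Type*} [∀ k, AddCommGroup (E k)]
    [∀ k, Module K (E k)] [∀ k, FiniteDimensional K (E k)] (p : ∀ k, E (k + 1) →ₗ[K] E k)
    (t : ∀ k, E k →ₗ[K] K) (ht : ∀ k x, t k (p k x) = t (k + 1) x) (h : ∀ k, ∃ x, t k x = 1) :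
    ∃ x : ∀ k, E k, (∀ k, p k (x (k + 1)) = x k) ∧ ∀ k, t k (x k) = 1 := by
  -- `W N` consists of the families compatible below level `N`. Its images in the finite-dimensional
  -- `E k` decrease with `N` and so become stable.
  let W : ℕ → Submodule K (∀ k, E k) := fun N =>
    { carrier := {x | ∀ k < N, p k (x (k + 1)) = x k}
      add_mem' := fun hx hy k hk => by simp [hx k hk, hy k hk]
      zero_mem' := fun k _ => by simp
      smul_mem' := fun c x hx k hk => by simp [hx k hk] }
  have hW : ∀ {M N}, M ≤ N → W N ≤ W M := fun hMN x hx k hk => hx k (hk.trans_le hMN)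
  have hstab : ∀ k, ∃ N, ∀ M, N ≤ M →
      (W N).map (LinearMap.proj k) = (W M).map (LinearMap.proj k : (∀ k, E k) →ₗ[K] E k) := by
    intro k
    exact monotone_stabilizes_iff_artinian.2 (inferInstance : IsArtinian K (E k))
      ⟨fun N => OrderDual.toDual ((W N).map (LinearMap.proj k)),
        fun M N hMN => Submodule.map_mono (hW hMN)⟩
  choose N hN using hstab
  -- The stable images form a tower of surjections, along which a compatible family can be chosen
  -- one level at a time.
  let S : ∀ k, Submodule K (E k) := fun k => (W (N k)).map (LinearMap.proj k)
  have hS : ∀ k (x : S k), ∃ y : S (k + 1), p k y.1 = x.1 := by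
    rintro k ⟨x, hx⟩
    have h1 : x ∈ (W (max (N k) (max (N (k + 1)) (k + 1)))).map (LinearMap.proj k) := by
      rw [← hN k _ (le_max_left _ _)]
      exact hx
    obtain ⟨w, hw, rfl⟩ := h1
    refine ⟨⟨w (k + 1), w, hW ?_ hw, rfl⟩, hw k ?_⟩
    · exact (le_max_left _ _).trans (le_max_right _ _)
    · exact (Nat.lt_succ_self k).trans_le ((le_max_right _ _).trans (le_max_right _ _))
  -- The forms are constant along partially compatible families, so a vector of value `1` at level
  -- `N 0` produces one of value `1` in the stable image at level `0`.
  have htW : ∀ M, ∀ w ∈ W M, ∀ k ≤ M, t 0 (w 0) = t k (w k) := by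
    intro M w hw k
    induction k with
    | zero => exact fun _ => rfl
    | succ k ih =>
      intro hk
      rw [ih (Nat.le_of_succ_le hk), ← ht, hw k hk]
  obtain ⟨e, he⟩ := h (N 0)
  obtain ⟨w, hw, hwN⟩ := exists_compatible_below (fun k => p k) (N 0) e
  obtain ⟨f, hf0, hf⟩ := exists_seq_of_forall_exists (P := fun k => S k)
    (R := fun k x y => p k y.1 = x.1) ⟨w 0, w, hw, rfl⟩ hS
  refine ⟨fun k => (f k).1, hf, fun k => ?_⟩
  induction k with
  | zero =>
    have h0 : (f 0).1 = w 0 := congrArg Subtype.val hf0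
    change t 0 (f 0).1 = 1
    rw [h0, htW _ w hw _ le_rfl, hwN, he]
  | succ k ih => rw [← ht, hf, ih]

end MittagLeffler

/-! ### Limits of towers of algebras. -/

section Tower

variable {K : Type*} [Field K] {C : ℕ → Type*} [∀ k, CommRing (C k)] [∀ k, Algebra K (C k)]
variable {R : Type*} [CommRing R] [Algebra K R]

/-- `R` is the limit of the tower of algebras `C k`. -/
structure IsTowerLimit (π : ∀ k, C (k + 1) →ₐ[K] C k) (P : ∀ k, R →ₐ[K] C k) : Prop where
  compat : ∀ k x, π k (P (k + 1) x) = P k x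
  eq_zero : ∀ x, (∀ k, P k x = 0) → x = 0
  exists_lift : ∀ x : ∀ k, C k, (∀ k, π k (x (k + 1)) = x k) → ∃ r, ∀ k, P k r = x k

/-- A tower of finite-dimensional augmented algebras with nilpotent augmentation ideals, in which
every step leaves the cotangent space unchanged. -/
structure IsMinimalTower (π : ∀ k, C (k + 1) →ₐ[K] C k) (ε : ∀ k, C k →ₐ[K] K) : Prop where
  finite : ∀ k, Module.Finite K (C k)
  surjective : ∀ k, Function.Surjective (π k)
  aug : ∀ k, (ε k).comp (π k) = ε (k + 1)
  nilpotent : ∀ k, RingHom.ker (ε k) ^ (k + 2) = ⊥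
  ker_le : ∀ k, RingHom.ker (π k) ≤ RingHom.ker (ε (k + 1)) ^ 2

variable {π : ∀ k, C (k + 1) →ₐ[K] C k} {P : ∀ k, R →ₐ[K] C k} {ε : ∀ k, C k →ₐ[K] K}
  {εR : R →ₐ[K] K}

namespace IsTowerLimit

variable (h : IsTowerLimit π P)
include h

theorem proj_surjective (hπ : ∀ k, Function.Surjective (π k)) (k : ℕ) :
    Function.Surjective (P k) := by
  intro a
  obtain ⟨w, hw, hwk⟩ := exists_compatible_below (fun j => π j) k a
  -- The second clause makes the chosen sequence follow the prescribed `w` up to level `k`; beyond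
  -- it any lifts will do.
  have hstep : ∀ n (x : C n), ∃ y : C (n + 1), π n y = x ∧
      (n + 1 ≤ k → x = w n → y = w (n + 1)) := by
    intro n x
    by_cases hn : n + 1 ≤ k ∧ x = w n
    · exact ⟨w (n + 1), by rw [hw n hn.1, hn.2], fun _ _ => rfl⟩
    · obtain ⟨y, hy⟩ := hπ n x
      exact ⟨y, hy, fun h1 h2 => absurd ⟨h1, h2⟩ hn⟩
  obtain ⟨f, hf0, hf⟩ := exists_seq_of_forall_exists (w 0) hstep
  obtain ⟨r, hr⟩ := h.exists_lift f fun n => (hf n).1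
  have hfw : ∀ n ≤ k, f n = w n := by
    intro n
    induction n with
    | zero => exact fun _ => hf0
    | succ n ih => exact fun hn => (hf n).2 hn (ih (Nat.le_of_succ_le hn))
  exact ⟨r, by rw [hr, hfw k le_rfl, hwk]⟩

theorem aug_comp (hε : ∀ k, (ε k).comp (π k) = ε (k + 1)) (h0 : (ε 0).comp (P 0) = εR) (k : ℕ) :
    (ε k).comp (P k) = εR := by
  induction k with
  | zero => exact h0
  | succ k ih =>
    rw [← ih, ← hε]
    exact AlgHom.ext fun x => congrArg (ε k) (h.compat k x)

/-- Finitely generated ideals of the limit are closed. -/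
theorem mem_of_forall_mem_map [∀ k, FiniteDimensional K (C k)] {J : Ideal R} (hJ : J.FG) {x : R}
    (hx : ∀ k, P k x ∈ J.map (P k)) : x ∈ J := by
  obtain ⟨m, s, rfl⟩ := Submodule.fg_iff_exists_fin_generating_family.1 hJ
  -- A vector `(c, 1)` in the kernel of `Φ k` is an expression of `P k x` in the generators. The
  -- kernels form a tower of finite-dimensional spaces on which the last coordinate is a compatible
  -- form, so the coefficients can be chosen coherently.
  let Φ : ∀ k, (Fin m → C k) × K →ₗ[K] C k := fun k =>
    (∑ i, (LinearMap.mulRight K (P k (s i))) ∘ₗ LinearMap.proj i) ∘ₗ LinearMap.fst K _ K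
      - (LinearMap.toSpanSingleton K (C k) (P k x)) ∘ₗ LinearMap.snd K _ K
  have hΦ : ∀ k (c : Fin m → C k) (a : K), Φ k (c, a) = ∑ i, c i * P k (s i) - a • P k x :=
    fun k c a => by simp [Φ]
  let q : ∀ k, (Fin m → C (k + 1)) × K →ₗ[K] (Fin m → C k) × K := fun k =>
    LinearMap.prodMap (LinearMap.pi fun i => (π k).toLinearMap ∘ₗ LinearMap.proj i) LinearMap.id
  have hq : ∀ k (c : Fin m → C (k + 1)) (a : K), q k (c, a) = (fun i => π k (c i), a) :=
    fun k c a => rfl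
  have hqΦ : ∀ k y, Φ (k + 1) y = 0 → Φ k (q k y) = 0 := by
    rintro k ⟨c, a⟩ hy
    rw [hΦ] at hy
    rw [hq, hΦ]
    have h1 := congrArg (π k) hy
    simpa [h.compat] using h1
  obtain ⟨c, hc, hc1⟩ := exists_compatible_of_forms (E := fun k => (Φ k).ker)
    (fun k => (q k).restrict fun y hy => hqΦ k y hy)
    (fun k => LinearMap.snd K _ K ∘ₗ (Φ k).ker.subtype) (fun k y => rfl) fun k => by
      have h1 := hx k
      rw [Ideal.submodule_span_eq, Ideal.map_span, ← Set.range_comp,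
        Ideal.mem_span_range_iff_exists_fun] at h1
      obtain ⟨c, hc⟩ := h1
      exact ⟨⟨(c, 1), by simpa [hΦ, sub_eq_zero] using hc⟩, rfl⟩
  have hr : ∀ i, ∃ r, ∀ k, P k r = (c k).1.1 i := fun i => h.exists_lift _ fun k => by
    rw [← hc k]
    rfl
  choose r hr using hr
  rw [Ideal.submodule_span_eq, Ideal.mem_span_range_iff_exists_fun]
  refine ⟨r, ?_⟩
  rw [← sub_eq_zero]
  refine h.eq_zero _ fun k => ?_
  have h1 : Φ k ((c k).1.1, (c k).1.2) = 0 := (c k).2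
  have h2 : (c k).1.2 = 1 := hc1 k
  rw [hΦ, h2, one_smul] at h1
  simp [hr, h1]

end IsTowerLimit

/-- Nakayama's lemma for a nilpotent ideal: substituting the inclusion into itself pushes the error
into ever higher powers of `m`. -/
theorem le_of_le_sup_sq {A : Type*} [CommRing A] {m I : Ideal A} {n : ℕ} (hm : m ^ (n + 1) = ⊥)
    (h : m ≤ I ⊔ m ^ 2) : m ≤ I := by
  have h1 : ∀ k, m ≤ I ⊔ m ^ (k + 1) := by
    intro k
    induction k with
    | zero => simp
    | succ k ih =>
      refine h.trans (sup_le le_sup_left ?_)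
      calc m ^ 2 = m * m := sq m
        _ ≤ m * (I ⊔ m ^ (k + 1)) := Ideal.mul_mono_right ih
        _ = m * I ⊔ m ^ (k + 1 + 1) := by rw [Ideal.mul_sup, pow_succ' m (k + 1)]
        _ ≤ I ⊔ m ^ (k + 1 + 1) := sup_le_sup_right Ideal.mul_le_right _
  simpa [hm] using h1 n

/-- Such an element is a nonzero scalar plus a nilpotent. -/
theorem isUnit_of_aug_ne_zero {A : Type*} [CommRing A] [Algebra K A] {ε : A →ₐ[K] K} {n : ℕ}
    (hε : RingHom.ker ε ^ n = ⊥) {a : A} (ha : ε a ≠ 0) : IsUnit a := by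
  have h1 : IsNilpotent (a - algebraMap K A (ε a)) := ⟨n, by
    have h2 : (a - algebraMap K A (ε a)) ^ n ∈ RingHom.ker ε ^ n :=
      Ideal.pow_mem_pow (by simp [RingHom.mem_ker]) n
    rwa [hε] at h2⟩
  have h3 : IsUnit (algebraMap K A (ε a)) := (IsUnit.mk0 _ ha).map _
  have h4 := h1.isUnit_add_left_of_commute h3 (Commute.all _ _)
  simpa using h4

theorem map_ker_aug {A B : Type*} [CommRing A] [Algebra K A] [CommRing B] [Algebra K B]
    {εA : A →ₐ[K] K} {εB : B →ₐ[K] K} {f : B →ₐ[K] A} (hf : Function.Surjective f)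
    (h : εA.comp f = εB) : (RingHom.ker εB).map f = RingHom.ker εA := by
  subst h
  refine le_antisymm (Ideal.map_le_iff_le_comap.2 fun x hx => hx) fun x hx => ?_
  obtain ⟨y, rfl⟩ := hf x
  exact Ideal.mem_map_of_mem f hx

namespace IsMinimalTower

variable (hC : IsMinimalTower π ε) (h : IsTowerLimit π P) (h0 : (ε 0).comp (P 0) = εR)
include hC h h0

omit h0 in
-- Elements of the square lift to elements of the square, and the ambiguity of the lift lies in the
-- kernel, which is in the square by minimality.
theorem proj_mem_sq {z : R} (hz : P 0 z = 0) (k : ℕ) : P k z ∈ RingHom.ker (ε k) ^ 2 := by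
  induction k with
  | zero => rw [hz]; exact zero_mem _
  | succ k ih =>
    rw [← map_ker_aug (hC.surjective k) (hC.aug k), ← Ideal.map_pow,
      Ideal.mem_map_iff_of_surjective _ (hC.surjective k)] at ih
    obtain ⟨y, hy, hyz⟩ := ih
    have h1 : P (k + 1) z - y ∈ RingHom.ker (π k) := by
      rw [RingHom.mem_ker, map_sub, hyz, h.compat, sub_self]
    have h2 := add_mem (hC.ker_le k h1) hy
    rwa [sub_add_cancel] at h2

/-- Lifts of generators for the lowest stage generate the augmentation ideal of each stage modulo
its square, by `proj_mem_sq`, hence generate it by Nakayama. The ideal `J` turns out to be the whole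
of `ker εR` (`ker_fg`), but the closedness argument for this needs its finite generation beforehand.
-/
theorem exists_fg : ∃ J : Ideal R, J.FG ∧ J ≤ RingHom.ker εR ∧
    ∀ k, J.map (P k) = RingHom.ker (ε k) := by
  have := hC.finite
  have hP := h.proj_surjective hC.surjective
  have hε := h.aug_comp hC.aug h0
  have hN : IsNoetherianRing (C 0) := isNoetherian_of_tower K inferInstance
  obtain ⟨m, s, hs⟩ := Submodule.fg_iff_exists_fin_generating_family.1
    (hN.noetherian (RingHom.ker (ε 0)))
  choose x hx using fun i => hP 0 (s i)
  have hmap : (Ideal.span (Set.range x)).map (P 0) = RingHom.ker (ε 0) := by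
    rw [Ideal.map_span, ← Set.range_comp, ← hs, Ideal.submodule_span_eq]
    congr 2
    exact funext hx
  have hle : Ideal.span (Set.range x) ≤ RingHom.ker εR := by
    rw [← h0]
    intro a ha
    have h1 := Ideal.mem_map_of_mem (P 0) ha
    rw [hmap] at h1
    exact h1
  refine ⟨Ideal.span (Set.range x), Submodule.fg_span (Set.finite_range x), hle, fun k => ?_⟩
  have h1 : (Ideal.span (Set.range x)).map (P k) ≤ RingHom.ker (ε k) := by
    rw [← map_ker_aug (hP k) (hε k)]
    exact Ideal.map_mono hle
  refine le_antisymm h1 (le_of_le_sup_sq (hC.nilpotent k) fun a ha => ?_)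
  obtain ⟨r, rfl⟩ := hP k a
  have h2 : P 0 r ∈ RingHom.ker (ε 0) := by
    have h3 := DFunLike.congr_fun ((hε k).trans (hε 0).symm) r
    rw [RingHom.mem_ker]
    exact h3.symm.trans ha
  rw [← hmap, Ideal.mem_map_iff_of_surjective _ (hP 0)] at h2
  obtain ⟨j, hj, hjr⟩ := h2
  have h3 := hC.proj_mem_sq h (z := r - j) (by rw [map_sub, hjr, sub_self]) k
  have h4 : P k r = P k j + P k (r - j) := by rw [map_sub]; ring
  rw [h4]
  exact Submodule.add_mem_sup (Ideal.mem_map_of_mem _ hj) h3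

theorem proj_mem_pow {x : R} {n : ℕ} (hx : x ∈ RingHom.ker εR ^ n) (k : ℕ) :
    P k x ∈ RingHom.ker (ε k) ^ n := by
  rw [← map_ker_aug (h.proj_surjective hC.surjective k) (h.aug_comp hC.aug h0 k), ← Ideal.map_pow]
  exact Ideal.mem_map_of_mem _ hx

/-- `J ^ n` is finitely generated, hence closed, and its image at each stage generates the `n`-th
power of the augmentation ideal there. So membership in powers of `ker εR` can be tested stage by
stage. -/
theorem mem_pow {x : R} {n : ℕ} (hx : ∀ k, P k x ∈ RingHom.ker (ε k) ^ n) :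
    x ∈ RingHom.ker εR ^ n := by
  have := hC.finite
  obtain ⟨J, hJ, hle, hmap⟩ := hC.exists_fg h h0
  refine Ideal.pow_right_mono hle n (h.mem_of_forall_mem_map hJ.pow fun k => ?_)
  rw [Ideal.map_pow, hmap]
  exact hx k

theorem ker_fg : (RingHom.ker εR).FG := by
  have := hC.finite
  obtain ⟨J, hJ, hle, hmap⟩ := hC.exists_fg h h0
  have h1 : J = RingHom.ker εR := le_antisymm hle fun x hx =>
    h.mem_of_forall_mem_map hJ fun k => by
      rw [hmap]
      exact (DFunLike.congr_fun (h.aug_comp hC.aug h0 k) x).trans hx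
  rwa [← h1]

/-- This makes `R/𝔐²` a quotient of the lowest stage, as the uniqueness part of versality requires.
-/
theorem ker_proj_zero_le : RingHom.ker (P 0) ≤ RingHom.ker εR ^ 2 := fun _ hx =>
  hC.mem_pow h h0 (hC.proj_mem_sq h hx)

theorem pow_le_ker_proj (k : ℕ) : RingHom.ker εR ^ (k + 2) ≤ RingHom.ker (P k) := fun x hx => by
  have h1 := hC.proj_mem_pow h h0 hx k
  rwa [hC.nilpotent k] at h1

theorem isLocalRing : IsLocalRing R := by
  have hu : ∀ x, εR x ≠ 0 → IsUnit x := by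
    intro x hx
    have h1 : ∀ k, ∃ y, P k x * y = 1 := fun k => by
      refine (isUnit_of_aug_ne_zero (hC.nilpotent k) ?_).exists_right_inv
      have h2 := DFunLike.congr_fun (h.aug_comp hC.aug h0 k) x
      rw [AlgHom.comp_apply] at h2
      rwa [h2]
    choose y hy using h1
    -- Inverses are unique, so those chosen at the single stages are compatible.
    obtain ⟨r, hr⟩ := h.exists_lift y fun k => by
      have h3 : P k x * π k (y (k + 1)) = 1 := by rw [← h.compat, ← map_mul, hy, map_one]
      exact (left_inv_eq_right_inv ((mul_comm _ _).trans (hy k)) h3).symm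
    refine IsUnit.of_mul_eq_one r ?_
    rw [← sub_eq_zero]
    refine h.eq_zero _ fun k => ?_
    rw [map_sub, map_mul, hr, hy, map_one, sub_self]
  have hn : Nontrivial R := εR.toRingHom.domain_nontrivial
  refine IsLocalRing.of_isUnit_or_isUnit_one_sub_self fun a => ?_
  by_cases ha : εR a = 0
  · exact Or.inr (hu _ (by simp [ha]))
  · exact Or.inl (hu a ha)

theorem isAdicComplete : IsAdicComplete (RingHom.ker εR) R where
  haus' x hx := h.eq_zero x fun k => by
    have h1 := hx (k + 2)
    rw [SModEq.zero, smul_eq_mul, Ideal.mul_top] at h1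
    exact hC.pow_le_ker_proj h h0 k h1
  prec' f hf := by
    simp only [SModEq.sub_mem, smul_eq_mul, Ideal.mul_top] at hf ⊢
    -- `𝔐 ^ (k + 2)` vanishes at stage `k`, so the Cauchy sequence is constant there from index `k +
    -- 2` on.
    have hk : ∀ k m, k + 2 ≤ m → P k (f (k + 2)) = P k (f m) := fun k m hm => by
      have h1 := hC.pow_le_ker_proj h h0 k (hf hm)
      rwa [RingHom.mem_ker, map_sub, sub_eq_zero] at h1
    obtain ⟨r, hr⟩ := h.exists_lift (fun k => P k (f (k + 2))) fun k => by
      rw [h.compat, hk k (k + 1 + 2) (by omega)]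
    refine ⟨r, fun n => hC.mem_pow h h0 fun k => ?_⟩
    rw [map_sub, hr]
    rcases le_total n (k + 2) with hn | hn
    · rw [← map_sub]
      exact hC.proj_mem_pow h h0 (hf hn) k
    · rw [hk k n hn, sub_self]
      exact zero_mem _

end IsMinimalTower

end Tower

/-! ### Finite-dimensionality of the truncations. -/

section Finite

variable {K : Type*} [Field K] {R : Type*} [CommRing R] [Algebra K R] {ε : R →ₐ[K] K}

/-- An element `a` acts on `𝔐ⁿ/𝔐ⁿ⁺¹` as the scalar `ε a`, so ideal generators of `𝔐ⁿ` span this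
quotient over `K`. -/
theorem exists_finite_span_pow (hR : (RingHom.ker ε).FG) (n : ℕ) :
    ∃ S : Set R, S.Finite ∧ ((RingHom.ker ε) ^ n).restrictScalars K
      ≤ Submodule.span K S ⊔ ((RingHom.ker ε) ^ (n + 1)).restrictScalars K := by
  obtain ⟨S, hS⟩ := hR.pow (n := n)
  refine ⟨S, S.finite_toSet, fun x hx => ?_⟩
  rw [Submodule.restrictScalars_mem, ← hS] at hx
  induction hx using Submodule.span_induction with
  | mem x hx => exact Submodule.mem_sup_left (Submodule.subset_span hx)
  | zero => exact zero_mem _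
  | add x y _ _ hx hy => exact add_mem hx hy
  | smul a x hx' hx =>
    have h1 : a • x = ε a • x + (a - algebraMap K R (ε a)) * x := by
      rw [sub_mul, ← Algebra.smul_def, smul_eq_mul]; ring
    rw [h1]
    refine add_mem (Submodule.smul_mem _ _ hx) (Submodule.mem_sup_right ?_)
    rw [Submodule.restrictScalars_mem, pow_succ']
    refine Ideal.mul_mem_mul (by simp [RingHom.mem_ker]) ?_
    rw [← hS]
    exact hx'

theorem finite_quotient_pow (hR : (RingHom.ker ε).FG) (n : ℕ) :
    Module.Finite K (R ⧸ (RingHom.ker ε) ^ n) := by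
  have h1 : ∃ S : Set R, S.Finite ∧
      (⊤ : Submodule K R) ≤ Submodule.span K S ⊔ ((RingHom.ker ε) ^ n).restrictScalars K := by
    induction n with
    | zero => exact ⟨∅, Set.finite_empty, fun x _ => Submodule.mem_sup_right (by simp)⟩
    | succ n ih =>
      obtain ⟨S, hS, h1⟩ := ih
      obtain ⟨T, hT, h2⟩ := exists_finite_span_pow hR n
      refine ⟨S ∪ T, hS.union hT, h1.trans ?_⟩
      rw [Submodule.span_union, sup_assoc]
      exact sup_le_sup_left h2 _
  obtain ⟨S, hS, h1⟩ := h1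
  refine ⟨⟨(hS.image (Ideal.Quotient.mkₐ K _).toLinearMap).toFinset, ?_⟩⟩
  rw [Set.Finite.coe_toFinset, Submodule.span_image, eq_top_iff]
  rintro x -
  obtain ⟨x, rfl⟩ := Ideal.Quotient.mk_surjective x
  obtain ⟨y, hy, z, hz, rfl⟩ := Submodule.mem_sup.1 (h1 (Submodule.mem_top (x := x)))
  refine ⟨y, hy, ?_⟩
  rw [map_add, Ideal.Quotient.eq_zero_iff_mem.2 hz, add_zero]
  rfl

/-- The quotient embeds into the finite-dimensional `R/𝔐ᵏ⁺¹`. -/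
theorem finite_pow_quotient (hR : (RingHom.ker ε).FG) (k : ℕ) :
    Module.Finite K (↥((RingHom.ker ε) ^ k) ⧸
      ((RingHom.ker ε) ^ (k + 1)).submoduleOf ((RingHom.ker ε) ^ k)) := by
  have := finite_quotient_pow hR (k + 1)
  let F := Submodule.mapQ (((RingHom.ker ε) ^ (k + 1)).submoduleOf ((RingHom.ker ε) ^ k))
    ((RingHom.ker ε) ^ (k + 1)) ((RingHom.ker ε) ^ k).subtype le_rfl
  refine Module.Finite.of_injective (F.restrictScalars K) ?_
  change Function.Injective F
  rw [← LinearMap.ker_eq_bot]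
  refine (Submodule.ker_mapQ _ _ _ _).trans ?_
  exact Submodule.mkQ_map_self _

end Finite

/-! ### Comparison of the tower with the adic filtration. -/

section Tower

variable {K : Type*} [Field K] {C : ℕ → Type*} [∀ k, CommRing (C k)] [∀ k, Algebra K (C k)]
variable {R : Type*} [CommRing R] [Algebra K R]
variable {π : ∀ k, C (k + 1) →ₐ[K] C k} {P : ∀ k, R →ₐ[K] C k} {ε : ∀ k, C k →ₐ[K] K}
  {εR : R →ₐ[K] K}

theorem IsMinimalTower.isCompleteLocal (hC : IsMinimalTower π ε) (h : IsTowerLimit π P)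
    (h0 : (ε 0).comp (P 0) = εR) : IsCompleteLocal εR where
  isLocalRing := hC.isLocalRing h h0
  isAdicComplete := hC.isAdicComplete h h0
  finite := finite_pow_quotient (hC.ker_fg h h0)

/-- Chevalley's argument: the images of the kernels in the finite-dimensional `R/𝔐ⁿ` decrease and
are stable from some `k` on. An element of `ker (P k)` is then congruent modulo `𝔐ⁿ` to an element
of `ker (P j)` for each `j ≥ k`, hence lies in the closed ideal `𝔐ⁿ`. -/
theorem IsMinimalTower.exists_ker_proj_le (hC : IsMinimalTower π ε) (h : IsTowerLimit π P)
    (h0 : (ε 0).comp (P 0) = εR) (n : ℕ) : ∃ k, RingHom.ker (P k) ≤ RingHom.ker εR ^ n := by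
  have := finite_quotient_pow (hC.ker_fg h h0) n
  have hanti : ∀ k, RingHom.ker (P (k + 1)) ≤ RingHom.ker (P k) := fun k x hx => by
    rw [RingHom.mem_ker] at hx ⊢
    rw [← h.compat, hx, map_zero]
  obtain ⟨k, hk⟩ := monotone_stabilizes_iff_artinian.2
    (inferInstance : IsArtinian K (R ⧸ RingHom.ker εR ^ n))
    ⟨fun k => OrderDual.toDual (((RingHom.ker (P k)).restrictScalars K).map
        (Ideal.Quotient.mkₐ K (RingHom.ker εR ^ n)).toLinearMap),
      monotone_nat_of_le_succ fun k => Submodule.map_mono (hanti k)⟩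
  refine ⟨k, fun x hx => hC.mem_pow h h0 fun j => ?_⟩
  rcases le_total j k with hj | hj
  · have h1 : x ∈ RingHom.ker (P j) :=
      (antitone_nat_of_succ_le (f := fun k => RingHom.ker (P k)) hanti) hj hx
    rw [RingHom.mem_ker] at h1
    rw [h1]
    exact zero_mem _
  · have h1 : (Ideal.Quotient.mkₐ K (RingHom.ker εR ^ n)).toLinearMap x
        ∈ ((RingHom.ker (P k)).restrictScalars K).map
          (Ideal.Quotient.mkₐ K (RingHom.ker εR ^ n)).toLinearMap := ⟨x, hx, rfl⟩
    have h2 : ((RingHom.ker (P k)).restrictScalars K).map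
        (Ideal.Quotient.mkₐ K (RingHom.ker εR ^ n)).toLinearMap
        = ((RingHom.ker (P j)).restrictScalars K).map
          (Ideal.Quotient.mkₐ K (RingHom.ker εR ^ n)).toLinearMap := hk j hj
    rw [h2] at h1
    obtain ⟨y, hy, hyx⟩ := h1
    have h3 : x - y ∈ RingHom.ker εR ^ n := Ideal.Quotient.eq.1 hyx.symm
    have h4 := hC.proj_mem_pow h h0 h3 j
    have h5 : P j y = 0 := hy
    rwa [map_sub, h5, sub_zero] at h4

end Tower

/-! ### Minimality of the extensions. -/

section Essential

variable {K : Type*} [Field K] {A : Type*} [CommRing A] [Algebra K A] {ε : A →ₐ[K] K}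

theorem sub_algebraMap_mem_ker (a : A) : a - algebraMap K A (ε a) ∈ RingHom.ker ε := by
  simp [RingHom.mem_ker]

/-- A linear form vanishing at `1` and on the square of the augmentation ideal is a derivation. -/
theorem form_mul {g : A →ₗ[K] K} (hg1 : g 1 = 0) (hg : ∀ a ∈ RingHom.ker ε ^ 2, g a = 0) (a b : A) :
    g (a * b) = ε a * g b + ε b * g a := by
  have h1 : (a - algebraMap K A (ε a)) * (b - algebraMap K A (ε b)) ∈ RingHom.ker ε ^ 2 := by
    rw [sq]
    exact Ideal.mul_mem_mul (sub_algebraMap_mem_ker a) (sub_algebraMap_mem_ker b)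
  have h2 := hg _ h1
  have h3 : (a - algebraMap K A (ε a)) * (b - algebraMap K A (ε b))
      = a * b - ε a • b - ε b • a + (ε a * ε b) • 1 := by
    simp only [Algebra.smul_def, map_mul]; ring
  rw [h3] at h2
  simp only [map_add, map_sub, map_smul, hg1, smul_eq_mul] at h2
  linear_combination h2

/-- If `i v` were outside `𝔐²`, a form on `A` killing `𝔐²` would pull back along `i` to a nonzero
form, which by finite-dimensionality is evaluation at some `c`. Made to vanish at `1`, the form is a
derivation by `form_mul`, and the hypothesis gives `c = 0`. -/
theorem mem_sq_of_forall_form {V : Type*} [AddCommGroup V] [Module K V] [FiniteDimensional K V]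
    {i : Module.Dual K V →ₗ[K] A} (hi : ∀ v, ε (i v) = 0)
    (h : ∀ (c : V) (g : A →ₗ[K] K), (∀ a b, g (a * b) = ε a * g b + ε b * g a) →
      (∀ v, g (i v) = v c) → c = 0) (v : Module.Dual K V) : i v ∈ RingHom.ker ε ^ 2 := by
  let U : Submodule K A := (RingHom.ker ε ^ 2).restrictScalars K
  let I := U.mkQ ∘ₗ i
  have hI : ∀ w, I w = 0 ↔ i w ∈ RingHom.ker ε ^ 2 := fun w => Submodule.Quotient.mk_eq_zero U
  by_contra hv
  have hlt : I.ker < ⊤ := lt_top_iff_ne_top.2 fun h => hv ((hI v).1 (by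
    have h1 : v ∈ I.ker := h ▸ Submodule.mem_top
    exact h1))
  obtain ⟨f, hf0, hf⟩ := Submodule.exists_le_ker_of_lt_top _ hlt
  have hf' : f ∈ I.dualMap.range := by
    rw [LinearMap.range_dualMap_eq_dualAnnihilator_ker, Submodule.mem_dualAnnihilator]
    exact fun w hw => hf hw
  obtain ⟨g₀, hg₀⟩ := hf'
  obtain ⟨c, hc⟩ := (Module.evalEquiv K V).surjective f
  let g := g₀ ∘ₗ U.mkQ
  -- Subtracting a multiple of `ε` kills the value at `1` and changes nothing on the image of `i`.
  let g' : A →ₗ[K] K := g - g 1 • ε.toLinearMap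
  have hg' : ∀ x, g' x = g x - g 1 * ε x := fun x => rfl
  have h1 : g' 1 = 0 := by rw [hg', map_one ε, mul_one, sub_self]
  have h2 : ∀ x ∈ RingHom.ker ε ^ 2, g' x = 0 := fun x hx => by
    have h3 : g x = 0 := by
      have h5 : U.mkQ x = 0 := (Submodule.Quotient.mk_eq_zero U).2 hx
      change g₀ (U.mkQ x) = 0
      rw [h5, map_zero]
    have h4 : ε x = 0 := Ideal.pow_le_self two_ne_zero hx
    rw [hg', h3, h4, mul_zero, sub_zero]
  have h3 : ∀ w, g' (i w) = w c := fun w => by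
    have h5 : g (i w) = f w := LinearMap.congr_fun hg₀ w
    rw [hg', hi, mul_zero, sub_zero, h5, ← hc, Module.evalEquiv_apply]
    rfl
  refine hf0 ?_
  rw [← hc, h c g' (form_mul h1 h2) h3, map_zero]

variable {L : Type*} [AddCommGroup L] [Module K L] {br : LeibnizBracket K L}
variable (lam : Deformation br ε) {μ : H2Harr ε →ₗ[K] HarrisonCocycle ε K}

theorem mk_eq_zero_of_derivation {f : HarrisonCocycle ε K} {B : Type*} [CommRing B] [Algebra K B]
    {εB : B →ₐ[K] K} {s : A →ₗ[K] B} (hs : ∀ a, εB (s a) = ε a) {g : B →ₗ[K] K}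
    (hg : ∀ a b, g (a * b) = εB a * g b + εB b * g a)
    (hf : ∀ a b, g (s a * s b) = g (s (a * b)) + f.1 a b) :
    (Submodule.Quotient.mk f : H2Harr ε) = 0 := by
  refine (Submodule.Quotient.mk_eq_zero _).2 ⟨g ∘ₗ s, fun a b => ?_⟩
  have h1 := hf a b
  rw [hg, hs, hs] at h1
  change f.1 a b = ε a * g (s b) - g (s (a * b)) + ε b * g (s a)
  linear_combination -h1

/-- The kernel of the projection of the new base consists of decomposable elements. -/
theorem nextIncl_mem_sq [FiniteDimensional K (H2Harr ε)]
    (hμ : ∀ c, Submodule.Quotient.mk (μ c) = c) (v : Module.Dual K (H2Harr ε)) :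
    nextIncl lam μ v ∈ RingHom.ker (nextAug lam μ) ^ 2 := by
  -- A derivation restricting to evaluation at `c` on the kernel makes `μ c` a coboundary, so `c =
  -- 0`.
  refine mem_sq_of_forall_form (nextAug_nextIncl lam μ) (fun c g hg hgi => ?_) v
  have h : ∀ a b, g (nextSec lam μ a * nextSec lam μ b)
      = g (nextSec lam μ (a * b)) + (μ c).1 a b := fun a b => by
    have h1 := hgi ((universalCocycle μ).1 a b)
    have h2 := congrArg g (nextSec_mul lam μ a b)
    rw [map_add, h1] at h2
    exact h2
  exact (hμ c).symm.trans (mk_eq_zero_of_derivation (fun a => rfl) hg h)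

theorem exists_eq_nextIncl {y : NextBase lam μ} (hy : nextProj lam μ y = 0) :
    ∃ v, y = nextIncl lam μ v := by
  obtain ⟨v, hv⟩ := eq_nextSec_add lam μ y
  rw [hy, map_zero, zero_add] at hv
  exact ⟨v, hv⟩

theorem nextBase_mul_eq_zero {x y : NextBase lam μ} (hx : nextAug lam μ x = 0)
    (hy : nextProj lam μ y = 0) : x * y = 0 := by
  obtain ⟨v, rfl⟩ := exists_eq_nextIncl lam hy
  rw [mul_nextIncl, hx, zero_smul]

theorem ker_nextProj_le [FiniteDimensional K (H2Harr ε)]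
    (hμ : ∀ c, Submodule.Quotient.mk (μ c) = c) :
    RingHom.ker (nextProj lam μ) ≤ RingHom.ker (nextAug lam μ) ^ 2 := by
  intro y hy
  obtain ⟨v, rfl⟩ := exists_eq_nextIncl lam hy
  exact nextIncl_mem_sq lam hμ v

end Essential

/-! ### The tower of the construction. -/

section Stages

variable {K : Type u} [Field K] {L : Type v} [AddCommGroup L] [Module K L]
variable {br : LeibnizBracket K L}

theorem Step.mul_eq_zero_of_proj {S : Stage br} (T : Step S) {x y : T.next.base}
    (hx : T.next.ε x = 0) (hy : T.proj y = 0) : x * y = 0 :=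
  nextBase_mul_eq_zero S.η hx hy

theorem Step.proj_surjective {S : Stage br} (T : Step S) : Function.Surjective T.proj :=
  nextProj_surjective S.η T.μ

theorem Step.aug_comp_proj {S : Stage br} (T : Step S) : S.ε.comp T.proj = T.next.ε := rfl

theorem Step.ker_proj_le {S : Stage br} (T : Step S) :
    RingHom.ker T.proj ≤ RingHom.ker T.next.ε ^ 2 :=
  ker_nextProj_le S.η T.μ_class

/-- Elements of `𝔐ⁿ` already lie in the kernel of the projection, and one more factor from `𝔐` kills
them. -/
theorem Step.ker_pow_eq_bot {S : Stage br} (T : Step S) {n : ℕ}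
    (h : RingHom.ker S.ε ^ n = ⊥) : RingHom.ker T.next.ε ^ (n + 1) = ⊥ := by
  rw [eq_bot_iff, pow_succ', Ideal.mul_le]
  intro x hx y hy
  refine T.mul_eq_zero_of_proj hx ?_
  have h1 := Ideal.mem_map_of_mem T.proj hy
  rw [Ideal.map_pow, map_ker_aug T.proj_surjective T.aug_comp_proj, h] at h1
  exact h1

variable [FiniteDimensional K (HL2 br)]

theorem firstStage_ker_sq (μ : HL2 br →ₗ[K] Z2 br) :
    RingHom.ker (firstStage μ).ε ^ 2 = ⊥ := by
  rw [eq_bot_iff, sq, Ideal.mul_le]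
  intro x hx y hy
  have hx' : x.1 = 0 := hx
  have hy' : y.1 = 0 := hy
  have h1 : x = firstIncl br x.2 := HarrisonExt.ext hx' rfl
  have h2 : y = firstIncl br y.2 := HarrisonExt.ext hy' rfl
  rw [h1, h2]
  exact firstIncl_mul br _ _

namespace Construction

variable (D : Construction br)

theorem isMinimalTower : IsMinimalTower D.proj (fun k => (D.stage k).ε) where
  finite k := (D.stage k).finite
  surjective k := (D.step k (D.stage k)).proj_surjective
  aug k := rfl
  -- Stage `0` is `C₁`, whose augmentation ideal has square zero; hence the exponent `k + 2`.
  nilpotent k := by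
    induction k with
    | zero => exact firstStage_ker_sq D.μ
    | succ k ih => exact (D.step k (D.stage k)).ker_pow_eq_bot ih
  ker_le k := (D.step k (D.stage k)).ker_proj_le

theorem isTowerLimit : IsTowerLimit D.proj D.limitProj where
  compat k := fun x => x.2 k
  eq_zero _ hx := Subtype.ext (funext hx)
  exists_lift x hx := ⟨⟨x, hx⟩, fun _ => rfl⟩

theorem isCompleteLocal : IsCompleteLocal D.limitAug :=
  D.isMinimalTower.isCompleteLocal D.isTowerLimit rfl

theorem limitProj_surjective (k : ℕ) : Function.Surjective (D.limitProj k) :=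
  D.isTowerLimit.proj_surjective D.isMinimalTower.surjective k

theorem ker_pow_le_ker_limitProj (k : ℕ) :
    RingHom.ker D.limitAug ^ (k + 2) ≤ RingHom.ker (D.limitProj k) :=
  D.isMinimalTower.pow_le_ker_proj D.isTowerLimit rfl k

theorem exists_ker_limitProj_le (n : ℕ) :
    ∃ k, RingHom.ker (D.limitProj k) ≤ RingHom.ker D.limitAug ^ n :=
  D.isMinimalTower.exists_ker_proj_le D.isTowerLimit rfl n

theorem ker_limitProj_zero_le : RingHom.ker (D.limitProj 0) ≤ RingHom.ker D.limitAug ^ 2 :=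
  D.isMinimalTower.ker_proj_zero_le D.isTowerLimit rfl

end Construction

end Stages

/-! ### Functoriality of push-outs and truncations. -/

section Pushout

variable {K : Type*} [Field K] {L : Type*} [AddCommGroup L] [Module K L]
variable {br : LeibnizBracket K L}
variable {A : Type*} [CommRing A] [Algebra K A] {ε : A →ₐ[K] K}
variable {B : Type*} [CommRing B] [Algebra K B] {εB : B →ₐ[K] K}
variable {C : Type*} [CommRing C] [Algebra K C] {εC : C →ₐ[K] K}

theorem Deformation.pushout_congr {φ ψ : A →ₐ[K] B} (h : φ = ψ) (hφ : εB.comp φ = ε)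
    (hψ : εB.comp ψ = ε) (lam : Deformation br ε) : lam.pushout φ hφ = lam.pushout ψ hψ := by
  subst h
  rfl

theorem Deformation.pushout_id (lam : Deformation br ε) :
    lam.pushout (AlgHom.id K A) (AlgHom.comp_id ε) = lam := by
  refine Deformation.ext_gen fun x y => ?_
  rw [Deformation.pushout_one_tmul]
  change LinearMap.rTensor L LinearMap.id _ = _
  rw [LinearMap.rTensor_id, LinearMap.id_apply]

theorem Deformation.pushout_comp (φ : A →ₐ[K] B) (hφ : εB.comp φ = ε) (ψ : B →ₐ[K] C)
    (hψ : εC.comp ψ = εB) (lam : Deformation br ε) :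
    (lam.pushout φ hφ).pushout ψ hψ
      = lam.pushout (ψ.comp φ) (by rw [← AlgHom.comp_assoc, hψ, hφ]) :=
  Deformation.pushout_pushout φ hφ ψ hψ _ _ rfl lam

theorem exists_algHom_of_ker_le {f : A →ₐ[K] B} (hf : Function.Surjective f) (g : A →ₐ[K] C)
    (h : RingHom.ker f ≤ RingHom.ker g) : ∃ χ : B →ₐ[K] C, χ.comp f = g := by
  refine ⟨(Ideal.Quotient.liftₐ (RingHom.ker f) g h).comp
    (Ideal.quotientKerAlgEquivOfSurjective hf).symm.toAlgHom, AlgHom.ext fun a => ?_⟩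
  have h1 : (Ideal.quotientKerAlgEquivOfSurjective hf).symm (f a) = Ideal.Quotient.mk _ a := by
    rw [AlgEquiv.symm_apply_eq]
    rfl
  change Ideal.Quotient.liftₐ (RingHom.ker f) g h
    ((Ideal.quotientKerAlgEquivOfSurjective hf).symm (f a)) = g a
  rw [h1]
  rfl

theorem algHom_eq_of_comp_eq {f : A →ₐ[K] B} (hf : Function.Surjective f) {g h : B →ₐ[K] C}
    (hgh : g.comp f = h.comp f) : g = h :=
  AlgHom.ext fun b => by
    obtain ⟨a, rfl⟩ := hf b
    exact DFunLike.congr_fun hgh a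

variable (ε) in
/-- The projection `A/𝔐ᵐ⁺¹ → A/𝔐ⁿ⁺¹` for `n ≤ m`. -/
def truncLE {n m : ℕ} (h : n ≤ m) : Trunc ε m →ₐ[K] Trunc ε n :=
  Ideal.Quotient.factorₐ K (Ideal.pow_le_pow_right (Nat.succ_le_succ h))

variable (ε) in
/-- The projection `A → A/𝔐ⁿ⁺¹`. -/
def truncMk (n : ℕ) : A →ₐ[K] Trunc ε n := Ideal.Quotient.mkₐ K _

theorem truncMk_surjective (n : ℕ) : Function.Surjective (truncMk ε n) :=
  Ideal.Quotient.mk_surjective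

theorem trunc_algHom_ext {n : ℕ} {g h : Trunc ε n →ₐ[K] C}
    (H : ∀ a, g (truncMk ε n a) = h (truncMk ε n a)) : g = h :=
  algHom_eq_of_comp_eq (truncMk_surjective n) (AlgHom.ext H)

theorem truncLE_comp_truncMk {n m : ℕ} (h : n ≤ m) :
    (truncLE ε h).comp (truncMk ε m) = truncMk ε n := rfl

theorem truncMap_comp_truncMk (n : ℕ) : (truncMap ε n).comp (truncMk ε (n + 1)) = truncMk ε n := rfl

theorem truncAug_comp_truncMk (n : ℕ) : (truncAug ε n).comp (truncMk ε n) = ε := rfl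

theorem truncAug_comp_truncLE {n m : ℕ} (h : n ≤ m) :
    (truncAug ε n).comp (truncLE ε h) = truncAug ε m :=
  trunc_algHom_ext fun _ => rfl

theorem ker_truncMk (n : ℕ) : RingHom.ker (truncMk ε n) = RingHom.ker ε ^ (n + 1) :=
  Ideal.Quotient.mkₐ_ker K _

theorem FormalDeformation.level_pushout (eta : FormalDeformation br ε) {n m : ℕ} (h : n ≤ m) :
    (eta.level m).pushout (truncLE ε h) (truncAug_comp_truncLE h) = eta.level n := by
  induction m, h using Nat.le_induction with
  | base =>
    conv_rhs => rw [← (eta.level n).pushout_id]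
    have h1 : truncLE ε (le_refl n) = AlgHom.id K (Trunc ε n) := trunc_algHom_ext fun _ => rfl
    exact Deformation.pushout_congr h1 _ _ _
  | succ m h ih =>
    rw [← ih, ← eta.compat m, Deformation.pushout_comp]
    have h1 : truncLE ε (Nat.le_succ_of_le h) = (truncLE ε h).comp (truncMap ε m) :=
      trunc_algHom_ext fun _ => rfl
    exact Deformation.pushout_congr h1 _ _ _

end Pushout

/-! ### The limit deformation: existence and uniqueness. -/

namespace Construction

variable {K : Type u} [Field K] {L : Type v} [AddCommGroup L] [Module K L]
variable {br : LeibnizBracket K L} [FiniteDimensional K (HL2 br)] (D : Construction br)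
variable {X : Type*} [CommRing X] [Algebra K X] {εX : X →ₐ[K] K}

theorem stage_succ_pushout (k : ℕ) :
    (D.stage (k + 1)).η.pushout (D.proj k) (D.isMinimalTower.aug k) = (D.stage k).η :=
  (D.step k (D.stage k)).extends_η

theorem proj_comp_limitProj (k : ℕ) : (D.proj k).comp (D.limitProj (k + 1)) = D.limitProj k :=
  AlgHom.ext fun x => x.2 k

/-- The push-outs of the deformations `η_k` along homomorphisms which agree on `C` agree. -/
theorem pushout_stage_eq {k j : ℕ} {χ : (D.stage k).base →ₐ[K] X} (hχ : εX.comp χ = (D.stage k).ε)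
    {χ' : (D.stage j).base →ₐ[K] X} (hχ' : εX.comp χ' = (D.stage j).ε)
    (h : χ.comp (D.limitProj k) = χ'.comp (D.limitProj j)) :
    (D.stage k).η.pushout χ hχ = (D.stage j).η.pushout χ' hχ' := by
  wlog hkj : k ≤ j generalizing k j
  · exact (this hχ' hχ h.symm (le_of_not_ge hkj)).symm
  -- Composition with the projections moves `χ` up to stage `j`, where it equals `χ'` because the
  -- limit surjects onto that stage.
  have key : ∀ j, k ≤ j → ∃ (ψ : (D.stage j).base →ₐ[K] X) (hψ : εX.comp ψ = (D.stage j).ε),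
      ψ.comp (D.limitProj j) = χ.comp (D.limitProj k) ∧
      (D.stage j).η.pushout ψ hψ = (D.stage k).η.pushout χ hχ := by
    intro j hj
    induction j, hj using Nat.le_induction with
    | base => exact ⟨χ, hχ, rfl, rfl⟩
    | succ j hj ih =>
      obtain ⟨ψ, hψ, h1, h2⟩ := ih
      refine ⟨ψ.comp (D.proj j), ?_, ?_, ?_⟩
      · rw [← AlgHom.comp_assoc, hψ]
        exact D.isMinimalTower.aug j
      · rw [AlgHom.comp_assoc, proj_comp_limitProj, h1]
      · rw [← h2, ← D.stage_succ_pushout j, Deformation.pushout_comp]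
  obtain ⟨ψ, hψ, h1, h2⟩ := key j hkj
  rw [← h2]
  exact Deformation.pushout_congr
    (algHom_eq_of_comp_eq (D.limitProj_surjective j) (h1.trans h)) _ _ _

theorem aug_of_comp_limitProj {k : ℕ} {χ : (D.stage k).base →ₐ[K] X}
    (h : εX.comp (χ.comp (D.limitProj k)) = D.limitAug) : εX.comp χ = (D.stage k).ε :=
  algHom_eq_of_comp_eq (D.limitProj_surjective k)
    (h.trans (D.aug_comp_limitProj k).symm)

/-- By cofinality every truncation of `C` is a quotient of some stage, so the levels of the limit
can be obtained from the `η_k`. -/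
theorem exists_stage_factor (n : ℕ) : ∃ (k : ℕ) (χ : (D.stage k).base →ₐ[K] Trunc D.limitAug n),
    χ.comp (D.limitProj k) = truncMk D.limitAug n := by
  obtain ⟨k, hk⟩ := D.exists_ker_limitProj_le (n + 1)
  exact ⟨k, exists_algHom_of_ker_le (D.limitProj_surjective k) _ (by rwa [ker_truncMk])⟩

theorem truncProj_comp_truncMk (k n : ℕ)
    (h : (RingHom.ker D.limitAug) ^ (n + 1) ≤ RingHom.ker (D.limitProj k)) :
    (D.truncProj k n h).comp (truncMk D.limitAug n) = D.limitProj k := rfl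

theorem exists_isLimit : ∃ eta : FormalDeformation br D.limitAug, D.IsLimit eta := by
  choose κ χ hχ using D.exists_stage_factor
  have hε : ∀ n, (truncAug D.limitAug n).comp (χ n) = (D.stage (κ n)).ε := fun n =>
    D.aug_of_comp_limitProj (by rw [hχ]; rfl)
  -- By `pushout_stage_eq` the choice of stage does not matter, which gives both compatibility and
  -- the limit property. The index `k + 1` occurs because stage `k` is a quotient of `C/𝔐ᵏ⁺²`.
  refine ⟨{ level := fun n => (D.stage (κ n)).η.pushout (χ n) (hε n)
            compat := fun n => ?_ }, fun k => ⟨k + 1, D.ker_pow_le_ker_limitProj k, ?_⟩⟩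
  · rw [Deformation.pushout_comp]
    refine D.pushout_stage_eq _ _ ?_
    rw [AlgHom.comp_assoc, hχ, hχ, truncMap_comp_truncMk]
  · rw [Deformation.pushout_comp]
    conv_rhs => rw [← (D.stage k).η.pushout_id]
    refine D.pushout_stage_eq _ _ ?_
    rw [AlgHom.comp_assoc, hχ, truncProj_comp_truncMk]
    rfl

variable {D}

/-- The push-out of a level of the limit is the push-out of a deformation `η_k`, if the two
homomorphisms agree on `C`. -/
theorem IsLimit.pushout_level {eta : FormalDeformation br D.limitAug} (h : D.IsLimit eta) {k n : ℕ}
    {g : Trunc D.limitAug n →ₐ[K] X} (hg : εX.comp g = truncAug D.limitAug n)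
    {χ : (D.stage k).base →ₐ[K] X} (hχ : εX.comp χ = (D.stage k).ε)
    (hgχ : g.comp (truncMk D.limitAug n) = χ.comp (D.limitProj k)) :
    (eta.level n).pushout g hg = (D.stage k).η.pushout χ hχ := by
  obtain ⟨m, hm, hmk⟩ := h k
  -- Both sides become push-outs of the level `max n m` of `eta` along homomorphisms that agree on
  -- `C`.
  rw [← hmk, ← eta.level_pushout (le_max_left n m), ← eta.level_pushout (le_max_right n m),
    Deformation.pushout_comp, Deformation.pushout_comp, Deformation.pushout_comp]
  refine Deformation.pushout_congr (algHom_eq_of_comp_eq (truncMk_surjective _) ?_) _ _ _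
  rw [AlgHom.comp_assoc, AlgHom.comp_assoc, AlgHom.comp_assoc, truncLE_comp_truncMk,
    truncLE_comp_truncMk, truncProj_comp_truncMk, hgχ]

theorem IsLimit.unique {eta eta' : FormalDeformation br D.limitAug} (h : D.IsLimit eta)
    (h' : D.IsLimit eta') : eta' = eta := by
  refine FormalDeformation.ext (funext fun n => ?_)
  obtain ⟨k, χ, hχ⟩ := D.exists_stage_factor n
  have hε : (truncAug D.limitAug n).comp χ = (D.stage k).ε :=
    D.aug_of_comp_limitProj (by rw [hχ]; rfl)
  rw [← (eta.level n).pushout_id, ← (eta'.level n).pushout_id,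
    h.pushout_level (AlgHom.comp_id _) hε hχ.symm, h'.pushout_level (AlgHom.comp_id _) hε hχ.symm]

/-- The levels of a push-out of the limit. -/
theorem IsLimit.level_pushout {eta : FormalDeformation br D.limitAug} (h : D.IsLimit eta)
    {A : Type*} [CommRing A] [Algebra K A] {ε : A →ₐ[K] K} {f : D.limitBase →ₐ[K] A}
    (hf : ε.comp f = D.limitAug) {k n : ℕ} {χ : (D.stage k).base →ₐ[K] Trunc ε n}
    (hχ : (truncAug ε n).comp χ = (D.stage k).ε)
    (hfχ : (truncMk ε n).comp f = χ.comp (D.limitProj k)) :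
    (eta.pushout f hf).level n = (D.stage k).η.pushout χ hχ :=
  h.pushout_level (truncAug_comp_truncHom f hf n) hχ hfχ

end Construction

/-! ### Truncations of a complete local base. -/

section Trunc

variable {K : Type*} [Field K] {L : Type*} [AddCommGroup L] [Module K L]
variable {br : LeibnizBracket K L}
variable {A : Type*} [CommRing A] [Algebra K A] {ε : A →ₐ[K] K}

theorem ker_truncAug_pow (n : ℕ) : RingHom.ker (truncAug ε n) ^ (n + 1) = ⊥ := by
  rw [← map_ker_aug (truncMk_surjective n) (truncAug_comp_truncMk n), ← Ideal.map_pow]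
  exact Ideal.map_quotient_self _

theorem isNilpotent_ker_truncAug (n : ℕ) : IsNilpotent (RingHom.ker (truncAug ε n)) :=
  ⟨n + 1, ker_truncAug_pow n⟩

theorem truncMap_surjective (n : ℕ) : Function.Surjective (truncMap ε n) := fun x => by
  obtain ⟨a, rfl⟩ := truncMk_surjective n x
  exact ⟨truncMk ε (n + 1) a, rfl⟩

/-- The kernel is the image of `𝔐ⁿ⁺¹/𝔐ⁿ⁺²`, which is where the finiteness condition on a complete
local algebra enters. -/
theorem finite_ker_truncMap (hA : IsCompleteLocal ε) (n : ℕ) :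
    FiniteDimensional K (truncMap ε n).toLinearMap.ker := by
  have := hA.finite (n + 1)
  let F := Submodule.mapQ (((RingHom.ker ε) ^ (n + 1 + 1)).submoduleOf ((RingHom.ker ε) ^ (n + 1)))
    ((RingHom.ker ε) ^ (n + 1 + 1)) ((RingHom.ker ε) ^ (n + 1)).subtype le_rfl
  have hle : (truncMap ε n).toLinearMap.ker ≤ (F.restrictScalars K).range := by
    intro x hx
    obtain ⟨a, rfl⟩ := truncMk_surjective (n + 1) x
    have ha : a ∈ (RingHom.ker ε) ^ (n + 1) := Ideal.Quotient.eq_zero_iff_mem.1 hx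
    exact ⟨Submodule.Quotient.mk ⟨a, ha⟩, rfl⟩
  exact Submodule.finiteDimensional_of_le hle

theorem mul_of_truncMap_eq_zero {n : ℕ} (b w : Trunc ε (n + 1)) (hw : truncMap ε n w = 0) :
    b * w = truncAug ε (n + 1) b • w := by
  obtain ⟨a, rfl⟩ := truncMk_surjective (n + 1) b
  obtain ⟨m, rfl⟩ := truncMk_surjective (n + 1) w
  have hm : m ∈ (RingHom.ker ε) ^ (n + 1) := Ideal.Quotient.eq_zero_iff_mem.1 hw
  have h1 : (a - algebraMap K A (ε a)) * m ∈ (RingHom.ker ε) ^ (n + 1 + 1) := by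
    rw [pow_succ' _ (n + 1)]
    exact Ideal.mul_mem_mul (sub_algebraMap_mem_ker a) hm
  have h2 : truncMk ε (n + 1) ((a - algebraMap K A (ε a)) * m) = 0 :=
    Ideal.Quotient.eq_zero_iff_mem.2 h1
  have h3 : truncAug ε (n + 1) (truncMk ε (n + 1) a) = ε a := rfl
  rw [sub_mul, ← Algebra.smul_def, map_sub, map_mul, map_smul, sub_eq_zero] at h2
  rw [h2, h3]

theorem exists_smallExt_truncMap (hA : IsCompleteLocal ε) (n : ℕ) :
    ∃ m, Nonempty (SmallExt (truncMap ε n) (truncAug ε (n + 1)) m) := by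
  have := finite_ker_truncMap hA n
  exact SmallExt.exists _ _ (truncMap_surjective n) mul_of_truncMap_eq_zero

/-- A compatible family of morphisms is an equivalence of formal deformations. -/
theorem FormalDeformation.equivalent_of_levels {lam mu : FormalDeformation br ε}
    (ρ : ∀ n, Trunc ε n ⊗[K] L →ₗ[Trunc ε n] Trunc ε n ⊗[K] L)
    (hρ : ∀ n, IsMorphism (ρ n) (lam.level n) (mu.level n))
    (hc : ∀ n t, baseMap L (truncMap ε n).toLinearMap (ρ (n + 1) t)
      = ρ n (baseMap L (truncMap ε n).toLinearMap t)) : lam.Equivalent mu := by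
  have hbij : ∀ n, Function.Bijective (ρ n) := fun n =>
    bijective_of_aug (isNilpotent_ker_truncAug n) (hρ n).aug
  let F : CompletedTensor ε L →ₗ[A] CompletedTensor ε L :=
    { toFun := fun x => ⟨fun n => ρ n (x.1 n), fun n => by rw [hc, x.2 n]⟩
      map_add' := fun x y => by ext n; simp
      map_smul' := fun a x => by
        ext n
        exact LinearMap.map_smul_of_tower (ρ n) a (x.1 n) }
  have hF : Function.Bijective F := by
    refine ⟨fun x y hxy => ?_, fun y => ?_⟩
    · refine Subtype.ext (funext fun n => (hbij n).1 ?_)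
      exact congrFun (congrArg Subtype.val hxy) n
    · choose x hx using fun n => (hbij n).2 (y.1 n)
      refine ⟨⟨x, fun n => (hbij n).1 ?_⟩, Subtype.ext (funext hx)⟩
      rw [← hc, hx, hx]
      exact y.2 n
  refine ⟨LinearEquiv.ofBijective F hF, fun x y => ?_, fun x => (hρ 0).aug (x.1 0)⟩
  exact Subtype.ext (funext fun n => (hρ n).bracket (x.1 n) (y.1 n))

theorem FormalDeformation.Equivalent.symm {lam mu : FormalDeformation br ε}
    (h : lam.Equivalent mu) : mu.Equivalent lam := by
  obtain ⟨ρ, h1, h2⟩ := h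
  refine ⟨ρ.symm, fun x y => ?_, fun x => ?_⟩
  · rw [LinearEquiv.symm_apply_eq, h1, LinearEquiv.apply_symm_apply, LinearEquiv.apply_symm_apply]
  · rw [← h2, LinearEquiv.apply_symm_apply]

theorem FormalDeformation.Equivalent.trans {lam mu nu : FormalDeformation br ε}
    (h : lam.Equivalent mu) (h' : mu.Equivalent nu) : lam.Equivalent nu := by
  obtain ⟨ρ, h1, h2⟩ := h
  obtain ⟨ρ', h1', h2'⟩ := h'
  refine ⟨ρ.trans ρ', fun x y => ?_, fun x => ?_⟩
  · simp only [LinearEquiv.trans_apply, h1, h1']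
  · rw [LinearEquiv.trans_apply, h2', h2]

theorem exists_algHom_of_compatible {R : Type*} [CommRing R] [Algebra K R] {εR : R →ₐ[K] K}
    (hA : IsAdicComplete (RingHom.ker ε) A) (ψ : ∀ n, R →ₐ[K] Trunc ε n)
    (hψ : ∀ n, (truncMap ε n).comp (ψ (n + 1)) = ψ n) (h0 : (truncAug ε 0).comp (ψ 0) = εR) :
    ∃ f : R →ₐ[K] A, ε.comp f = εR ∧ ∀ n, (truncMk ε n).comp f = ψ n := by
  have hLE : ∀ m n (h : m ≤ n), (truncLE ε h).comp (ψ n) = ψ m := by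
    intro m n h
    induction n, h using Nat.le_induction with
    | base =>
      refine AlgHom.ext fun x => ?_
      obtain ⟨a, ha⟩ := truncMk_surjective m (ψ m x)
      rw [AlgHom.comp_apply, ← ha]
      rfl
    | succ n h ih =>
      rw [← ih, ← hψ n]
      refine AlgHom.ext fun x => ?_
      obtain ⟨a, ha⟩ := truncMk_surjective (n + 1) (ψ (n + 1) x)
      rw [AlgHom.comp_apply, AlgHom.comp_apply, AlgHom.comp_apply, ← ha]
      rfl
  -- `Trunc` begins with the first power of the ideal, whereas adic completeness asks for quotients
  -- by all powers; `F n` is `ψ n` reduced by one power.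
  let F : ∀ n, R →ₐ[K] A ⧸ RingHom.ker ε ^ n := fun n =>
    (Ideal.Quotient.factorₐ K (Ideal.pow_le_pow_right (Nat.le_succ n))).comp (ψ n)
  have hF : ∀ {m n : ℕ} (hle : m ≤ n), (Ideal.Quotient.factorₐ K (Ideal.pow_le_pow_right hle)).comp
      (F n) = F m := by
    intro m n hle
    refine AlgHom.ext fun x => ?_
    obtain ⟨a, ha⟩ := truncMk_surjective n (ψ n x)
    have h1 := DFunLike.congr_fun (hLE m n hle) x
    rw [AlgHom.comp_apply, ← ha] at h1
    rw [AlgHom.comp_apply, AlgHom.comp_apply, AlgHom.comp_apply, ← ha, ← h1]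
    rfl
  let f := IsAdicComplete.liftAlgHom (RingHom.ker ε) F hF
  have hf : ∀ n, (truncMk ε n).comp f = ψ n := fun n => by
    refine AlgHom.ext fun x => ?_
    have h1 : Ideal.Quotient.mk (RingHom.ker ε ^ (n + 1)) (f x) = F (n + 1) x :=
      IsAdicComplete.mk_liftAlgHom _ F hF (n + 1) x
    rw [← hψ n]
    exact h1
  refine ⟨f, ?_, hf⟩
  rw [← h0, ← hf 0, ← AlgHom.comp_assoc, truncAug_comp_truncMk]

/-- By flatness `ε ⊗ id` is injective too, so the augmentation condition prescribes the bracket.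
Over `A/𝔐` this starts the induction for versality. -/
theorem Deformation.eq_of_aug_injective (hε : Function.Injective ε) (lam mu : Deformation br ε) :
    lam = mu := by
  refine Deformation.ext_gen fun x y => ?_
  have h1 : Function.Injective (coeff L ε.toLinearMap) := by
    rw [coeff, LinearMap.coe_comp]
    exact (TensorProduct.lid K L).injective.comp
      (Module.Flat.rTensor_preserves_injective_linearMap _ hε)
  refine h1 ?_
  rw [lam.coeff_one_tmul, mu.coeff_one_tmul]

theorem truncAug_zero_injective : Function.Injective (truncAug ε 0) := by
  rw [injective_iff_map_eq_zero]
  intro x hx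
  obtain ⟨a, rfl⟩ := truncMk_surjective 0 x
  have ha : a ∈ RingHom.ker ε ^ (0 + 1) := by rw [zero_add, pow_one]; exact hx
  exact Ideal.Quotient.eq_zero_iff_mem.2 ha

end Trunc

/-! ### Existence part of versality. -/

namespace Construction

variable {K : Type u} [Field K] {L : Type v} [AddCommGroup L] [Module K L]
variable {br : LeibnizBracket K L} [FiniteDimensional K (HL2 br)] {D : Construction br}

variable (D) in
theorem exists_isInfinitesimalFamily (k : ℕ) :
    ∃ d, IsInfinitesimalFamily br (D.stage k).η D.μ d := by
  induction k with
  | zero => exact ⟨_, isInfinitesimalFamily_first br D.μ⟩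
  | succ k ih =>
    obtain ⟨d, hd⟩ := ih
    exact ⟨_, hd.comp (D.isMinimalTower.aug k) (D.stage_succ_pushout k)⟩

variable {A : Type*} [CommRing A] [Algebra K A] {ε : A →ₐ[K] K}

variable (D) in
/-- A homomorphism from `C_{n+1}` to a truncation of the base of a formal deformation together with
an isomorphism of the deformation with the push-out. -/
structure LevelMorphism (lam : FormalDeformation br ε) (n : ℕ) where
  φ : (D.stage n).base →ₐ[K] Trunc ε n
  hφ : (truncAug ε n).comp φ = (D.stage n).ε
  ρ : Trunc ε n ⊗[K] L →ₗ[Trunc ε n] Trunc ε n ⊗[K] L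
  hρ : IsMorphism ρ (lam.level n) ((D.stage n).η.pushout φ hφ)

theorem nonempty_levelMorphism_zero (lam : FormalDeformation br ε) :
    Nonempty (LevelMorphism D lam 0) := by
  let φ : (D.stage 0).base →ₐ[K] Trunc ε 0 := (Algebra.ofId K _).comp (D.stage 0).ε
  have hφ : (truncAug ε 0).comp φ = (D.stage 0).ε := AlgHom.ext fun x => by
    simp [φ, Algebra.ofId_apply]
  refine ⟨⟨φ, hφ, LinearMap.id, ?_⟩⟩
  rw [Deformation.eq_of_aug_injective truncAug_zero_injective (lam.level 0)
    ((D.stage 0).η.pushout φ hφ)]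
  exact IsMorphism.id _

theorem LevelMorphism.exists_succ (hA : IsCompleteLocal ε) {lam : FormalDeformation br ε} {n : ℕ}
    (x : LevelMorphism D lam n) : ∃ y : LevelMorphism D lam (n + 1),
      (truncMap ε n).comp y.φ = x.φ.comp (D.proj n) ∧
      ∀ t, baseMap L (truncMap ε n).toLinearMap (y.ρ t)
        = x.ρ (baseMap L (truncMap ε n).toLinearMap t) := by
  obtain ⟨m, ⟨E⟩⟩ := exists_smallExt_truncMap hA n
  obtain ⟨d, hd⟩ := D.exists_isInfinitesimalFamily (n + 1)
  have hρ : IsMorphism x.ρ ((lam.level (n + 1)).pushout (truncMap ε n)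
      (truncAug_comp_truncMap ε n)) ((D.stage n).η.pushout x.φ x.hφ) := by
    rw [lam.compat]
    exact x.hρ
  obtain ⟨φ, hφ, ρ, h1, h2, h3⟩ := (D.step n (D.stage n)).exists_lift D.μ_class hd
    (truncAug_comp_truncMap ε n) E (isNilpotent_ker_truncAug (n + 1)) (lam.level (n + 1)) x.hφ hρ
  exact ⟨⟨φ, hφ, ρ, h2⟩, h1, h3⟩

/-- The limit satisfies the existence part of versality. -/
theorem IsLimit.exists_equivalent {eta : FormalDeformation br D.limitAug} (h : D.IsLimit eta)
    (hA : IsCompleteLocal ε) (lam : FormalDeformation br ε) :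
    ∃ (f : D.limitBase →ₐ[K] A) (hf : ε.comp f = D.limitAug),
      lam.Equivalent (eta.pushout f hf) := by
  obtain ⟨x₀⟩ := nonempty_levelMorphism_zero (D := D) lam
  -- Each level extends the preceding one exactly, so homomorphisms and isomorphisms both pass to
  -- the limit.
  obtain ⟨x, -, hx⟩ := exists_seq_of_forall_exists x₀ fun n x =>
    LevelMorphism.exists_succ hA x
  obtain ⟨f, hf, hfψ⟩ := exists_algHom_of_compatible (εR := D.limitAug) hA.isAdicComplete
    (fun n => (x n).φ.comp (D.limitProj n))
    (fun n => by rw [← AlgHom.comp_assoc, (hx n).1, AlgHom.comp_assoc, proj_comp_limitProj])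
    (by rw [← AlgHom.comp_assoc, (x 0).hφ]; rfl)
  refine ⟨f, hf, FormalDeformation.equivalent_of_levels (fun n => (x n).ρ) (fun n => ?_)
    fun n => (hx n).2⟩
  rw [h.level_pushout hf (x n).hφ (hfψ n)]
  exact (x n).hρ

end Construction

/-! ### Invariance of the infinitesimal class. -/

section Uniqueness

variable {K : Type*} [Field K] {L : Type*} [AddCommGroup L] [Module K L]
variable {br : LeibnizBracket K L}
variable {A : Type*} [CommRing A] [Algebra K A] {ε : A →ₐ[K] K}

theorem coeff_derivation_smul {d : A →ₗ[K] K} (hd : ∀ a b, d (a * b) = ε a * d b + ε b * d a)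
    (a : A) (t : A ⊗[K] L) :
    coeff L d (a • t) = ε a • coeff L d t + d a • coeff L ε.toLinearMap t := by
  induction t using TensorProduct.induction_on with
  | zero => simp
  | add x y hx hy => simp only [smul_add, map_add, hx, hy]; abel
  | tmul b l =>
    simp only [TensorProduct.smul_tmul', smul_eq_mul, coeff_tmul, hd, AlgHom.toLinearMap_apply]
    module

theorem Deformation.coeff_derivation (lam : Deformation br ε) {d : A →ₗ[K] K}
    (hd : ∀ a b, d (a * b) = ε a * d b + ε b * d a) (s t : A ⊗[K] L) :
    coeff L d (lam.bracket s t)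
      = coeff L d (lam.bracket (1 ⊗ₜ coeff L ε.toLinearMap s) (1 ⊗ₜ coeff L ε.toLinearMap t))
        + br.bracket (coeff L d s) (coeff L ε.toLinearMap t)
        + br.bracket (coeff L ε.toLinearMap s) (coeff L d t) := by
  have hg : ∀ x y : L, coeff L d (lam.bracket (1 ⊗ₜ x) (1 ⊗ₜ y))
      = coeff L d (gen lam.bracket x y) :=
    fun _ _ => rfl
  rw [hg]
  induction s using TensorProduct.induction_on with
  | zero => simp
  | add x y hx hy => simp only [map_add, LinearMap.add_apply, hx, hy]; abel
  | tmul a x =>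
    induction t using TensorProduct.induction_on with
    | zero => simp
    | add y z hy hz => simp only [map_add, hy, hz]; abel
    | tmul b y =>
      rw [bilin_tmul, coeff_derivation_smul hd, coeff_derivation_smul hd, coeff_smul,
        lam.coeff_one_tmul, hg]
      simp only [coeff_tmul, map_smul, LinearMap.smul_apply, AlgHom.toLinearMap_apply]
      module

/-- The element `1 ⊗ l` of the completed tensor product. -/
def completedTmul (ε : A →ₐ[K] K) (l : L) : CompletedTensor ε L :=
  ⟨fun _ => 1 ⊗ₜ l, fun n => by simp⟩

/-- If `𝔐² = 0`, all truncations from index `1` on coincide with `A`, so level `1` determines the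
others. -/
theorem completed_ext_of_sq (hε : RingHom.ker ε ^ 2 = ⊥) {x y : CompletedTensor ε L}
    (h : x.1 1 = y.1 1) : x = y := by
  have hinj : ∀ n, Function.Injective (baseMap L (truncMap ε (n + 1)).toLinearMap) := fun n => by
    refine Module.Flat.rTensor_preserves_injective_linearMap _ ?_
    change Function.Injective (truncMap ε (n + 1))
    rw [injective_iff_map_eq_zero]
    intro b hb
    obtain ⟨a, rfl⟩ := truncMk_surjective _ b
    have ha : a ∈ RingHom.ker ε ^ (n + 2) := Ideal.Quotient.eq_zero_iff_mem.1 hb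
    rw [pow_add, hε, Ideal.mul_bot, Ideal.mem_bot] at ha
    rw [ha, map_zero]
  refine Subtype.ext (funext fun n => ?_)
  rcases n with _ | n
  · rw [← x.2 0, ← y.2 0]
    exact congrArg _ h
  · induction n with
    | zero => exact h
    | succ n ih =>
      refine hinj n ?_
      rw [x.2 (n + 1), y.2 (n + 1), ih]

theorem trunc_smul (a : A) (n : ℕ) (t : Trunc ε n ⊗[K] L) : a • t = truncMk ε n a • t := by
  induction t using TensorProduct.induction_on with
  | zero => simp
  | add x y hx hy => simp only [smul_add, hx, hy]
  | tmul b l => rfl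

/-- If `𝔐² = 0`, the coefficients of equivalent formal deformations along a derivation are
cohomologous. -/
theorem FormalDeformation.Equivalent.coeff_sub (hε : RingHom.ker ε ^ 2 = ⊥)
    {lam mu : FormalDeformation br ε} (h : lam.Equivalent mu) {d : Trunc ε 1 →ₗ[K] K}
    (hd : ∀ a b, d (a * b) = truncAug ε 1 a * d b + truncAug ε 1 b * d a) :
    ∃ g : L →ₗ[K] L, ∀ x y, coeff L d ((lam.level 1).bracket (1 ⊗ₜ x) (1 ⊗ₜ y))
      = coeff L d ((mu.level 1).bracket (1 ⊗ₜ x) (1 ⊗ₜ y)) + d1 br g x y := by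
  obtain ⟨ρ, hρ, hρε⟩ := h
  have haug : ∀ x : CompletedTensor ε L,
      coeff L (truncAug ε 1).toLinearMap (x.1 1) = completedAug x := fun x => by
    rw [completedAug, ← x.2 0, coeff_baseMap (truncMap ε 0) (truncAug_comp_truncMap ε 0)]
  have h1 : ∀ l : L, coeff L (truncAug ε 1).toLinearMap ((ρ (completedTmul ε l)).1 1) = l :=
    fun l => by
      rw [haug, hρε]
      simp [completedAug, completedTmul]
  -- The coefficient of `ρ` along `d`; its coboundary accounts for the difference of the two
  -- brackets.
  let g : L →ₗ[K] L :=
    { toFun := fun l => coeff L d ((ρ (completedTmul ε l)).1 1)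
      map_add' := fun l l' => by
        have h2 : completedTmul ε (l + l') = completedTmul ε l + completedTmul ε l' :=
          Subtype.ext (funext fun n => TensorProduct.tmul_add _ _ _)
        rw [h2, map_add, ← map_add (coeff L d)]
        rfl
      map_smul' := fun k l => by
        have h2 : completedTmul ε (k • l) = algebraMap K A k • completedTmul ε l :=
          Subtype.ext (funext fun n => by
            change (1 : Trunc ε n) ⊗ₜ[K] (k • l) = algebraMap K A k • ((1 : Trunc ε n) ⊗ₜ[K] l)
            rw [algebraMap_smul, TensorProduct.tmul_smul])
        rw [h2, map_smul, RingHom.id_apply, ← map_smul (coeff L d)]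
        change coeff L d (algebraMap K A k • (ρ (completedTmul ε l)).1 1) = _
        rw [algebraMap_smul] }
  have hg : ∀ l, coeff L d ((ρ (completedTmul ε l)).1 1) = g l := fun _ => rfl
  have hd1 : d 1 = 0 := by
    have h2 := hd 1 1
    simp only [mul_one, map_one, one_mul] at h2
    linear_combination -h2
  have key : ∀ z : CompletedTensor ε L, coeff L d ((ρ z).1 1)
      = coeff L d (z.1 1) + g (coeff L (truncAug ε 1).toLinearMap (z.1 1)) := by
    -- Since `ρ` lives on the completed tensor product, a tensor of level `1` is first lifted there;
    -- the lift is unique by `completed_ext_of_sq`.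
    have hex : ∀ t : Trunc ε 1 ⊗[K] L, ∃ z : CompletedTensor ε L, z.1 1 = t ∧
        coeff L d ((ρ z).1 1) = coeff L d t + g (coeff L (truncAug ε 1).toLinearMap t) := by
      intro t
      induction t using TensorProduct.induction_on with
      | zero => exact ⟨0, rfl, by simp⟩
      | add s t hs ht =>
        obtain ⟨x, hx, hx'⟩ := hs
        obtain ⟨y, hy, hy'⟩ := ht
        refine ⟨x + y, by rw [← hx, ← hy]; rfl, ?_⟩
        have h2 : (ρ (x + y)).1 1 = (ρ x).1 1 + (ρ y).1 1 := by rw [map_add]; rfl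
        rw [h2, map_add, hx', hy']
        simp only [map_add]
        abel
      | tmul b l =>
        obtain ⟨a, rfl⟩ := truncMk_surjective 1 b
        refine ⟨a • completedTmul ε l, ?_, ?_⟩
        · change a • ((1 : Trunc ε 1) ⊗ₜ[K] l) = _
          rw [trunc_smul, ← one_tmul_smul]
        · have h2 : (ρ (a • completedTmul ε l)).1 1
              = truncMk ε 1 a • (ρ (completedTmul ε l)).1 1 := by
            rw [map_smul, ← trunc_smul]
            rfl
          rw [h2, coeff_derivation_smul hd, h1, hg]
          simp only [coeff_tmul, map_smul, AlgHom.toLinearMap_apply]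
          abel
    intro z
    obtain ⟨z', hz, hz'⟩ := hex (z.1 1)
    rwa [completed_ext_of_sq hε hz] at hz'
  refine ⟨g, fun x y => ?_⟩
  have h2 := key (lam.limitBracket.bracket (completedTmul ε x) (completedTmul ε y))
  rw [hρ] at h2
  change coeff L d ((mu.level 1).bracket ((ρ (completedTmul ε x)).1 1)
      ((ρ (completedTmul ε y)).1 1)) = coeff L d ((lam.level 1).bracket (1 ⊗ₜ x) (1 ⊗ₜ y))
      + g (coeff L (truncAug ε 1).toLinearMap ((lam.level 1).bracket (1 ⊗ₜ x) (1 ⊗ₜ y))) at h2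
  rw [(mu.level 1).coeff_derivation hd, h1, h1, hg, hg, (lam.level 1).coeff_one_tmul] at h2
  rw [← sub_eq_iff_eq_add.2 h2, d1]
  abel

end Uniqueness

/-! ### Homomorphisms are determined by cohomology classes. -/

section First

variable {K : Type u} [Field K] {L : Type v} [AddCommGroup L] [Module K L]
variable {br : LeibnizBracket K L}

/-- A homomorphism on the base of an infinitesimal family that exhausts the linear forms vanishing
at `1` is determined by the cohomology classes of the coefficients of the push-out. -/
theorem algHom_eq_of_cohomologous {N : Type*} [CommRing N] [Algebra K N] {εN : N →ₐ[K] K}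
    {ν : Deformation br εN} {μ : HL2 br →ₗ[K] Z2 br} {δ : HL2 br → N →ₗ[K] K}
    (hδ : IsInfinitesimalFamily br ν μ δ) (hμ : ∀ α, Submodule.Quotient.mk (μ α) = α)
    (hall : ∀ u : N →ₗ[K] K, u 1 = 0 → ∃ α, u = δ α)
    {B : Type*} [CommRing B] [Algebra K B] {εB : B →ₐ[K] K} {χ ψ : N →ₐ[K] B}
    (hχ : εB.comp χ = εN) (hψ : εB.comp ψ = εN)
    (hB : ∀ d : B →ₗ[K] K, d 1 = 0 → ∃ k : L →ₗ[K] L, ∀ x y,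
      coeff L d ((ν.pushout χ hχ).bracket (1 ⊗ₜ x) (1 ⊗ₜ y))
        = coeff L d ((ν.pushout ψ hψ).bracket (1 ⊗ₜ x) (1 ⊗ₜ y)) + d1 br k x y) :
    χ = ψ := by
  -- The forms `d ∘ χ` and `d ∘ ψ` are `δ α` and `δ β`, so the coefficients of the push-outs along
  -- `d` are `μ α` and `μ β`; being cohomologous, they give `α = β`.
  have key : ∀ d : B →ₗ[K] K, d 1 = 0 → ∀ a, d (χ a) = d (ψ a) := by
    intro d hd1 a
    obtain ⟨k, hk⟩ := hB d hd1
    obtain ⟨α, hα⟩ := hall (d ∘ₗ χ.toLinearMap) (by simp [hd1])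
    obtain ⟨β, hβ⟩ := hall (d ∘ₗ ψ.toLinearMap) (by simp [hd1])
    have h1 : ∀ x y, (μ α).1 x y = (μ β).1 x y + d1 br k x y := fun x y => by
      have h2 := hk x y
      rwa [Deformation.pushout_one_tmul, Deformation.pushout_one_tmul, coeff_baseMap_linear,
        coeff_baseMap_linear, hα, hβ, hδ.coeff, hδ.coeff] at h2
    have h3 : α = β := by
      rw [← hμ α, ← hμ β]
      refine (Submodule.Quotient.eq _).2 ⟨k, fun x y => ?_⟩
      change (μ α).1 x y - (μ β).1 x y = _
      rw [h1, add_sub_cancel_left]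
    rw [← h3, ← hα] at hβ
    exact (LinearMap.congr_fun hβ a).symm
  refine AlgHom.ext fun a => ?_
  rw [← sub_eq_zero, ← Module.forall_dual_apply_eq_zero_iff K]
  intro d
  -- The multiple of `εB` is harmless because `χ` and `ψ` both respect the augmentations.
  have h1 := key (d - d 1 • εB.toLinearMap) (by simp) a
  have h2 : εB (χ a) = εB (ψ a) := DFunLike.congr_fun (hχ.trans hψ.symm) a
  simp only [LinearMap.sub_apply, LinearMap.smul_apply, AlgHom.toLinearMap_apply, h2] at h1
  rw [map_sub]
  linear_combination h1

theorem form_eq_of_ker {A V : Type*} [CommRing A] [Algebra K A] {ε : A →ₐ[K] K}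
    [AddCommGroup V] [Module K V] {i : V →ₗ[K] A} (hi : ∀ x, ε x = 0 → ∃ v, x = i v)
    {r s : A →ₗ[K] K} (hr : r 1 = 0) (hs : s 1 = 0) (h : ∀ v, r (i v) = s (i v)) : r = s := by
  refine LinearMap.ext fun x => ?_
  obtain ⟨v, hv⟩ := hi _ (RingHom.mem_ker.1 (sub_algebraMap_mem_ker (ε := ε) x))
  rw [← sub_add_cancel x (algebraMap K A (ε x)), hv, Algebra.algebraMap_eq_smul_one, map_add,
    map_add, map_smul, map_smul, hr, hs, h]

/-- A form vanishing at `1` is determined on `ℍ'`, where by finite-dimensionality it is evaluation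
at a class of `ℍ`. -/
theorem exists_firstForm_eq [FiniteDimensional K (HL2 br)] {r : FirstBase br →ₗ[K] K}
    (hr : r 1 = 0) : ∃ α, r = firstForm br α := by
  obtain ⟨α, hα⟩ := (Module.evalEquiv K (HL2 br)).surjective (r ∘ₗ firstIncl br)
  exact ⟨α, form_eq_of_ker (ε := firstAug br) (i := firstIncl br)
    (fun x hx => ⟨x.2, HarrisonExt.ext hx rfl⟩) hr (firstForm_one br α)
    fun v => (LinearMap.congr_fun hα v).symm⟩

end First

/-! ### Uniqueness part of versality. -/

namespace Construction

variable {K : Type u} [Field K] {L : Type v} [AddCommGroup L] [Module K L]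
variable {br : LeibnizBracket K L} [FiniteDimensional K (HL2 br)] {D : Construction br}
variable {A : Type*} [CommRing A] [Algebra K A] {ε : A →ₐ[K] K}

/-- `ker (C → C₁)` lies in the square of the augmentation ideal of `C`, which `f` maps into `𝔐²`. -/
theorem exists_first_factor (f : D.limitBase →ₐ[K] A) (hf : ε.comp f = D.limitAug) :
    ∃ χ : (D.stage 0).base →ₐ[K] Trunc ε 1, (truncMk ε 1).comp f = χ.comp (D.limitProj 0) := by
  obtain ⟨χ, hχ⟩ := exists_algHom_of_ker_le (D.limitProj_surjective 0) ((truncMk ε 1).comp f)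
    fun x hx => by
      have h1 : f x ∈ RingHom.ker ε ^ (1 + 1) :=
        ker_pow_le_comap f hf 1 (D.ker_limitProj_zero_le hx)
      exact Ideal.Quotient.eq_zero_iff_mem.2 h1
  exact ⟨χ, hχ.symm⟩

/-- The limit satisfies the uniqueness part of versality. -/
theorem IsLimit.unique_algHom {eta : FormalDeformation br D.limitAug} (h : D.IsLimit eta)
    (hε : RingHom.ker ε ^ 2 = ⊥) {lam : FormalDeformation br ε} {f g : D.limitBase →ₐ[K] A}
    (hf : ε.comp f = D.limitAug) (hg : ε.comp g = D.limitAug)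
    (hlf : lam.Equivalent (eta.pushout f hf)) (hlg : lam.Equivalent (eta.pushout g hg)) :
    f = g := by
  obtain ⟨χ, hχ⟩ := exists_first_factor f hf
  obtain ⟨ψ, hψ⟩ := exists_first_factor g hg
  have hχε : (truncAug ε 1).comp χ = (D.stage 0).ε :=
    D.aug_of_comp_limitProj ((congrArg (fun t => (truncAug ε 1).comp t) hχ.symm).trans hf)
  have hψε : (truncAug ε 1).comp ψ = (D.stage 0).ε :=
    D.aug_of_comp_limitProj ((congrArg (fun t => (truncAug ε 1).comp t) hψ.symm).trans hg)
  have hχψ : χ = ψ := by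
    -- Both push-outs are equivalent to `lam`, hence to each other, so their coefficients along
    -- every derivation are cohomologous.
    refine algHom_eq_of_cohomologous (isInfinitesimalFamily_first br D.μ) D.μ_class
      (fun _ hr => exists_firstForm_eq hr) (εB := truncAug ε 1) hχε hψε fun d hd1 => ?_
    have hd : ∀ a b, d (a * b) = truncAug ε 1 a * d b + truncAug ε 1 b * d a :=
      form_mul hd1 fun x hx => by
        rw [(Submodule.mem_bot _).1 ((ker_truncAug_pow 1).le hx), map_zero]
    obtain ⟨k, hk⟩ := (hlf.symm.trans hlg).coeff_sub hε hd
    rw [h.level_pushout hf hχε hχ, h.level_pushout hg hψε hψ] at hk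
    exact ⟨k, hk⟩
  have h0 : (truncMk ε 1).comp f = (truncMk ε 1).comp g :=
    hχ.trans ((congrArg (fun t => t.comp (D.limitProj 0)) hχψ).trans hψ.symm)
  -- As `𝔐² = 0`, agreement in `A/𝔐²` is agreement in `A`.
  refine AlgHom.ext fun x => ?_
  have h1 : truncMk ε 1 (f x) = truncMk ε 1 (g x) := DFunLike.congr_fun h0 x
  have h2 : f x - g x ∈ RingHom.ker ε ^ (1 + 1) := Ideal.Quotient.eq.1 h1
  rw [hε, Ideal.mem_bot, sub_eq_zero] at h2
  exact h2

/-- The limit is a versal deformation. -/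
theorem IsLimit.isVersal {eta : FormalDeformation br D.limitAug} (h : D.IsLimit eta) :
    FormalDeformation.IsVersal.{w} eta :=
  ⟨fun _ _ _ _ hA lam => h.exists_equivalent hA lam,
   fun _ _ _ _ _ hε _ _ _ hf hg hlf hlg => h.unique_algHom hε hf hg hlf hlg⟩

end Construction

end LeibnizDeformation

end

theorem mainTheorem1 {K : Type u} [Field K] [CharZero K] {L : Type v} [AddCommGroup L] [Module K L]
    (br : LeibnizBracket K L) [FiniteDimensional K (HL2 br)] :
    Nonempty (Construction br) ∧
    ∀ D : Construction br,
      IsCompleteLocal D.limitAug ∧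
      ∃ eta : FormalDeformation br D.limitAug,
        D.IsLimit eta ∧ (∀ eta' : FormalDeformation br D.limitAug, D.IsLimit eta' → eta' = eta) ∧
        FormalDeformation.IsVersal.{w} eta := by
  refine ⟨nonempty_construction br, fun D => ⟨D.isCompleteLocal, ?_⟩⟩
  obtain ⟨eta, h⟩ := D.exists_isLimit
  exact ⟨eta, h, fun eta' h' => h.unique h', h.isVersal⟩
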